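/- Let $0<\varepsilon\le 1$ and $0<\lambda<1$ be constants. A coverage instance consists of a ground set $\mathcal E$ of $m$ elements and a family $\mathcal F$ of $n\ge 1$ subsets of $\mathcal E$ such that every element lies in at least one set of $\mathcal F$. In the (randomized) RAM model an algorithm knows $n$ and $m$ and has random access to the edge lists of the bipartite incidence graph of $\mathcal F$ and $\mathcal E$: the length of the list of any set or element, and any single entry of such a list, can be read in one unit of time. Arithmetic on words of $w$ bits, memory accesses, comparisons with conditional jumps, and the choice of a uniformly random number below a given word also take one unit of time each; the word length $w$ may be any number that is at least a sufficiently large constant multiple, depending on $\varepsilon$ and $\lambda$ only, of the binary length of $n+m$. Then there is a randomized algorithm (which may depend on $\varepsilon$ and $\lambda$) in the RAM model that, on every coverage instance, always halts within time $\tilde O(n)$, i.e. within $C\,n\,(1+\log n)^p$ steps, where $p$ is an absolute constant and $C$ depends only on $\varepsilon$ and $\lambda$ (and neither depends on $m$), and that with probability at least $1-\frac1n$ outputs a $(1+\varepsilon)\log\frac1\lambda$-approximate solution for set cover with $\lambda$ outliers, that is, a subfamily $\mathcal S\subseteq\mathcal F$ with $$\Bigl|\bigcup_{U\in\mathcal S}U\Bigr|\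 \ge\ (1-\lambda)\,m\qquad\text{and}\qquad |\mathcal S|\ \le\ \Bigl\lceil (1+\varepsilon)\,\log\tfrac1\lambda\cdot k^*\Bigr\rceil ,$$ where $k^*$ is the minimum number of sets of $\mathcal F$ that together cover all of $\mathcal E$, and $\log$ is the natural logarithm. -/

import Mathlib

open scoped ENNReal

namespace OutlierCover

/-- A coverage instance: `n` sets (indexed by `Fin n`) over a ground set of `m` elements, given as
a bipartite graph through the edge lists of all its vertices, in arbitrary order. No element is
isolated; two indices may carry the same set. -/
structure CoverInstance where
  n : ℕ
  m : ℕ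
  /-- the edge list of a set: the elements that it contains -/
  setList : Fin n → List (Fin m)
  /-- the edge list of an element: the sets that contain it -/
  elemList : Fin m → List (Fin n)
  setList_nodup : ∀ i, (setList i).Nodup
  elemList_nodup : ∀ v, (elemList v).Nodup
  mem_iff : ∀ i v, v ∈ setList i ↔ i ∈ elemList v
  no_isolated : ∀ v, elemList v ≠ []

namespace CoverInstance

/-- The union of the sets of a subfamily. -/
def covered (G : CoverInstance) (S : Finset (Fin G.n)) : Finset (Fin G.m) :=
  S.biUnion fun i => (G.setList i).toFinset

/-- The coverage function. -/
def coverage (G : CoverInstance) (S : Finset (Fin G.n)) : ℕ := (G.covered S).card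

/-- `S` is a (full) set cover. -/
def IsSetCover (G : CoverInstance) (S : Finset (Fin G.n)) : Prop :=
  G.covered S = Finset.univ

/-- `S` is an `α`-approximate solution to set cover with `lam` outliers: it covers at least a
`1 - lam` fraction of the elements, and its number of sets is at most `α` times the size of the
smallest set cover, rounded up to an integer. -/
def IsApproxSolution (G : CoverInstance) (lam α : ℝ) (S : Finset (Fin G.n)) : Prop :=
  (1 - lam) * (G.m : ℝ) ≤ (G.coverage S : ℝ) ∧
    ∀ T : Finset (Fin G.n), G.IsSetCover T → S.card ≤ ⌈α * (T.card : ℝ)⌉₊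

/-! Contents of the input cells; a lookup outside the input returns `0`. -/

/-- Number of elements of the `i`-th set. -/
def setDeg (G : CoverInstance) (i : ℕ) : ℕ :=
  if h : i < G.n then (G.setList ⟨i, h⟩).length else 0

/-- The `j`-th entry of the edge list of the `i`-th set. -/
def setEntry (G : CoverInstance) (i j : ℕ) : ℕ :=
  if h : i < G.n then ((G.setList ⟨i, h⟩).map Fin.val).getD j 0 else 0

/-- Number of sets that contain the element `v`. -/
def elemDeg (G : CoverInstance) (v : ℕ) : ℕ :=
  if h : v < G.m then (G.elemList ⟨v, h⟩).length else 0

/-- The `j`-th entry of the edge list of the element `v`. -/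
def elemEntry (G : CoverInstance) (v j : ℕ) : ℕ :=
  if h : v < G.m then ((G.elemList ⟨v, h⟩).map Fin.val).getD j 0 else 0

end CoverInstance

/-- Arithmetic operations of the machine. -/
inductive ArithOp
  | add
  | sub
  | mul
  | div
  | mod

/-- Value of an arithmetic operation on naturals (truncated subtraction, integer division). -/
def ArithOp.eval : ArithOp → ℕ → ℕ → ℕ
  | .add, x, y => x + y
  | .sub, x, y => x - y
  | .mul, x, y => x * y
  | .div, x, y => x / y
  | .mod, x, y => x % y

/-- Instructions of a randomized random access machine with registers `R`, a memory `M`, and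
read-only random access to a coverage instance. -/
inductive Instr
  /-- `R[d] := k` -/
  | const (d k : ℕ)
  /-- `R[d] := R[a] o R[b]` -/
  | arith (o : ArithOp) (d a b : ℕ)
  /-- `R[d] := M[R[a]]` -/
  | load (d a : ℕ)
  /-- `M[R[a]] := R[b]` -/
  | store (a b : ℕ)
  /-- `R[d] :=` number of sets -/
  | numSets (d : ℕ)
  /-- `R[d] :=` number of elements -/
  | numElems (d : ℕ)
  /-- `R[d] :=` length of the edge list of the set `R[i]` -/
  | setDeg (d i : ℕ)
  /-- `R[d] :=` entry `R[j]` of the edge list of the set `R[i]` -/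
  | setEntry (d i j : ℕ)
  /-- `R[d] :=` length of the edge list of the element `R[v]` -/
  | elemDeg (d v : ℕ)
  /-- `R[d] :=` entry `R[j]` of the edge list of the element `R[v]` -/
  | elemEntry (d v j : ℕ)
  /-- `R[d] :=` a fresh uniformly random number in `{0, …, R[a] - 1}` (`0` if `R[a] = 0`) -/
  | rand (d a : ℕ)
  /-- append `R[a]` to the output -/
  | output (a : ℕ)
  /-- continue with instruction number `l` if `R[a] < R[b]` -/
  | jumpLt (a b l : ℕ)

/-- A program; it halts when the program counter leaves the list. -/
abbrev Program := List Instr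

/-- A configuration of the machine. -/
structure Config where
  pc : ℕ
  reg : ℕ → ℕ
  mem : ℕ → ℕ
  out : List ℕ

/-- The initial configuration: everything is zero, nothing has been output. -/
def Config.init : Config := ⟨0, fun _ => 0, fun _ => 0, []⟩

/-- Write `x` (reduced to a word of `w` bits) to register `d` and go to the next instruction. -/
def Config.write (w : ℕ) (c : Config) (d x : ℕ) : Config :=
  { c with pc := c.pc + 1, reg := Function.update c.reg d (x % 2 ^ w) }

/-- Has the program `P` halted in configuration `c`? -/
def Halted (P : Program) (c : Config) : Prop := P.length ≤ c.pc

/-- The uniform distribution on `{0, …, x - 1}`; the point mass at `0` if `x = 0`. -/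
noncomputable def uniformBelow : ℕ → PMF ℕ
  | 0 => PMF.pure 0
  | x + 1 => (PMF.uniformOfFintype (Fin (x + 1))).map Fin.val

/-- The effect of one instruction on a machine with words of `w` bits, which takes one unit of
time. -/
noncomputable def exec (G : CoverInstance) (w : ℕ) (c : Config) : Instr → PMF Config
  | .const d k => PMF.pure (c.write w d k)
  | .arith o d a b => PMF.pure (c.write w d (o.eval (c.reg a) (c.reg b)))
  | .load d a => PMF.pure (c.write w d (c.mem (c.reg a)))
  | .store a b =>
      PMF.pure { c with pc := c.pc + 1, mem := Function.update c.mem (c.reg a) (c.reg b) }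
  | .numSets d => PMF.pure (c.write w d G.n)
  | .numElems d => PMF.pure (c.write w d G.m)
  | .setDeg d i => PMF.pure (c.write w d (G.setDeg (c.reg i)))
  | .setEntry d i j => PMF.pure (c.write w d (G.setEntry (c.reg i) (c.reg j)))
  | .elemDeg d v => PMF.pure (c.write w d (G.elemDeg (c.reg v)))
  | .elemEntry d v j => PMF.pure (c.write w d (G.elemEntry (c.reg v) (c.reg j)))
  | .rand d a => (uniformBelow (c.reg a)).map fun x => c.write w d x
  | .output a => PMF.pure { c with pc := c.pc + 1, out := c.out ++ [c.reg a] }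
  | .jumpLt a b l => PMF.pure { c with pc := if c.reg a < c.reg b then l else c.pc + 1 }

/-- One step of the machine; a halted configuration does not change. -/
noncomputable def step (P : Program) (G : CoverInstance) (w : ℕ) (c : Config) : PMF Config :=
  match P[c.pc]? with
  | none => PMF.pure c
  | some ins => exec G w c ins

/-- The distribution of the configuration after `t` steps. -/
noncomputable def run (P : Program) (G : CoverInstance) (w : ℕ) : ℕ → PMF Config
  | 0 => PMF.pure Config.init
  | t + 1 => (run P G w t).bind (step P G w)

/-- The subfamily whose indices have been output. -/
def outputFamily (G : CoverInstance) (c : Config) : Finset (Fin G.n) :=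
  Finset.univ.filter fun i => (i : ℕ) ∈ c.out

/-- The output consists of indices of sets and forms an `α`-approximate solution to set cover with
`lam` outliers. -/
def Correct (G : CoverInstance) (lam α : ℝ) (c : Config) : Prop :=
  (∀ x ∈ c.out, x < G.n) ∧ G.IsApproxSolution lam α (outputFamily G c)

end OutlierCover

set_option linter.constructorNameAsVariable false


/-! The algorithm solves the problem on random samples. With `L` the binary length of `n`, it draws
`A * n * L` elements uniformly and independently. For a guess `k` of the optimum it looks only at
the first `A * k * L` samples, and only at the first `D` entries of each sample's list of sets,
where `D` is about `Q * n / k`. The entries read number at most `A * n * L * (Q + 1)`, whatever `k`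
and `m` are, which is why the running time does not depend on `m`.

Cutting the lists costs little (`sparse_of_cover`). Let `T` be a cover by at most `k` sets and
suppose that each set has at most `M` entries among the samples in `U`. Samples with uncut lists are
hit by `T`, so there are at most `k * M` of them; cut samples carry `D` entries each, so there are
at most `n * M / D ≤ k * M / Q`. Hence the largest set hits a fraction of about `Q / ((Q + 1) * k)`
of any `U`. Greedy with geometrically decreasing thresholds loses one more factor `Q / (Q + 1)`, so
each pick multiplies the number of uncovered samples by at most `ratio Q k` (`GreedyInv.step`).
After about `a * k / b` picks the uncovered fraction is at most `exp (-(Q / (Q + 1)) ^ 2 * a / b) ≤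
p / q` (`GreedyInv.success`). Since `a / b` exceeds `log (1 / lam)`, all parameters can be chosen
with `p / q < lam` (`exists_suitable`).

Binary search over `k` ends with a guess that succeeded and is no larger than any cover
(`searchCmd_spec`). This holds for every outcome of the sampling. Randomness matters only for the
passage from samples to elements: a fixed family that misses at least `lam * m` elements misses few
samples with exponentially small probability (`sampleMem_tail`), and a union bound over all families
that the algorithm might output gives failure probability at most `1 / n` (`badSample_le`).

To run this on the machine, a small structured language is compiled to machine code with a
correctness and time guarantee (`Exec.reach`), and its commands are verified by weakest
preconditions. The sampling loop is the only random code and is written directly in machine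
instructions. Once the samples are fixed the rest is deterministic, so the final configuration is a
function of the samples (`exists_run_eq_map`). -/

namespace OutlierCover

/-! ### Runs of the machine from an arbitrary configuration -/

/-- The distribution of the configuration after `t` steps from the configuration `c`. -/
noncomputable def runFrom (P : Program) (G : CoverInstance) (w : ℕ) (c : Config) : ℕ → PMF Config
  | 0 => PMF.pure c
  | t + 1 => (runFrom P G w c t).bind (step P G w)

theorem run_eq_runFrom (P : Program) (G : CoverInstance) (w t : ℕ) :
    run P G w t = runFrom P G w Config.init t := by
  induction t with
  | zero => rfl
  | succ t ih => simp only [run, runFrom, ih]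

theorem runFrom_add (P : Program) (G : CoverInstance) (w : ℕ) (c : Config) (t u : ℕ) :
    runFrom P G w c (t + u) = (runFrom P G w c t).bind fun c' => runFrom P G w c' u := by
  induction u with
  | zero => simp [runFrom]
  | succ u ih => rw [← add_assoc]; simp only [runFrom, ih, PMF.bind_bind]

/-- The machine goes from `c` to `c'` in `t` steps with certainty. -/
def Reach (P : Program) (G : CoverInstance) (w : ℕ) (c : Config) (t : ℕ) (c' : Config) : Prop :=
  runFrom P G w c t = PMF.pure c'

theorem Reach.refl (P : Program) (G : CoverInstance) (w : ℕ) (c : Config) :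
    Reach P G w c 0 c := rfl

theorem Reach.trans {P : Program} {G : CoverInstance} {w : ℕ} {c c' c'' : Config} {t u : ℕ}
    (h : Reach P G w c t c') (h' : Reach P G w c' u c'') : Reach P G w c (t + u) c'' := by
  unfold Reach at *
  rw [runFrom_add, h, PMF.pure_bind, h']

theorem runFrom_one (P : Program) (G : CoverInstance) (w : ℕ) (c : Config) :
    runFrom P G w c 1 = step P G w c := by
  simp [runFrom]

theorem Reach.single {P : Program} {G : CoverInstance} {w : ℕ} {c c' : Config} {ins : Instr}
    (h : P[c.pc]? = some ins) (h' : exec G w c ins = PMF.pure c') : Reach P G w c 1 c' := by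
  rw [Reach, runFrom_one, step, h]
  exact h'

/-- Runs that halt early can be padded, so that one number of steps serves all outcomes of the
random choices. -/
theorem Reach.of_halted {P : Program} {G : CoverInstance} {w : ℕ} {c : Config}
    (h : Halted P c) (t : ℕ) : Reach P G w c t c := by
  induction t with
  | zero => exact Reach.refl P G w c
  | succ t ih =>
    refine ih.trans ?_
    rw [Reach, runFrom_one, step, List.getElem?_eq_none h]

/-- The list `code` stands in the program `P` from address `l` on. -/
def CodeAt (P : Program) (l : ℕ) (code : List Instr) : Prop :=
  ∃ p s, P = p ++ (code ++ s) ∧ p.length = l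

theorem CodeAt.left {P : Program} {l : ℕ} {u v : List Instr} (h : CodeAt P l (u ++ v)) :
    CodeAt P l u := by
  obtain ⟨p, s, h, h'⟩ := h
  exact ⟨p, v ++ s, by simp [h], h'⟩

theorem CodeAt.right {P : Program} {l : ℕ} {u v : List Instr} (h : CodeAt P l (u ++ v)) :
    CodeAt P (l + u.length) v := by
  obtain ⟨p, s, h, h'⟩ := h
  exact ⟨p ++ u, s, by simp [h], by simp [h']⟩

theorem CodeAt.tail {P : Program} {l : ℕ} {i : Instr} {v : List Instr} (h : CodeAt P l (i :: v)) :
    CodeAt P (l + 1) v :=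
  CodeAt.right (u := [i]) h

theorem CodeAt.head {P : Program} {l : ℕ} {i : Instr} {v : List Instr} (h : CodeAt P l (i :: v)) :
    P[l]? = some i := by
  obtain ⟨p, s, h, rfl⟩ := h
  simp [h]

/-- The effect of an instruction that is neither a jump nor a random choice. -/
def directExec (G : CoverInstance) (w : ℕ) (c : Config) : Instr → Config
  | .const d k => c.write w d k
  | .arith o d a b => c.write w d (o.eval (c.reg a) (c.reg b))
  | .load d a => c.write w d (c.mem (c.reg a))
  | .store a b => { c with pc := c.pc + 1, mem := Function.update c.mem (c.reg a) (c.reg b) }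
  | .numSets d => c.write w d G.n
  | .numElems d => c.write w d G.m
  | .setDeg d i => c.write w d (G.setDeg (c.reg i))
  | .setEntry d i j => c.write w d (G.setEntry (c.reg i) (c.reg j))
  | .elemDeg d v => c.write w d (G.elemDeg (c.reg v))
  | .elemEntry d v j => c.write w d (G.elemEntry (c.reg v) (c.reg j))
  | .output a => { c with pc := c.pc + 1, out := c.out ++ [c.reg a] }
  | _ => c

/-- Is the instruction neither a jump nor a random choice? -/
def Instr.direct : Instr → Bool
  | .rand _ _ => false
  | .jumpLt _ _ _ => false
  | _ => true

theorem exec_direct (G : CoverInstance) (w : ℕ) (c : Config) {i : Instr} (h : i.direct = true) :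
    exec G w c i = PMF.pure (directExec G w c i) ∧ (directExec G w c i).pc = c.pc + 1 := by
  cases i <;> first | exact ⟨rfl, rfl⟩ | simp [Instr.direct] at h

theorem Reach.block {P : Program} {G : CoverInstance} {w : ℕ} {code : List Instr} {c : Config}
    (h : CodeAt P c.pc code) (hd : code.all Instr.direct = true) :
    Reach P G w c code.length (code.foldl (directExec G w) c) := by
  induction code generalizing c with
  | nil => exact Reach.refl P G w c
  | cons i v ih =>
    simp only [List.all_cons, Bool.and_eq_true] at hd
    obtain ⟨h1, h2⟩ := exec_direct G w c hd.1
    have := (Reach.single h.head h1).trans (ih (c := directExec G w c i) (h2 ▸ h.tail) hd.2)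
    rwa [add_comm] at this

theorem Reach.jump {P : Program} {G : CoverInstance} {w a b l : ℕ} {c : Config}
    (h : P[c.pc]? = some (.jumpLt a b l)) :
    Reach P G w c 1 { c with pc := if c.reg a < c.reg b then l else c.pc + 1 } :=
  Reach.single h rfl

/-! ### A structured language -/

/-- Variables of the structured language. -/
inductive Var
  | n | m | L | x | S | ad | en | eight | lo | hi | mid | s | D | N | u | j | e | v | d | i
  | unc | t | tau | c | bn

/-- Arrays of the structured language. -/
inductive Arr
  | smp | head | cov | nxt | val | pick | best

instance : DecidableEq Var := fun x y =>
  if h : x.ctorIdx = y.ctorIdx then .isTrue (by cases x <;> cases y <;> first | rfl | cases h)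
  else .isFalse fun h' => h (h' ▸ rfl)

instance : DecidableEq Arr := fun x y =>
  if h : x.ctorIdx = y.ctorIdx then .isTrue (by cases x <;> cases y <;> first | rfl | cases h)
  else .isFalse fun h' => h (h' ▸ rfl)

theorem Var.ctorIdx_injective : Function.Injective Var.ctorIdx := fun x y h => by
  cases x <;> cases y <;> first | rfl | cases h

theorem Arr.ctorIdx_injective : Function.Injective Arr.ctorIdx := fun x y h => by
  cases x <;> cases y <;> first | rfl | cases h

/-- The arrays are interleaved in memory with stride 8, so offsets below 8 keep their cells apart.
-/
theorem Arr.ctorIdx_lt (a : Arr) : a.ctorIdx < 8 := by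
  cases a <;> decide

/-- Expressions. -/
inductive Expr
  | lit (k : ℕ)
  | var (x : Var)
  | bin (o : ArithOp) (e f : Expr)
  | arr (a : Arr) (e : Expr)
  | nSets
  | nElems
  | deg (e : Expr)
  | entry (e f : Expr)

/-- States; `tm` counts the executed commands. -/
structure St where
  var : Var → ℕ
  arr : Arr → ℕ → ℕ
  out : List ℕ
  tm : ℕ

/-- The value of an expression. -/
def Expr.eval (G : CoverInstance) (σ : St) : Expr → ℕ
  | .lit k => k
  | .var x => σ.var x
  | .bin o e f => o.eval (e.eval G σ) (f.eval G σ)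
  | .arr a e => σ.arr a (e.eval G σ)
  | .nSets => G.n
  | .nElems => G.m
  | .deg e => G.elemDeg (e.eval G σ)
  | .entry e f => G.elemEntry (e.eval G σ) (f.eval G σ)

/-- An operation does not overflow words below `W`. -/
def ArithOp.Safe (W : ℕ) : ArithOp → ℕ → ℕ → Prop
  | .add, x, y => x + y < W
  | .mul, x, y => x * y < W
  | _, _, _ => True

/-- The evaluation of an expression does not overflow words below `W`. -/
def Expr.Safe (G : CoverInstance) (W : ℕ) (σ : St) : Expr → Prop
  | .lit k => k < W
  | .var _ => True
  | .bin o e f => e.Safe G W σ ∧ f.Safe G W σ ∧ o.Safe W (e.eval G σ) (f.eval G σ)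
  | .arr _ e => e.Safe G W σ ∧ 8 * e.eval G σ + 8 < W
  | .nSets => True
  | .nElems => True
  | .deg e => e.Safe G W σ
  | .entry e f => e.Safe G W σ ∧ f.Safe G W σ

/-! ### Compilation of expressions -/

/-- Instructions that turn the index in register `2 * t + 1` into the address of an array cell. -/
def addrCode (a : Arr) (t : ℕ) : List Instr :=
  [.const (2 * t + 3) 8, .arith .mul (2 * t + 1) (2 * t + 1) (2 * t + 3),
    .const (2 * t + 3) a.ctorIdx, .arith .add (2 * t + 1) (2 * t + 1) (2 * t + 3)]

/-- Instructions that evaluate an expression into register `2 * t + 1`. -/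
def Expr.code : Expr → ℕ → List Instr
  | .lit k, t => [.const (2 * t + 1) k]
  | .var x, t => [.const (2 * t + 1) 0, .arith .add (2 * t + 1) (2 * t + 1) (2 * x.ctorIdx)]
  | .bin o e f, t =>
      e.code t ++ (f.code (t + 1) ++ [.arith o (2 * t + 1) (2 * t + 1) (2 * t + 3)])
  | .arr a e, t => e.code t ++ (addrCode a t ++ [.load (2 * t + 1) (2 * t + 1)])
  | .nSets, t => [.numSets (2 * t + 1)]
  | .nElems, t => [.numElems (2 * t + 1)]
  | .deg e, t => e.code t ++ [.elemDeg (2 * t + 1) (2 * t + 1)]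
  | .entry e f, t =>
      e.code t ++ (f.code (t + 1) ++ [.elemEntry (2 * t + 1) (2 * t + 1) (2 * t + 3)])

theorem Expr.code_direct (e : Expr) (t : ℕ) : (e.code t).all Instr.direct = true := by
  induction e generalizing t <;>
    simp only [Expr.code, Instr.direct, addrCode, List.all_append, List.all_cons, List.all_nil,
      Bool.and_self, *]

/-- A configuration of the machine represents a state of the structured language. -/
structure Sim (w : ℕ) (c : Config) (σ : St) : Prop where
  var : ∀ x : Var, c.reg (2 * x.ctorIdx) = σ.var x
  arr : ∀ (a : Arr) i, c.mem (8 * i + a.ctorIdx) = σ.arr a i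
  out : c.out = σ.out
  reg_lt : ∀ r, c.reg r < 2 ^ w
  mem_lt : ∀ r, c.mem r < 2 ^ w

theorem elemDeg_le (G : CoverInstance) (v : ℕ) : G.elemDeg v ≤ G.n := by
  unfold CoverInstance.elemDeg
  split
  · simpa using (G.elemList_nodup _).length_le_card
  · exact Nat.zero_le _

theorem elemEntry_le (G : CoverInstance) (v j : ℕ) : G.elemEntry v j ≤ G.n := by
  unfold CoverInstance.elemEntry
  split
  · rw [List.getD_eq_getElem?_getD]
    rcases h : ((G.elemList ⟨v, _⟩).map Fin.val)[j]? with _ | y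
    · simp
    · have := List.mem_of_getElem? h
      simp only [List.mem_map] at this
      obtain ⟨z, -, rfl⟩ := this
      simp
  · exact Nat.zero_le _

/-- Two configurations differ at most in the program counter and in the temporary registers from
`2 * t + 1` on. -/
structure TempEq (t : ℕ) (c c' : Config) : Prop where
  reg : ∀ r, (r % 2 = 0 ∨ r < 2 * t + 1) → c'.reg r = c.reg r
  mem : c'.mem = c.mem
  out : c'.out = c.out

theorem TempEq.trans {t t' : ℕ} (ht : t ≤ t') {c c' c'' : Config} (h : TempEq t c c')
    (h' : TempEq t' c' c'') : TempEq t c c'' where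
  reg r hr := by rw [h'.reg r (by omega), h.reg r hr]
  mem := by rw [h'.mem, h.mem]
  out := by rw [h'.out, h.out]

/-- Variables live in even registers and temporaries in odd ones, so temporary results never disturb
the represented state. -/
theorem TempEq.sim {t w : ℕ} {c c' : Config} {σ : St} (h : TempEq t c c') (hs : Sim w c σ)
    (hr : ∀ r, c'.reg r < 2 ^ w) : Sim w c' σ where
  var x := by rw [h.reg _ (by omega), hs.var]
  arr a i := by rw [h.mem, hs.arr]
  out := by rw [h.out, hs.out]
  reg_lt := hr
  mem_lt := by rw [h.mem]; exact hs.mem_lt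

theorem TempEq.write {t w : ℕ} (c : Config) {d x : ℕ} (hd : d % 2 = 1) (hd' : 2 * t + 1 ≤ d) :
    TempEq t c (c.write w d x) where
  reg r hr := Function.update_of_ne (by omega) _ _
  mem := rfl
  out := rfl

theorem Config.write_reg_lt {w : ℕ} {c : Config} (h : ∀ r, c.reg r < 2 ^ w) (d x r : ℕ) :
    (c.write w d x).reg r < 2 ^ w := by
  by_cases hr : r = d
  · subst hr
    simp [Config.write, Nat.mod_lt]
  · simpa [Config.write, Function.update_of_ne hr] using h r

theorem ArithOp.eval_lt {W x y : ℕ} {o : ArithOp} (hx : x < W) (h : o.Safe W x y) :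
    o.eval x y < W := by
  cases o
  · exact h
  · exact lt_of_le_of_lt (Nat.sub_le _ _) hx
  · exact h
  · exact lt_of_le_of_lt (Nat.div_le_self _ _) hx
  · exact lt_of_le_of_lt (Nat.mod_le _ _) hx

theorem addrCode_spec (G : CoverInstance) {w t i : ℕ} (a : Arr) {c : Config}
    (hr : ∀ r, c.reg r < 2 ^ w) (hi : c.reg (2 * t + 1) = i) (hb : 8 * i + 8 < 2 ^ w) :
    ∃ c', (addrCode a t).foldl (directExec G w) c = c' ∧ c'.reg (2 * t + 1) = 8 * i + a.ctorIdx ∧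
      TempEq t c c' ∧ ∀ r, c'.reg r < 2 ^ w := by
  have ha := a.ctorIdx_lt
  refine ⟨_, rfl, ?_, ?_, ?_⟩
  · simp [addrCode, directExec, Config.write, ArithOp.eval, hi,
      Nat.mod_eq_of_lt (show 8 < 2 ^ w by omega),
      Nat.mod_eq_of_lt (show i * 8 < 2 ^ w by omega),
      Nat.mod_eq_of_lt (show a.ctorIdx < 2 ^ w by omega)]
    rw [Nat.mod_eq_of_lt (by omega), mul_comm]
  · simp only [addrCode, directExec, List.foldl_cons, List.foldl_nil]
    exact (((TempEq.write _ (by omega) (by omega)).trans le_rfl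
      (TempEq.write _ (by omega) (by omega))).trans le_rfl
      (TempEq.write _ (by omega) (by omega))).trans le_rfl (TempEq.write _ (by omega) (by omega))
  · simp only [addrCode, directExec, List.foldl_cons, List.foldl_nil]
    exact Config.write_reg_lt (Config.write_reg_lt (Config.write_reg_lt
      (Config.write_reg_lt hr _ _) _ _) _ _) _ _

/-- The odd registers act as a stack. The second operand is evaluated one level higher and touches
only registers from `2 * t + 3` on, so the first operand in register `2 * t + 1` survives. -/
theorem Expr.code_spec {G : CoverInstance} {w : ℕ} (hn : G.n < 2 ^ w) (hm : G.m < 2 ^ w)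
    {σ : St} (e : Expr) (hsafe : e.Safe G (2 ^ w) σ) (t : ℕ) {c : Config} (hs : Sim w c σ) :
    ∃ c', (e.code t).foldl (directExec G w) c = c' ∧ c'.reg (2 * t + 1) = e.eval G σ ∧
      TempEq t c c' ∧ ∀ r, c'.reg r < 2 ^ w := by
  induction e generalizing t c with
  | lit k =>
    refine ⟨_, rfl, ?_, TempEq.write _ (by omega) le_rfl, Config.write_reg_lt hs.reg_lt _ _⟩
    simpa [Expr.code, directExec, Config.write, Expr.eval] using Nat.mod_eq_of_lt hsafe
  | var x =>
    refine ⟨_, rfl, ?_, (TempEq.write _ (by omega) le_rfl).trans le_rfl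
      (TempEq.write _ (by omega) le_rfl),
      Config.write_reg_lt (Config.write_reg_lt hs.reg_lt _ _) _ _⟩
    have hx : 2 * x.ctorIdx ≠ 2 * t + 1 := by omega
    simp [Expr.code, directExec, Config.write, ArithOp.eval, Expr.eval, Function.update_of_ne hx, hs.var]
    exact Nat.mod_eq_of_lt (hs.var x ▸ hs.reg_lt _)
  | nSets =>
    refine ⟨_, rfl, ?_, TempEq.write _ (by omega) le_rfl, Config.write_reg_lt hs.reg_lt _ _⟩
    simpa [Expr.code, directExec, Config.write, Expr.eval] using Nat.mod_eq_of_lt hn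
  | nElems =>
    refine ⟨_, rfl, ?_, TempEq.write _ (by omega) le_rfl, Config.write_reg_lt hs.reg_lt _ _⟩
    simpa [Expr.code, directExec, Config.write, Expr.eval] using Nat.mod_eq_of_lt hm
  | bin o e f ihe ihf =>
    obtain ⟨c1, h1, v1, t1, b1⟩ := ihe hsafe.1 t hs
    obtain ⟨c2, h2, v2, t2, b2⟩ := ihf hsafe.2.1 (t + 1) (t1.sim hs b1)
    refine ⟨_, rfl, ?_, ?_, ?_⟩ <;>
      simp only [Expr.code, List.foldl_append, h1, h2, List.foldl_cons, List.foldl_nil, directExec]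
    · have hv : c2.reg (2 * t + 1) = e.eval G σ := by rw [t2.reg _ (by omega), v1]
      have hv' : c2.reg (2 * t + 3) = f.eval G σ := v2
      simp only [Config.write, Function.update_self, hv, hv', Expr.eval]
      exact Nat.mod_eq_of_lt (ArithOp.eval_lt (v1 ▸ b1 _) hsafe.2.2)
    · exact (t1.trans (by omega) t2).trans le_rfl (TempEq.write _ (by omega) le_rfl)
    · exact Config.write_reg_lt b2 _ _
  | arr a e ih =>
    obtain ⟨c1, h1, v1, t1, b1⟩ := ih hsafe.1 t hs
    obtain ⟨c2, h2, v2, t2, b2⟩ := addrCode_spec G a b1 v1 hsafe.2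
    refine ⟨_, rfl, ?_, ?_, ?_⟩ <;>
      simp only [Expr.code, List.foldl_append, h1, h2, List.foldl_cons, List.foldl_nil, directExec]
    · have hv : c2.mem (8 * e.eval G σ + a.ctorIdx) = σ.arr a (e.eval G σ) := by
        rw [t2.mem, t1.mem, hs.arr]
      simp only [Config.write, Function.update_self, v2, hv, Expr.eval]
      exact Nat.mod_eq_of_lt (by rw [← hs.arr]; exact hs.mem_lt _)
    · exact (t1.trans le_rfl t2).trans le_rfl (TempEq.write _ (by omega) le_rfl)
    · exact Config.write_reg_lt b2 _ _
  | deg e ih =>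
    obtain ⟨c1, h1, v1, t1, b1⟩ := ih hsafe t hs
    refine ⟨_, rfl, ?_, ?_, ?_⟩ <;>
      simp only [Expr.code, List.foldl_append, h1, List.foldl_cons, List.foldl_nil, directExec]
    · simp only [Config.write, Function.update_self, v1, Expr.eval]
      exact Nat.mod_eq_of_lt ((elemDeg_le G _).trans_lt hn)
    · exact t1.trans le_rfl (TempEq.write _ (by omega) le_rfl)
    · exact Config.write_reg_lt b1 _ _
  | entry e f ihe ihf =>
    obtain ⟨c1, h1, v1, t1, b1⟩ := ihe hsafe.1 t hs
    obtain ⟨c2, h2, v2, t2, b2⟩ := ihf hsafe.2 (t + 1) (t1.sim hs b1)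
    refine ⟨_, rfl, ?_, ?_, ?_⟩ <;>
      simp only [Expr.code, List.foldl_append, h1, h2, List.foldl_cons, List.foldl_nil, directExec]
    · have hv : c2.reg (2 * t + 1) = e.eval G σ := by rw [t2.reg _ (by omega), v1]
      have hv' : c2.reg (2 * t + 3) = f.eval G σ := v2
      simp only [Config.write, Function.update_self, hv, hv', Expr.eval]
      exact Nat.mod_eq_of_lt ((elemEntry_le G _ _).trans_lt hn)
    · exact (t1.trans (by omega) t2).trans le_rfl (TempEq.write _ (by omega) le_rfl)
    · exact Config.write_reg_lt b2 _ _

theorem foldl_direct_pc (G : CoverInstance) (w : ℕ) {code : List Instr} (c : Config)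
    (hd : code.all Instr.direct = true) :
    (code.foldl (directExec G w) c).pc = c.pc + code.length := by
  induction code generalizing c with
  | nil => rfl
  | cons i v ih =>
    simp only [List.all_cons, Bool.and_eq_true] at hd
    rw [List.foldl_cons, ih _ hd.2, (exec_direct G w c hd.1).2, List.length_cons]
    omega

theorem Expr.reach {P : Program} {G : CoverInstance} {w : ℕ} (hn : G.n < 2 ^ w)
    (hm : G.m < 2 ^ w) {σ : St} (e : Expr) (hsafe : e.Safe G (2 ^ w) σ) (t : ℕ) {c : Config}
    (hs : Sim w c σ) (hc : CodeAt P c.pc (e.code t)) :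
    ∃ c', Reach P G w c (e.code t).length c' ∧ c'.pc = c.pc + (e.code t).length ∧
      c'.reg (2 * t + 1) = e.eval G σ ∧ TempEq t c c' ∧ Sim w c' σ := by
  obtain ⟨c', h, v, te, b⟩ := e.code_spec hn hm hsafe t hs
  exact ⟨c', h ▸ Reach.block hc (e.code_direct t), h ▸ foldl_direct_pc G w c (e.code_direct t), v,
    te, te.sim hs b⟩

/-! ### Commands and the correctness of their compilation -/

/-- Commands. -/
inductive Cmd
  | skip
  | assign (x : Var) (e : Expr)
  | store (a : Arr) (i e : Expr)
  | emit (e : Expr)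
  | seq (c d : Cmd)
  /-- if `e < f` then `c` else `d` -/
  | ite (e f : Expr) (c d : Cmd)
  /-- while `e < f` do `c` -/
  | while (e f : Expr) (c : Cmd)

/-- An unconditional jump. -/
def gotoCode (l : ℕ) : List Instr := [.const 1 0, .const 3 1, .jumpLt 1 3 l]

/-- The instructions of a command, to be placed at address `l`. -/
def Cmd.compile : Cmd → ℕ → List Instr
  | .skip, _ => []
  | .assign x e, _ => e.code 0 ++ [.const 3 0, .arith .add (2 * x.ctorIdx) 1 3]
  | .store a i e, _ => e.code 0 ++ (i.code 1 ++ (addrCode a 1 ++ [.store 3 1]))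
  | .emit e, _ => e.code 0 ++ [.output 1]
  | .seq c d, l => c.compile l ++ d.compile (l + (c.compile l).length)
  | .ite e f c d, l =>
      let t := e.code 0 ++ f.code 1
      let u := d.compile (l + t.length + 1)
      let l' := l + t.length + 1 + u.length + 3
      let v := c.compile l'
      t ++ (.jumpLt 1 3 l' :: (u ++ (gotoCode (l' + v.length) ++ v)))
  | .while e f c, l =>
      let t := e.code 0 ++ f.code 1
      let u := c.compile (l + t.length + 4)
      t ++ (.jumpLt 1 3 (l + t.length + 4) ::
        (gotoCode (l + t.length + 4 + u.length + 3) ++ (u ++ gotoCode l)))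

/-- Let one unit of time pass. -/
def St.tick (σ : St) : St := { σ with tm := σ.tm + 1 }

/-- Set a variable. -/
def St.set (σ : St) (x : Var) (v : ℕ) : St :=
  { σ with var := Function.update σ.var x v, tm := σ.tm + 1 }

/-- Set an array cell. -/
def St.put (σ : St) (a : Arr) (i v : ℕ) : St :=
  { σ with arr := Function.update σ.arr a (Function.update (σ.arr a) i v), tm := σ.tm + 1 }

/-- Append to the output. -/
def St.emit (σ : St) (v : ℕ) : St := { σ with out := σ.out ++ [v], tm := σ.tm + 1 }

/-- The semantics of commands; words are below `W`. -/
inductive Exec (G : CoverInstance) (W : ℕ) : Cmd → St → St → Prop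
  | skip (σ) : Exec G W .skip σ σ
  | assign (σ) {x e} (h : e.Safe G W σ) : Exec G W (.assign x e) σ (σ.set x (e.eval G σ))
  | store (σ) {a i e} (hi : i.Safe G W σ) (hi' : 8 * i.eval G σ + 8 < W) (h : e.Safe G W σ) :
      Exec G W (.store a i e) σ (σ.put a (i.eval G σ) (e.eval G σ))
  | emit (σ) {e} (h : e.Safe G W σ) : Exec G W (.emit e) σ (σ.emit (e.eval G σ))
  | seq {c d σ σ' σ''} (h : Exec G W c σ σ') (h' : Exec G W d σ' σ'') :
      Exec G W (.seq c d) σ σ''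
  | ite_true {e f c d σ σ'} (he : e.Safe G W σ) (hf : f.Safe G W σ)
      (h : e.eval G σ < f.eval G σ) (h' : Exec G W c σ.tick σ') : Exec G W (.ite e f c d) σ σ'
  | ite_false {e f c d σ σ'} (he : e.Safe G W σ) (hf : f.Safe G W σ)
      (h : ¬ e.eval G σ < f.eval G σ) (h' : Exec G W d σ.tick σ') : Exec G W (.ite e f c d) σ σ'
  | while_true {e f c σ σ' σ''} (he : e.Safe G W σ) (hf : f.Safe G W σ)
      (h : e.eval G σ < f.eval G σ) (h' : Exec G W c σ.tick σ')
      (h'' : Exec G W (.while e f c) σ' σ'') : Exec G W (.while e f c) σ σ''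
  | while_false {e f c σ} (he : e.Safe G W σ) (hf : f.Safe G W σ)
      (h : ¬ e.eval G σ < f.eval G σ) : Exec G W (.while e f c) σ σ.tick

/-- The jump tests `0 < 1`; words of at least one bit make this true. -/
theorem reach_goto {P : Program} {G : CoverInstance} {w l : ℕ} (hw : 1 < 2 ^ w) {σ : St}
    {c : Config} (hs : Sim w c σ) (hc : CodeAt P c.pc (gotoCode l)) :
    ∃ c', Reach P G w c 3 c' ∧ c'.pc = l ∧ Sim w c' σ := by
  have h1 := Reach.block (G := G) (w := w) (code := [.const 1 0, .const 3 1])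
    (CodeAt.left (v := [.jumpLt 1 3 l]) hc) rfl
  have h2 := Reach.jump (G := G) (w := w) (P := P) (a := 1) (b := 3) (l := l)
    (c := [Instr.const 1 0, .const 3 1].foldl (directExec G w) c)
    (by exact hc.tail.tail.head)
  refine ⟨_, h1.trans h2, ?_, ?_⟩
  · simp [directExec, Config.write, Nat.mod_eq_of_lt hw]
  · have := (TempEq.write (t := 0) (w := w) c (d := 1) (x := 0) (by omega) (by omega)).trans le_rfl
      (TempEq.write (t := 0) (w := w) _ (d := 3) (x := 1) (by omega) (by omega))
    have h3 := this.sim hs (Config.write_reg_lt (Config.write_reg_lt hs.reg_lt _ _) _ _)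
    exact ⟨h3.var, h3.arr, h3.out, h3.reg_lt, h3.mem_lt⟩

theorem Sim.tick {w : ℕ} {c : Config} {σ : St} (h : Sim w c σ) : Sim w c σ.tick :=
  ⟨h.var, h.arr, h.out, h.reg_lt, h.mem_lt⟩

theorem Sim.pc {w : ℕ} {c : Config} {σ : St} (h : Sim w c σ) (l : ℕ) :
    Sim w { c with pc := l } σ :=
  ⟨h.var, h.arr, h.out, h.reg_lt, h.mem_lt⟩

/-- Evaluation of the two sides of a comparison, followed by the conditional jump. -/
theorem reach_test {P : Program} {G : CoverInstance} {w : ℕ} (hn : G.n < 2 ^ w)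
    (hm : G.m < 2 ^ w) {σ : St} {e f : Expr} {v : List Instr} (he : e.Safe G (2 ^ w) σ)
    (hf : f.Safe G (2 ^ w) σ) {l : ℕ} {c : Config} (hs : Sim w c σ)
    (hc : CodeAt P c.pc ((e.code 0 ++ f.code 1) ++ (.jumpLt 1 3 l :: v))) :
    ∃ c', Reach P G w c ((e.code 0 ++ f.code 1).length + 1) c' ∧
      c'.pc = (if e.eval G σ < f.eval G σ then l
        else c.pc + (e.code 0 ++ f.code 1).length + 1) ∧ Sim w c' σ.tick := by
  obtain ⟨c1, r1, p1, v1, t1, s1⟩ := e.reach hn hm he 0 hs hc.left.left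
  obtain ⟨c2, r2, p2, v2, t2, s2⟩ := f.reach hn hm hf 1 s1 (p1 ▸ hc.left.right)
  have hp : c2.pc = c.pc + (e.code 0 ++ f.code 1).length := by
    rw [p2, p1, List.length_append, add_assoc]
  have hv1 : c2.reg 1 = e.eval G σ := by rw [t2.reg 1 (by omega)]; exact v1
  have hv2 : c2.reg 3 = f.eval G σ := v2
  refine ⟨{ c2 with pc := if c2.reg 1 < c2.reg 3 then l else c2.pc + 1 }, ?_, ?_, (s2.pc _).tick⟩
  · rw [List.length_append]
    exact (r1.trans r2).trans (Reach.jump (a := 1) (b := 3) (l := l) (hp ▸ hc.right.head))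
  · simp only [hv1, hv2, hp]

theorem mul_tm_le {K : ℕ} (σ : St) : K * σ.tick.tm = K * σ.tm + K := by
  simp [St.tick, mul_add]

/-- Machine time is charged to the counter `tm`: between two ticks the machine executes only
straight pieces of the code, so any bound `K` on the code length bounds the steps per tick. A tick
of a loop pays for the test and the jumps. -/
theorem Exec.reach {G : CoverInstance} {w : ℕ} (hw : 1 < 2 ^ w) (hn : G.n < 2 ^ w)
    (hm : G.m < 2 ^ w) {cmd : Cmd} {σ σ' : St} (h : Exec G (2 ^ w) cmd σ σ') :
    ∀ {P : Program} {K : ℕ} {c : Config}, CodeAt P c.pc (cmd.compile c.pc) →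
      (cmd.compile c.pc).length ≤ K → Sim w c σ →
      ∃ t c', Reach P G w c t c' ∧ c'.pc = c.pc + (cmd.compile c.pc).length ∧ Sim w c' σ' ∧
        t + K * σ.tm ≤ K * σ'.tm := by
  induction h with
  | skip σ =>
    intro P K c hc hK hs
    exact ⟨0, c, Reach.refl _ _ _ _, by simp [Cmd.compile], hs, by simp⟩
  | @assign σ x e he =>
    intro P K c hc hK hs
    obtain ⟨c1, r1, p1, v1, t1, s1⟩ := e.reach hn hm he 0 hs hc.left
    have r2 := Reach.block (G := G) (w := w) (p1 ▸ hc.right) rfl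
    have hp := foldl_direct_pc G w c1
      (code := [.const 3 0, .arith .add (2 * x.ctorIdx) 1 3]) rfl
    refine ⟨_, _, r1.trans r2, ?_, ?_, ?_⟩
    · rw [hp, p1]; simp [Cmd.compile, add_assoc]
    · have v1' : c1.reg 1 = e.eval G σ := v1
      have h3 : 2 * x.ctorIdx ≠ 3 := by omega
      refine ⟨fun y => ?_, ?_, ?_, ?_, ?_⟩
      · by_cases hy : y = x
        · subst hy
          simp [directExec, Config.write, St.set, ArithOp.eval, v1']
          exact Nat.mod_eq_of_lt (v1' ▸ s1.reg_lt _)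
        · have : 2 * y.ctorIdx ≠ 2 * x.ctorIdx := fun h =>
            hy (Var.ctorIdx_injective (by omega))
          have h3 : 2 * y.ctorIdx ≠ 3 := by omega
          simp [directExec, Config.write, St.set, Function.update_of_ne this,
            Function.update_of_ne h3, Function.update_of_ne hy, s1.var]
      · exact s1.arr
      · exact s1.out
      · exact Config.write_reg_lt (Config.write_reg_lt s1.reg_lt _ _) _ _
      · exact s1.mem_lt
    · simp only [Cmd.compile, List.length_append] at hK
      simp only [St.set, mul_add]
      omega
  | @store σ a i e hi hi' he =>
    intro P K c hc hK hs
    obtain ⟨c1, r1, p1, v1, t1, s1⟩ := e.reach hn hm he 0 hs hc.left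
    obtain ⟨c2, r2, p2, v2, t2, s2⟩ := i.reach hn hm hi 1 s1 (p1 ▸ hc.right.left)
    obtain ⟨c3, h3, v3, t3, b3⟩ := addrCode_spec G a s2.reg_lt v2 hi'
    have hc' := hc.right.right
    have r3 := Reach.block (G := G) (w := w) (P := P) (c := c2) (code := addrCode a 1)
      (by rw [p2, p1]; exact hc'.left) rfl
    have p3 := foldl_direct_pc G w c2 (code := addrCode a 1) rfl
    rw [h3] at r3 p3
    have hst : P[c3.pc]? = some (.store 3 1) := by
      rw [p3, p2, p1]; exact hc'.right.head
    have hv : c3.reg 1 = e.eval G σ := by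
      rw [t3.reg _ (by omega), t2.reg _ (by omega)]; exact v1
    have s3 := t3.sim s2 b3
    refine ⟨_, _, ((r1.trans r2).trans r3).trans (Reach.single hst rfl), ?_, ?_, ?_⟩
    · simp only [p3, p2, p1, Cmd.compile, List.length_append, List.length_singleton]
      omega
    · refine ⟨s3.var, fun b j => ?_, s3.out, s3.reg_lt, fun r => ?_⟩
      · have v3' : c3.reg 3 = 8 * i.eval G σ + a.ctorIdx := v3
        have := a.ctorIdx_lt
        have := b.ctorIdx_lt
        simp only [v3', hv, St.put]
        by_cases hb : b = a
        · subst hb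
          by_cases hj : j = i.eval G σ
          · subst hj; simp
          · rw [Function.update_of_ne (by omega), Function.update_self, Function.update_of_ne hj,
              s3.arr]
        · have : b.ctorIdx ≠ a.ctorIdx := fun h => hb (Arr.ctorIdx_injective h)
          rw [Function.update_of_ne (by omega), Function.update_of_ne hb, s3.arr]
      · by_cases hr : r = c3.reg 3
        · subst hr; simpa using s3.reg_lt _
        · simpa [Function.update_of_ne hr] using s3.mem_lt r
    · simp only [Cmd.compile, List.length_append, List.length_singleton] at hK
      simp only [St.put, mul_add]
      omega
  | @emit σ e he =>
    intro P K c hc hK hs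
    obtain ⟨c1, r1, p1, v1, t1, s1⟩ := e.reach hn hm he 0 hs hc.left
    refine ⟨_, _, r1.trans (Reach.single (p1 ▸ hc.right.head) rfl), ?_, ?_, ?_⟩
    · simp only [p1, Cmd.compile, List.length_append, List.length_singleton]; omega
    · refine ⟨s1.var, s1.arr, ?_, s1.reg_lt, s1.mem_lt⟩
      have v1' : c1.reg 1 = e.eval G σ := v1
      simp [St.emit, s1.out, v1']
    · simp only [Cmd.compile, List.length_append, List.length_singleton] at hK
      simp only [St.emit, mul_add]
      omega
  | seq h1 h2 ih1 ih2 =>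
    intro P K c hc hK hs
    simp only [Cmd.compile, List.length_append] at hc hK ⊢
    obtain ⟨t1, c1, r1, p1, s1, e1⟩ := ih1 (K := K) hc.left (by omega) hs
    obtain ⟨t2, c2, r2, p2, s2, e2⟩ := ih2 (c := c1) (K := K) (p1 ▸ hc.right)
      (by rw [p1]; omega) s1
    exact ⟨_, c2, r1.trans r2, by rw [p2, p1, add_assoc], s2, by omega⟩
  | @ite_true e f c d σ σ' he hf h h' ih =>
    intro P K cf hc hK hs
    simp only [Cmd.compile] at hc hK ⊢
    obtain ⟨c1, r1, p1, s1⟩ := reach_test hn hm he hf hs hc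
    rw [if_pos h] at p1
    have hc' := hc.right.tail.right.right
    simp only [List.length_append, List.length_cons, gotoCode] at hc hK hc' p1 r1 ⊢
    obtain ⟨t2, c2, r2, p2, s2, e2⟩ := ih (P := P) (c := c1) (K := K) (by
      rw [p1]; exact hc') (by rw [p1]; omega) s1
    refine ⟨_, c2, r1.trans r2, ?_, s2, ?_⟩
    · rw [p2, p1]; simp only [List.length_nil]; omega
    · rw [mul_tm_le] at e2; omega
  | @ite_false e f c d σ σ' he hf h h' ih =>
    intro P K cf hc hK hs
    simp only [Cmd.compile] at hc hK ⊢
    obtain ⟨c1, r1, p1, s1⟩ := reach_test hn hm he hf hs hc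
    rw [if_neg h] at p1
    have hc' := hc.right.tail.left
    have hc'' := hc.right.tail.right.left
    simp only [List.length_append, List.length_cons] at hc hK hc' hc'' p1 r1 ⊢
    obtain ⟨t2, c2, r2, p2, s2, e2⟩ := ih (P := P) (c := c1) (K := K) (by
      rw [p1]; exact hc') (by rw [p1]; omega) s1
    obtain ⟨c3, r3, p3, s3⟩ := reach_goto (G := G) hw s2 (by
      rw [p2, p1]; exact hc'')
    refine ⟨_, c3, (r1.trans r2).trans r3, ?_, s3, ?_⟩
    · rw [p3]; simp only [gotoCode, List.length_cons, List.length_nil]; omega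
    · simp only [gotoCode, List.length_cons] at hK
      rw [mul_tm_le] at e2; omega
  | @while_true e f c σ σ' σ'' he hf h h' h'' ih1 ih2 =>
    intro P K cf hc hK hs
    have hcw := hc
    have hKw := hK
    simp only [Cmd.compile] at hc hK ⊢
    obtain ⟨c1, r1, p1, s1⟩ := reach_test hn hm he hf hs hc
    rw [if_pos h] at p1
    have hc' := hc.right.tail.right.left
    have hc'' := hc.right.tail.right.right
    simp only [List.length_append, List.length_cons, gotoCode, List.length_nil] at hK hc' hc'' p1 r1
    obtain ⟨t2, c2, r2, p2, s2, e2⟩ := ih1 (P := P) (c := c1) (K := K) (by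
      rw [p1]; exact hc') (by rw [p1]; omega) s1
    obtain ⟨c3, r3, p3, s3⟩ := reach_goto (G := G) (P := P) (l := cf.pc) hw s2 (by
      rw [p2, p1]; exact hc'')
    obtain ⟨t4, c4, r4, p4, s4, e4⟩ := ih2 (P := P) (c := c3) (K := K) (by rw [p3]; exact hcw)
      (by rw [p3]; exact hKw) s3
    refine ⟨_, c4, ((r1.trans r2).trans r3).trans r4, ?_, s4, ?_⟩
    · rw [p4, p3]; rfl
    · rw [mul_tm_le] at e2; omega
  | @while_false e f c σ he hf h =>
    intro P K cf hc hK hs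
    simp only [Cmd.compile] at hc hK ⊢
    obtain ⟨c1, r1, p1, s1⟩ := reach_test hn hm he hf hs hc
    rw [if_neg h] at p1
    have hc' := hc.right.tail.left
    obtain ⟨c3, r3, p3, s3⟩ := reach_goto (G := G) (P := P) hw s1 (by
      rw [p1]; exact hc')
    refine ⟨_, c3, r1.trans r3, ?_, s3, ?_⟩
    · rw [p3]; simp only [gotoCode, List.length_cons, List.length_nil, List.length_append]; omega
    · simp only [gotoCode, List.length_cons, List.length_append] at hK r1 ⊢
      rw [mul_tm_le]; omega

/-! ### Total correctness of commands -/

/-- The command terminates from `σ` in a state that satisfies `Q`. -/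
def wp (G : CoverInstance) (W : ℕ) (c : Cmd) (Q : St → Prop) (σ : St) : Prop :=
  ∃ σ', Exec G W c σ σ' ∧ Q σ'

/-- Can the command change the variable? -/
def Cmd.modifies : Cmd → Var → Bool
  | .assign x _, y => decide (x = y)
  | .seq c d, y => c.modifies y || d.modifies y
  | .ite _ _ c d, y => c.modifies y || d.modifies y
  | .while _ _ c, y => c.modifies y
  | _, _ => false

/-- Can the command change the array? -/
def Cmd.touches : Cmd → Arr → Bool
  | .store a _ _, b => decide (a = b)
  | .seq c d, b => c.touches b || d.touches b
  | .ite _ _ c d, b => c.touches b || d.touches b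
  | .while _ _ c, b => c.touches b
  | _, _ => false

/-- Can the command produce output? -/
def Cmd.emits : Cmd → Bool
  | .emit _ => true
  | .seq c d => c.emits || d.emits
  | .ite _ _ c d => c.emits || d.emits
  | .while _ _ c => c.emits
  | _ => false

/-- The parts of the state that the command cannot change are equal. -/
structure Frame (c : Cmd) (σ σ' : St) : Prop where
  var : ∀ x, c.modifies x = false → σ'.var x = σ.var x
  arr : ∀ a, c.touches a = false → σ'.arr a = σ.arr a
  out : c.emits = false → σ'.out = σ.out

theorem Frame.refl (c : Cmd) (σ : St) : Frame c σ σ :=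
  ⟨fun _ _ => rfl, fun _ _ => rfl, fun _ => rfl⟩

theorem Frame.trans {c : Cmd} {σ σ' σ'' : St} (h : Frame c σ σ') (h' : Frame c σ' σ'') :
    Frame c σ σ'' :=
  ⟨fun x hx => (h'.var x hx).trans (h.var x hx), fun a ha => (h'.arr a ha).trans (h.arr a ha),
    fun ho => (h'.out ho).trans (h.out ho)⟩

theorem Frame.tick {c : Cmd} {σ σ' : St} (h : Frame c σ.tick σ') : Frame c σ σ' :=
  ⟨h.var, h.arr, h.out⟩

/-- What a command may change is computed from its syntax, so that in concrete programs preservation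
of the other variables and arrays is proved by `rfl`. -/
theorem Exec.frame {G : CoverInstance} {W : ℕ} {c : Cmd} {σ σ' : St} (h : Exec G W c σ σ') :
    Frame c σ σ' := by
  induction h with
  | skip σ => exact Frame.refl _ _
  | @assign σ x e _ =>
    refine ⟨fun y hy => ?_, fun _ _ => rfl, fun _ => rfl⟩
    have : x ≠ y := by simpa [Cmd.modifies] using hy
    simp [St.set, Function.update_of_ne this.symm]
  | @store σ a i e _ _ _ =>
    refine ⟨fun _ _ => rfl, fun b hb => ?_, fun _ => rfl⟩
    have : a ≠ b := by simpa [Cmd.touches] using hb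
    simp [St.put, Function.update_of_ne this.symm]
  | emit σ _ => exact ⟨fun _ _ => rfl, fun _ _ => rfl, fun h => by simp [Cmd.emits] at h⟩
  | seq _ _ ih1 ih2 =>
    refine ⟨fun y hy => ?_, fun b hb => ?_, fun ho => ?_⟩
    · simp only [Cmd.modifies, Bool.or_eq_false_iff] at hy
      exact (ih2.var y hy.2).trans (ih1.var y hy.1)
    · simp only [Cmd.touches, Bool.or_eq_false_iff] at hb
      exact (ih2.arr b hb.2).trans (ih1.arr b hb.1)
    · simp only [Cmd.emits, Bool.or_eq_false_iff] at ho
      exact (ih2.out ho.2).trans (ih1.out ho.1)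
  | ite_true _ _ _ _ ih =>
    refine ⟨fun y hy => ?_, fun b hb => ?_, fun ho => ?_⟩
    · simp only [Cmd.modifies, Bool.or_eq_false_iff] at hy
      exact ih.var y hy.1
    · simp only [Cmd.touches, Bool.or_eq_false_iff] at hb
      exact ih.arr b hb.1
    · simp only [Cmd.emits, Bool.or_eq_false_iff] at ho
      exact ih.out ho.1
  | ite_false _ _ _ _ ih =>
    refine ⟨fun y hy => ?_, fun b hb => ?_, fun ho => ?_⟩
    · simp only [Cmd.modifies, Bool.or_eq_false_iff] at hy
      exact ih.var y hy.2
    · simp only [Cmd.touches, Bool.or_eq_false_iff] at hb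
      exact ih.arr b hb.2
    · simp only [Cmd.emits, Bool.or_eq_false_iff] at ho
      exact ih.out ho.2
  | while_true _ _ _ _ _ ih1 ih2 =>
    exact ⟨fun y hy => (ih2.var y hy).trans (ih1.var y hy),
      fun b hb => (ih2.arr b hb).trans (ih1.arr b hb), fun ho => (ih2.out ho).trans (ih1.out ho)⟩
  | while_false _ _ _ => exact ⟨fun _ _ => rfl, fun _ _ => rfl, fun _ => rfl⟩

section wp

variable {G : CoverInstance} {W : ℕ} {c d : Cmd} {Q Q' : St → Prop} {σ : St} {e f : Expr}

theorem wp_mono (h : wp G W c Q σ) (hQ : ∀ τ, Q τ → Frame c σ τ → Q' τ) : wp G W c Q' σ := by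
  obtain ⟨τ, h1, h2⟩ := h
  exact ⟨τ, h1, hQ τ h2 h1.frame⟩

theorem wp_skip : wp G W .skip Q σ ↔ Q σ :=
  ⟨fun ⟨_, h, hQ⟩ => by cases h; exact hQ, fun h => ⟨σ, .skip σ, h⟩⟩

theorem wp_seq : wp G W (.seq c d) Q σ ↔ wp G W c (fun τ => wp G W d Q τ) σ := by
  constructor
  · rintro ⟨τ, h, hQ⟩
    cases h with
    | seq h h' => exact ⟨_, h, _, h', hQ⟩
  · rintro ⟨τ, h, τ', h', hQ⟩
    exact ⟨τ', .seq h h', hQ⟩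

theorem wp_assign {x : Var} :
    wp G W (.assign x e) Q σ ↔ e.Safe G W σ ∧ Q (σ.set x (e.eval G σ)) := by
  constructor
  · rintro ⟨τ, h, hQ⟩
    cases h with
    | assign _ h => exact ⟨h, hQ⟩
  · rintro ⟨h, hQ⟩
    exact ⟨_, .assign σ h, hQ⟩

theorem wp_store {a : Arr} : wp G W (.store a f e) Q σ ↔
    (f.Safe G W σ ∧ 8 * f.eval G σ + 8 < W ∧ e.Safe G W σ) ∧
      Q (σ.put a (f.eval G σ) (e.eval G σ)) := by
  constructor
  · rintro ⟨τ, h, hQ⟩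
    cases h with
    | store _ h h' h'' => exact ⟨⟨h, h', h''⟩, hQ⟩
  · rintro ⟨⟨h, h', h''⟩, hQ⟩
    exact ⟨_, .store σ h h' h'', hQ⟩

theorem wp_emit : wp G W (.emit e) Q σ ↔ e.Safe G W σ ∧ Q (σ.emit (e.eval G σ)) := by
  constructor
  · rintro ⟨τ, h, hQ⟩
    cases h with
    | emit _ h => exact ⟨h, hQ⟩
  · rintro ⟨h, hQ⟩
    exact ⟨_, .emit σ h, hQ⟩

theorem wp_ite : wp G W (.ite e f c d) Q σ ↔ (e.Safe G W σ ∧ f.Safe G W σ) ∧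
    (e.eval G σ < f.eval G σ → wp G W c Q σ.tick) ∧
    (f.eval G σ ≤ e.eval G σ → wp G W d Q σ.tick) := by
  constructor
  · rintro ⟨τ, h, hQ⟩
    cases h with
    | ite_true he hf h h' => exact ⟨⟨he, hf⟩, fun _ => ⟨τ, h', hQ⟩, fun h'' => by omega⟩
    | ite_false he hf h h' => exact ⟨⟨he, hf⟩, fun h'' => by omega, fun _ => ⟨τ, h', hQ⟩⟩
  · rintro ⟨⟨he, hf⟩, h, h'⟩
    by_cases hlt : e.eval G σ < f.eval G σ
    · obtain ⟨τ, h1, h2⟩ := h hlt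
      exact ⟨τ, .ite_true he hf hlt h1, h2⟩
    · obtain ⟨τ, h1, h2⟩ := h' (not_lt.1 hlt)
      exact ⟨τ, .ite_false he hf hlt h1, h2⟩

/-- The rule for loops: `I i` holds after `i` passes, of which there are at most `R`. -/
theorem wp_while (I : ℕ → St → Prop) (R : ℕ) (h0 : I 0 σ)
    (hsafe : ∀ i τ, I i τ → Frame c σ τ → e.Safe G W τ ∧ f.Safe G W τ)
    (hstep : ∀ i τ, I i τ → Frame c σ τ → e.eval G τ < f.eval G τ →
      i < R ∧ wp G W c (I (i + 1)) τ.tick)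
    (hexit : ∀ i τ, I i τ → Frame c σ τ → f.eval G τ ≤ e.eval G τ → Q τ.tick) :
    wp G W (.while e f c) Q σ := by
  -- Induction on the number of passes left; a true guard forces `i < R`, so it cannot occur when
  -- none is left.
  suffices h : ∀ k i τ, R - i ≤ k → I i τ → Frame c σ τ → wp G W (.while e f c) Q τ from
    h R 0 σ (by omega) h0 (Frame.refl _ _)
  intro k
  induction k with
  | zero =>
    intro i τ hi hI hF
    by_cases hlt : e.eval G τ < f.eval G τ
    · have := (hstep i τ hI hF hlt).1; omega
    · exact ⟨_, .while_false (hsafe i τ hI hF).1 (hsafe i τ hI hF).2 hlt,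
        hexit i τ hI hF (not_lt.1 hlt)⟩
  | succ k ih =>
    intro i τ hi hI hF
    by_cases hlt : e.eval G τ < f.eval G τ
    · obtain ⟨hR, τ', hx, hI'⟩ := hstep i τ hI hF hlt
      obtain ⟨τ'', hx', hQ⟩ := ih (i + 1) τ' (by omega) hI' (hF.trans hx.frame.tick)
      exact ⟨τ'', .while_true (hsafe i τ hI hF).1 (hsafe i τ hI hF).2 hlt hx hx', hQ⟩
    · exact ⟨_, .while_false (hsafe i τ hI hF).1 (hsafe i τ hI hF).2 hlt,
        hexit i τ hI hF (not_lt.1 hlt)⟩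

end wp

section simp_lemmas

variable (σ : St) (x y : Var) (a b : Arr) (i v : ℕ)

@[simp] theorem St.set_var : (σ.set x v).var y = if y = x then v else σ.var y := by
  simp [St.set, Function.update_apply]
@[simp] theorem St.set_arr : (σ.set x v).arr a = σ.arr a := rfl
@[simp] theorem St.set_out : (σ.set x v).out = σ.out := rfl
@[simp] theorem St.set_tm : (σ.set x v).tm = σ.tm + 1 := rfl
@[simp] theorem St.put_var : (σ.put a i v).var y = σ.var y := rfl
@[simp] theorem St.put_arr :
    (σ.put a i v).arr b = if b = a then Function.update (σ.arr b) i v else σ.arr b := by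
  by_cases h : b = a
  · subst h; simp [St.put]
  · simp [St.put, h]
@[simp] theorem St.put_out : (σ.put a i v).out = σ.out := rfl
@[simp] theorem St.put_tm : (σ.put a i v).tm = σ.tm + 1 := rfl
@[simp] theorem St.emit_var : (σ.emit v).var y = σ.var y := rfl
@[simp] theorem St.emit_arr : (σ.emit v).arr b = σ.arr b := rfl
@[simp] theorem St.emit_out : (σ.emit v).out = σ.out ++ [v] := rfl
@[simp] theorem St.emit_tm : (σ.emit v).tm = σ.tm + 1 := rfl
@[simp] theorem St.tick_var : σ.tick.var y = σ.var y := rfl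
@[simp] theorem St.tick_arr : σ.tick.arr b = σ.arr b := rfl
@[simp] theorem St.tick_out : σ.tick.out = σ.out := rfl
@[simp] theorem St.tick_tm : σ.tick.tm = σ.tm + 1 := rfl

instance : Add Expr := ⟨.bin .add⟩
instance : Sub Expr := ⟨.bin .sub⟩
instance : Mul Expr := ⟨.bin .mul⟩
instance : Div Expr := ⟨.bin .div⟩

variable (G : CoverInstance) (W : ℕ) (e f : Expr)

@[simp] theorem Expr.eval_add : (e + f).eval G σ = e.eval G σ + f.eval G σ := rfl
@[simp] theorem Expr.eval_sub : (e - f).eval G σ = e.eval G σ - f.eval G σ := rfl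
@[simp] theorem Expr.eval_mul : (e * f).eval G σ = e.eval G σ * f.eval G σ := rfl
@[simp] theorem Expr.eval_div : (e / f).eval G σ = e.eval G σ / f.eval G σ := rfl
@[simp] theorem Expr.eval_lit : (Expr.lit i).eval G σ = i := rfl
@[simp] theorem Expr.eval_var : (Expr.var x).eval G σ = σ.var x := rfl
@[simp] theorem Expr.eval_arr : (Expr.arr a e).eval G σ = σ.arr a (e.eval G σ) := rfl
@[simp] theorem Expr.eval_nSets : Expr.nSets.eval G σ = G.n := rfl
@[simp] theorem Expr.eval_nElems : Expr.nElems.eval G σ = G.m := rfl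
@[simp] theorem Expr.eval_deg : (Expr.deg e).eval G σ = G.elemDeg (e.eval G σ) := rfl
@[simp] theorem Expr.eval_entry :
    (Expr.entry e f).eval G σ = G.elemEntry (e.eval G σ) (f.eval G σ) := rfl
@[simp] theorem Expr.safe_add : (e + f).Safe G W σ ↔
    e.Safe G W σ ∧ f.Safe G W σ ∧ e.eval G σ + f.eval G σ < W := Iff.rfl
@[simp] theorem Expr.safe_mul : (e * f).Safe G W σ ↔
    e.Safe G W σ ∧ f.Safe G W σ ∧ e.eval G σ * f.eval G σ < W := Iff.rfl
@[simp] theorem Expr.safe_sub : (e - f).Safe G W σ ↔ e.Safe G W σ ∧ f.Safe G W σ := by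
  change _ ∧ _ ∧ True ↔ _
  simp
@[simp] theorem Expr.safe_div : (e / f).Safe G W σ ↔ e.Safe G W σ ∧ f.Safe G W σ := by
  change _ ∧ _ ∧ True ↔ _
  simp
@[simp] theorem Expr.safe_lit : (Expr.lit i).Safe G W σ ↔ i < W := Iff.rfl
@[simp] theorem Expr.safe_var : (Expr.var x).Safe G W σ ↔ True := Iff.rfl
@[simp] theorem Expr.safe_arr : (Expr.arr a e).Safe G W σ ↔
    e.Safe G W σ ∧ 8 * e.eval G σ + 8 < W := Iff.rfl
@[simp] theorem Expr.safe_nSets : Expr.nSets.Safe G W σ ↔ True := Iff.rfl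
@[simp] theorem Expr.safe_nElems : Expr.nElems.Safe G W σ ↔ True := Iff.rfl
@[simp] theorem Expr.safe_deg : (Expr.deg e).Safe G W σ ↔ e.Safe G W σ := Iff.rfl
@[simp] theorem Expr.safe_entry : (Expr.entry e f).Safe G W σ ↔
    e.Safe G W σ ∧ f.Safe G W σ := Iff.rfl

end simp_lemmas

/-! ### The program -/

/-- Numerical parameters: `a / b` is the approximation factor, `p / q` the tolerated fraction of
uncovered samples, `1 / Q` the precision of the thresholds, `A` the sampling rate. -/
structure Params where
  a : ℕ
  b : ℕ
  Q : ℕ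
  p : ℕ
  q : ℕ
  A : ℕ

infixr:45 " ;; " => Cmd.seq
infix:50 " ::= " => Cmd.assign

open OutlierCover.Expr (lit var)

/-- Set `L` to the binary length of `n` and prepare the sampling loop. -/
def setupCmd (pr : Params) : Cmd :=
  .n ::= .nSets ;; .m ::= .nElems ;; .L ::= lit 0 ;; .x ::= lit 1 ;;
  .while (var .x) (var .n + lit 1) (.x ::= var .x + var .x ;; .L ::= var .L + lit 1) ;;
  .S ::= lit pr.A * var .n * var .L ;; .ad ::= lit 0 ;; .en ::= lit 8 * var .S ;;
  .eight ::= lit 8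

/-- Set the cells of `a` with indices below `y` to zero. -/
def clearCmd (a : Arr) (x y : Var) : Cmd :=
  x ::= lit 0 ;; .while (var x) (var y) (.store a (var x) (lit 0) ;; x ::= var x + lit 1)

/-- Insert the first `d` edges of the sample `j`. -/
def insertCmd : Cmd :=
  .i ::= lit 0 ;; .while (var .i) (var .d)
    (.u ::= .entry (var .v) (var .i) ;; .e ::= var .e + lit 1 ;;
      .store .nxt (var .e) (.arr .head (var .u)) ;; .store .val (var .e) (var .j) ;;
      .store .head (var .u) (var .e) ;; .i ::= var .i + lit 1)

/-- Build the linked lists of the samples in every set. -/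
def buildCmd : Cmd :=
  .e ::= lit 0 ;; .j ::= lit 0 ;; .while (var .j) (var .s)
    (.v ::= .arr .smp (var .j) ;; .d ::= .deg (var .v) ;;
      .ite (var .D) (var .d) (.d ::= var .D) .skip ;; insertCmd ;; .j ::= var .j + lit 1)

/-- Count the uncovered samples in the set `u`. -/
def countCmd : Cmd :=
  .c ::= lit 0 ;; .e ::= .arr .head (var .u) ;; .while (lit 0) (var .e)
    (.c ::= var .c + (lit 1 - .arr .cov (.arr .val (var .e))) ;; .e ::= .arr .nxt (var .e))

/-- Mark the samples in the set `u` as covered. -/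
def markCmd : Cmd :=
  .e ::= .arr .head (var .u) ;; .while (lit 0) (var .e)
    (.store .cov (.arr .val (var .e)) (lit 1) ;; .e ::= .arr .nxt (var .e))

/-- Pick the set `u` if it contains at least `tau` uncovered samples. -/
def considerCmd : Cmd :=
  countCmd ;; .ite (var .t) (var .N) (.ite (var .c) (var .tau) .skip
    (markCmd ;; .unc ::= var .unc - var .c ;; .store .pick (var .t) (var .u) ;;
      .t ::= var .t + lit 1)) .skip

/-- Consider all sets with the threshold `tau`. -/
def scanCmd : Cmd :=
  .u ::= lit 0 ;; .while (var .u) (var .n) (considerCmd ;; .u ::= var .u + lit 1)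

/-- The greedy algorithm with decreasing thresholds. -/
def greedyCmd (pr : Params) : Cmd :=
  .unc ::= var .s ;; .t ::= lit 0 ;; .tau ::= var .s ;; .while (lit 0) (var .tau)
    (scanCmd ;; .tau ::= var .tau * lit pr.Q / lit (pr.Q + 1))

/-- Try to find a good solution with the guess `mid`. -/
def attemptCmd (pr : Params) : Cmd :=
  .s ::= lit pr.A * var .mid * var .L ;;
  .D ::= lit pr.Q * var .n / var .mid + lit 1 ;;
  .N ::= (lit pr.a * var .mid + lit (pr.b - 1)) / lit pr.b ;;
  clearCmd .head .u .n ;; clearCmd .cov .j .s ;; buildCmd ;; greedyCmd pr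

/-- Copy the picked sets. -/
def copyCmd : Cmd :=
  .i ::= lit 0 ;; .while (var .i) (var .t)
    (.store .best (var .i) (.arr .pick (var .i)) ;; .i ::= var .i + lit 1) ;; .bn ::= var .t

/-- Binary search for the smallest successful guess. -/
def searchCmd (pr : Params) : Cmd :=
  .while (var .lo + lit 1) (var .hi)
    (.mid ::= (var .lo + var .hi) / lit 2 ;; attemptCmd pr ;;
      .ite (lit pr.p * var .s) (lit pr.q * var .unc) (.lo ::= var .mid)
        (.hi ::= var .mid ;; copyCmd))

/-- Output the best solution. -/
def reportCmd : Cmd :=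
  .i ::= lit 0 ;; .while (var .i) (var .bn) (.emit (.arr .best (var .i)) ;; .i ::= var .i + lit 1)

/-- The deterministic part of the algorithm. -/
def solveCmd (pr : Params) : Cmd :=
  .bn ::= lit 0 ;; .lo ::= lit 0 ;; .hi ::= var .n + lit 1 ;;
  .ite (lit 0) (var .m) (searchCmd pr) .skip ;; reportCmd

/-! ### The greedy algorithm on a sketch -/

/-- Indices of the sets that contain the element `v`. -/
def CoverInstance.owners (G : CoverInstance) (v : ℕ) : List ℕ :=
  if h : v < G.m then (G.elemList ⟨v, h⟩).map Fin.val else []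

theorem elemDeg_eq (G : CoverInstance) (v : ℕ) : G.elemDeg v = (G.owners v).length := by
  unfold CoverInstance.elemDeg CoverInstance.owners
  split <;> simp

theorem elemEntry_eq (G : CoverInstance) (v j : ℕ) : G.elemEntry v j = (G.owners v).getD j 0 := by
  unfold CoverInstance.elemEntry CoverInstance.owners
  split <;> simp

theorem owners_nodup (G : CoverInstance) (v : ℕ) : (G.owners v).Nodup := by
  unfold CoverInstance.owners
  split
  · exact (G.elemList_nodup _).map Fin.val_injective
  · exact List.nodup_nil

theorem lt_of_mem_owners {G : CoverInstance} {v u : ℕ} (h : u ∈ G.owners v) : u < G.n := by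
  unfold CoverInstance.owners at h
  split at h
  · simp only [List.mem_map] at h
    obtain ⟨z, -, rfl⟩ := h
    exact z.2
  · simp at h

theorem mem_owners {G : CoverInstance} {u : Fin G.n} {v : Fin G.m} :
    (u : ℕ) ∈ G.owners v ↔ v ∈ G.setList u := by
  simp [CoverInstance.owners, G.mem_iff, Fin.val_inj]

theorem mem_covered {G : CoverInstance} {T : Finset (Fin G.n)} {v : Fin G.m} :
    v ∈ G.covered T ↔ ∃ u ∈ T, (u : ℕ) ∈ G.owners v := by
  simp [CoverInstance.covered, mem_owners]

/-- The indices among `U` of the samples that contain `u`, where `cap` lists the sets of a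
sample. -/
def hits (cap : ℕ → List ℕ) (U : Finset ℕ) (u : ℕ) : Finset ℕ :=
  U.filter fun j => u ∈ cap j

theorem hits_subset (cap : ℕ → List ℕ) (U : Finset ℕ) (u : ℕ) : hits cap U u ⊆ U :=
  Finset.filter_subset _ _

theorem hits_mono (cap : ℕ → List ℕ) {U V : Finset ℕ} (h : U ⊆ V) (u : ℕ) :
    hits cap U u ⊆ hits cap V u :=
  Finset.filter_subset_filter _ h

/-- If no set contains many of the samples in `U` then `U` is small. -/
def Sparse (n s Q k : ℕ) (cap : ℕ → List ℕ) : Prop :=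
  ∀ U ⊆ Finset.range s, ∀ M, (∀ u < n, (hits cap U u).card ≤ M) →
    Q * U.card ≤ (Q + 1) * k * M

/-- Double counting of incidences. The cover `T` accounts for the samples whose lists are not cut,
and the total number of entries bounds the samples whose lists are. -/
theorem sparse_of_cover {G : CoverInstance} {T : Finset (Fin G.n)} (hT : G.IsSetCover T)
    {s Q k D : ℕ} (hk : T.card ≤ k) (hD : Q * G.n ≤ D * k) (hD0 : 0 < D) {smp : ℕ → ℕ}
    (hsmp : ∀ j < s, smp j < G.m) :
    Sparse G.n s Q k fun j => (G.owners (smp j)).take D := by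
  intro U hU M hM
  set cap : ℕ → List ℕ := fun j => (G.owners (smp j)).take D with hcap
  -- Each sample has weight `D`: an uncut list meets `T` at least once, and a cut list has exactly
  -- `D` distinct entries.
  have key : ∀ j ∈ U, D ≤ D * (T.filter fun u : Fin G.n => (u : ℕ) ∈ cap j).card +
      ((Finset.range G.n).filter fun u => u ∈ cap j).card := by
    intro j hj
    by_cases hlen : (G.owners (smp j)).length ≤ D
    · have hv := hsmp j (Finset.mem_range.1 (hU hj))
      have : (⟨smp j, hv⟩ : Fin G.m) ∈ G.covered T := by rw [hT]; exact Finset.mem_univ _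
      obtain ⟨u, hu, hu'⟩ := mem_covered.1 this
      have : 0 < (T.filter fun u : Fin G.n => (u : ℕ) ∈ cap j).card :=
        Finset.card_pos.2 ⟨u, by simp [hcap, List.take_of_length_le hlen, hu, hu']⟩
      nlinarith
    · have h1 : ((Finset.range G.n).filter fun u => u ∈ cap j) = (cap j).toFinset := by
        ext u
        simp only [Finset.mem_filter, Finset.mem_range, List.mem_toFinset, and_iff_right_iff_imp]
        exact fun h => lt_of_mem_owners (List.mem_of_mem_take h)
      have h2 : (cap j).toFinset.card = D := by
        rw [List.toFinset_card_of_nodup ((owners_nodup G _).sublist (List.take_sublist _ _))]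
        simp; omega
      rw [h1, h2]; omega
  have h1 : D * U.card ≤ D * (T.card * M) + G.n * M := by
    calc D * U.card = ∑ j ∈ U, D := by simp [mul_comm]
      _ ≤ ∑ j ∈ U, (D * (T.filter fun u : Fin G.n => (u : ℕ) ∈ cap j).card +
          ((Finset.range G.n).filter fun u => u ∈ cap j).card) := Finset.sum_le_sum key
      _ = D * (∑ u ∈ T, (hits cap U u).card) + ∑ u ∈ Finset.range G.n, (hits cap U u).card := by
        rw [Finset.sum_add_distrib, ← Finset.mul_sum]
        simp only [hits, Finset.card_filter]
        rw [Finset.sum_comm, Finset.sum_comm (s := U) (t := Finset.range G.n)]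
      _ ≤ _ := by
        refine add_le_add (Nat.mul_le_mul_left _ ?_) ?_
        · exact (Finset.sum_le_card_nsmul T _ M fun u _ => hM u u.2).trans_eq (smul_eq_mul _ _)
        · exact (Finset.sum_le_card_nsmul _ _ M fun u hu => hM u (Finset.mem_range.1 hu)).trans_eq
            (by simp)
  have h2 : D * (Q * U.card) ≤ D * ((Q + 1) * k * M) := by
    calc D * (Q * U.card) = Q * (D * U.card) := by ring
      _ ≤ Q * (D * (T.card * M) + G.n * M) := by gcongr
      _ = Q * (D * (T.card * M)) + Q * G.n * M := by ring
      _ ≤ Q * (D * (k * M)) + D * k * M := by gcongr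
      _ = D * ((Q + 1) * k * M) := by ring
  exact Nat.le_of_mul_le_mul_left h2 hD0

/-- The samples that are not marked as covered. -/
def uncovered (s : ℕ) (cov : ℕ → ℕ) : Finset ℕ :=
  (Finset.range s).filter fun j => cov j = 0

/-- Guaranteed ratio of the numbers of uncovered samples after and before a greedy step. -/
noncomputable def ratio (Q k : ℕ) : ℝ := 1 - (Q : ℝ) ^ 2 / ((Q + 1) ^ 2 * k)

theorem ratio_nonneg {Q k : ℕ} (hk : 0 < k) : 0 ≤ ratio Q k := by
  unfold ratio
  have : (1 : ℝ) ≤ k := by exact_mod_cast hk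
  have hQ : (0 : ℝ) ≤ Q := Nat.cast_nonneg Q
  rw [sub_nonneg, div_le_one (by positivity)]
  nlinarith [mul_nonneg hQ hQ]

/-- What holds after `t` steps of the greedy algorithm. -/
structure GreedyInv (n s Q k N : ℕ) (cap : ℕ → List ℕ) (cov pick : ℕ → ℕ) (t unc : ℕ) :
    Prop where
  cov_le : ∀ j, j < s → cov j ≤ 1
  covered : ∀ j < s, cov j = 1 → ∃ i < t, pick i ∈ cap j
  pick_lt : ∀ i < t, pick i < n
  unc_eq : unc = (uncovered s cov).card
  t_le : t ≤ N
  progress : Sparse n s Q k cap → (unc : ℝ) ≤ s * ratio Q k ^ t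

theorem GreedyInv.init {n s Q k N : ℕ} {cap : ℕ → List ℕ} {cov pick : ℕ → ℕ}
    (h : ∀ j < s, cov j = 0) : GreedyInv n s Q k N cap cov pick 0 s where
  cov_le j hj := by rw [h j hj]; omega
  covered j hj h' := by rw [h j hj] at h'; omega
  pick_lt i hi := by omega
  unc_eq := by
    rw [uncovered, Finset.filter_true_of_mem fun j hj => h j (Finset.mem_range.1 hj),
      Finset.card_range]
  t_le := Nat.zero_le _
  progress _ := by simp

/-- Sparsity gives `Q * unc ≤ (Q + 1) * k * M` for `M = tau * (Q + 1) / Q`, while the picked set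
hits at least `tau` uncovered samples. The two losses of `(Q + 1) / Q`, one from cutting lists and
one from thresholds, make up the square in `ratio`. -/
theorem GreedyInv.step {n s Q k N : ℕ} {cap : ℕ → List ℕ} {cov cov' pick : ℕ → ℕ}
    {t unc tau u : ℕ} (h : GreedyInv n s Q k N cap cov pick t unc) (hQ : 0 < Q) (hk : 0 < k)
    (ht : t < N) (hu : u < n)
    (hcov' : ∀ j < s, cov' j = if u ∈ cap j then 1 else cov j)
    (hM : ∀ u' < n, (hits cap (uncovered s cov) u').card * Q ≤ tau * (Q + 1))
    (htau : tau ≤ (hits cap (uncovered s cov) u).card) :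
    GreedyInv n s Q k N cap cov' (Function.update pick t u) (t + 1)
      (unc - (hits cap (uncovered s cov) u).card) := by
  have hset : uncovered s cov' = uncovered s cov \ hits cap (uncovered s cov) u := by
    ext j
    simp only [uncovered, hits, Finset.mem_filter, Finset.mem_range, Finset.mem_sdiff]
    constructor
    · rintro ⟨hj, hj'⟩
      rw [hcov' j hj] at hj'
      split_ifs at hj' with hc
      exact ⟨⟨hj, hj'⟩, fun h => hc h.2⟩
    · rintro ⟨⟨hj, hj'⟩, hc⟩
      rw [hcov' j hj, if_neg fun h => hc ⟨⟨hj, hj'⟩, h⟩]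
      exact ⟨hj, hj'⟩
  have hle : (hits cap (uncovered s cov) u).card ≤ (uncovered s cov).card :=
    Finset.card_le_card (hits_subset _ _ _)
  refine ⟨fun j hj => ?_, fun j hj h' => ?_, fun i hi => ?_, ?_, ht, fun hsp => ?_⟩
  · rw [hcov' j hj]; split_ifs
    · exact le_rfl
    · exact h.cov_le j hj
  · rw [hcov' j hj] at h'
    split_ifs at h' with hc
    · exact ⟨t, by omega, by simpa using hc⟩
    · obtain ⟨i, hi, hi'⟩ := h.covered j hj h'
      exact ⟨i, by omega, by rwa [Function.update_of_ne hi.ne]⟩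
  · by_cases hi' : i = t
    · subst hi'; simpa using hu
    · rw [Function.update_of_ne hi']; exact h.pick_lt i (by omega)
  · rw [hset, Finset.card_sdiff_of_subset (hits_subset _ _ _), h.unc_eq]
  · set c := (hits cap (uncovered s cov) u).card
    have h1 := hsp (uncovered s cov) (Finset.filter_subset _ _) (tau * (Q + 1) / Q) fun u' hu' =>
      (Nat.le_div_iff_mul_le hQ).2 (hM u' hu')
    rw [← h.unc_eq] at h1 hle
    have h2 : Q * Q * unc ≤ (Q + 1) * (Q + 1) * k * c := by
      calc Q * Q * unc = Q * (Q * unc) := by ring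
        _ ≤ Q * ((Q + 1) * k * (tau * (Q + 1) / Q)) := by gcongr
        _ = (Q + 1) * k * (tau * (Q + 1) / Q * Q) := by ring
        _ ≤ (Q + 1) * k * (tau * (Q + 1)) := Nat.mul_le_mul_left _ (Nat.div_mul_le_self _ _)
        _ ≤ (Q + 1) * k * (c * (Q + 1)) := by gcongr
        _ = _ := by ring
    have h3 : (Q : ℝ) * Q * unc ≤ (Q + 1) * (Q + 1) * k * c := by exact_mod_cast h2
    have hk' : (0 : ℝ) < k := by exact_mod_cast hk
    have h4 : (Q : ℝ) ^ 2 / ((Q + 1) ^ 2 * k) * unc ≤ c := by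
      rw [div_mul_eq_mul_div, div_le_iff₀ (by positivity)]
      nlinarith
    have h5 := mul_le_mul_of_nonneg_right (h.progress hsp) (ratio_nonneg (Q := Q) hk)
    rw [Nat.cast_sub hle, pow_succ]
    have h6 : (unc : ℝ) - c ≤ unc * ratio Q k := by unfold ratio; linarith
    linarith

/-- Greedy stops either with all `N` picks made, where `1 - x ≤ exp (-x)` turns the power of `ratio`
into the exponential, or when no set hits an uncovered sample. -/
theorem GreedyInv.success {n s Q k N : ℕ} {cap : ℕ → List ℕ} {cov pick : ℕ → ℕ} {t unc a b p q : ℕ}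
    (h : GreedyInv n s Q k N cap cov pick t unc) (hk : 0 < k) (hb : 0 < b) (hQ : 0 < Q)
    (hq : 0 < q) (hN : a * k ≤ N * b)
    (hexp : Real.exp (-((Q : ℝ) ^ 2 / (Q + 1) ^ 2 * (a / b))) ≤ p / q)
    (hend : t = N ∨ ∀ u < n, (hits cap (uncovered s cov) u).card * Q ≤ 0)
    (hsp : Sparse n s Q k cap) : q * unc ≤ p * s := by
  rcases hend with rfl | hend
  · have h1 := h.progress hsp
    have hk' : (0 : ℝ) < k := by exact_mod_cast hk
    have hb' : (0 : ℝ) < b := by exact_mod_cast hb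
    have hq' : (0 : ℝ) < q := by exact_mod_cast hq
    have h2 : ratio Q k ^ t ≤ p / q := by
      refine le_trans ?_ hexp
      have : ratio Q k ≤ Real.exp (-((Q : ℝ) ^ 2 / ((Q + 1) ^ 2 * k))) := by
        have := Real.add_one_le_exp (-((Q : ℝ) ^ 2 / ((Q + 1) ^ 2 * k)))
        unfold ratio; linarith
      refine (pow_le_pow_left₀ (ratio_nonneg hk) this t).trans ?_
      rw [← Real.exp_nat_mul, Real.exp_le_exp, mul_neg, neg_le_neg_iff]
      have h3 : (a : ℝ) / b ≤ t / k := by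
        rw [div_le_div_iff₀ hb' hk']; exact_mod_cast hN
      calc (Q : ℝ) ^ 2 / (Q + 1) ^ 2 * (a / b) ≤ (Q : ℝ) ^ 2 / (Q + 1) ^ 2 * (t / k) := by gcongr
        _ = _ := by field_simp
    have h3 : (unc : ℝ) ≤ s * (p / q) := h1.trans (by gcongr)
    have h4 : (q : ℝ) * unc ≤ p * s := by
      calc (q : ℝ) * unc ≤ q * (s * (p / q)) := by gcongr
        _ = p * s := by field_simp
    exact_mod_cast h4
  -- Sparsity with `M = 0`: nothing is left uncovered.
  · have h1 := hsp (uncovered s cov) (Finset.filter_subset _ _) 0 fun u hu => by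
      have := hend u hu
      simpa [hQ.ne'] using this
    have h2 : (uncovered s cov).card = 0 := by simpa [hQ.ne'] using h1
    rw [h.unc_eq, h2]; simp

/-! ### Correctness of the parts of the program -/

section parts

variable {G : CoverInstance} {W : ℕ} {σ : St}

theorem clearCmd_spec {a : Arr} {x y : Var} (hxy : y ≠ x) (hb : 8 * σ.var y + 16 < W) :
    wp G W (clearCmd a x y) (fun τ => (∀ i < σ.var y, τ.arr a i = 0) ∧
      τ.tm ≤ σ.tm + 3 * σ.var y + 2) σ := by
  unfold clearCmd
  rw [wp_seq, wp_assign]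
  refine ⟨by simp; omega, wp_while (fun i τ => τ.var x = i ∧ i ≤ σ.var y ∧ τ.var y = σ.var y ∧
    (∀ k < i, τ.arr a k = 0) ∧ τ.tm = σ.tm + 1 + 3 * i) (σ.var y) ?_ ?_ ?_ ?_⟩
  · simp [hxy]
  · simp
  · rintro i τ ⟨h1, h2, h3, h4, h5⟩ - hlt
    simp only [Expr.eval_var, h1, h3] at hlt
    refine ⟨hlt, ?_⟩
    simp only [wp_seq, wp_store, wp_assign]
    simp [h1, h3, hxy, h5]
    refine ⟨⟨by omega, by omega⟩, by omega, hlt, fun k hk => ?_, by omega⟩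
    by_cases hki : k = i
    · subst hki; simp
    · rw [Function.update_of_ne hki]; exact h4 k (by omega)
  · rintro i τ ⟨h1, h2, h3, h4, h5⟩ - hle
    simp only [Expr.eval_var, h1, h3] at hle
    obtain rfl : i = σ.var y := by omega
    refine ⟨by simpa using h4, ?_⟩
    simp [h5]; omega

/-- Following the pointers `nxt` from `p` one reads the values of the list; all nodes have numbers
from `1` to `e`. -/
def Chain (e : ℕ) (nxt val : ℕ → ℕ) : List ℕ → ℕ → Prop
  | [], p => p = 0
  | j :: l, p => 0 < p ∧ p ≤ e ∧ val p = j ∧ Chain e nxt val l (nxt p)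

/-- A new node gets the number `e + 1`, beyond all nodes in use, so writing it leaves the existing
lists intact. -/
theorem Chain.congr {e e' : ℕ} {nxt val nxt' val' : ℕ → ℕ} {l : List ℕ} {p : ℕ}
    (h : Chain e nxt val l p) (he : e ≤ e') (hn : ∀ r ≤ e, nxt' r = nxt r)
    (hv : ∀ r ≤ e, val' r = val r) : Chain e' nxt' val' l p := by
  induction l generalizing p with
  | nil => exact h
  | cons j l ih =>
    obtain ⟨h1, h2, h3, h4⟩ := h
    exact ⟨h1, h2.trans he, (hv p h2).trans h3, by rw [hn p h2]; exact ih h4⟩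

/-- The linked lists `adj u` of the samples with the set `u` after the insertion of the first `D`
edges of the samples below `j` and of the first `i` edges of the sample `j`. -/
structure Lists (G : CoverInstance) (smp : ℕ → ℕ) (D j i e : ℕ) (nxt val head : ℕ → ℕ)
    (adj : ℕ → List ℕ) : Prop where
  chain : ∀ u < G.n, Chain e nxt val (adj u) (head u)
  nodup : ∀ u, (adj u).Nodup
  mem : ∀ u k, k ∈ adj u ↔ (k < j ∧ u ∈ (G.owners (smp k)).take D) ∨
    (k = j ∧ u ∈ (G.owners (smp j)).take i)
  sum : ∑ u ∈ Finset.range G.n, (adj u).length = e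

/-- The new node is put in front of the list of `u`. The sample `j` is not yet there, because `u`
occurs only once among its owners. -/
theorem Lists.insert {smp : ℕ → ℕ} {D j i e u : ℕ} {nxt val head : ℕ → ℕ} {adj : ℕ → List ℕ}
    (h : Lists G smp D j i e nxt val head adj) (hu : (G.owners (smp j))[i]? = some u) :
    Lists G smp D j (i + 1) (e + 1) (Function.update nxt (e + 1) (head u))
      (Function.update val (e + 1) j) (Function.update head u (e + 1))
      (Function.update adj u (j :: adj u)) where
  chain u' hu' := by
    have hn : ∀ r ≤ e, Function.update nxt (e + 1) (head u) r = nxt r := fun r hr =>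
      Function.update_of_ne (by omega) _ _
    have hv : ∀ r ≤ e, Function.update val (e + 1) j r = val r := fun r hr =>
      Function.update_of_ne (by omega) _ _
    by_cases h' : u' = u
    · subst h'
      simp only [Function.update_self, Chain]
      exact ⟨by omega, le_rfl, trivial, (h.chain u' hu').congr (Nat.le_succ e) hn hv⟩
    · simp only [Function.update_of_ne h']
      exact (h.chain u' hu').congr (Nat.le_succ e) hn hv
  nodup u' := by
    by_cases h' : u' = u
    · subst h'
      simp only [Function.update_self, List.nodup_cons]
      refine ⟨fun hj => ?_, h.nodup _⟩
      rcases (h.mem _ _).1 hj with ⟨h1, -⟩ | ⟨-, h1⟩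
      · omega
      · have hlt : i < (G.owners (smp j)).length := (List.getElem?_eq_some_iff.1 hu).1
        obtain ⟨r, hr, hr'⟩ := List.mem_take_iff_getElem.1 h1
        have := (List.getElem?_eq_some_iff.1 hu).2
        have := (owners_nodup G (smp j)).getElem_inj_iff.1 (hr'.trans this.symm)
        omega
    · simp only [Function.update_of_ne h']; exact h.nodup _
  mem u' k := by
    have ht : (G.owners (smp j)).take (i + 1) = (G.owners (smp j)).take i ++ [u] := by
      rw [List.take_add_one, hu]; rfl
    rw [ht]
    by_cases h' : u' = u
    · subst h'
      simp only [Function.update_self, List.mem_cons, h.mem, List.mem_append]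
      tauto
    · simp only [Function.update_of_ne h', h.mem, List.mem_append, List.mem_cons, h',
        List.not_mem_nil, or_false]
  sum := by
    have hu' : u ∈ Finset.range G.n :=
      Finset.mem_range.2 (lt_of_mem_owners (List.mem_of_getElem? hu))
    rw [← h.sum, ← Finset.add_sum_erase _ _ hu', ← Finset.add_sum_erase _ _ hu']
    rw [Finset.sum_congr rfl (g := fun u' => (adj u').length) fun u' hu'' => by
      rw [Function.update_of_ne (Finset.ne_of_mem_erase hu'')]]
    simp; omega

theorem Lists.next {smp : ℕ → ℕ} {D j i e : ℕ} {nxt val head : ℕ → ℕ} {adj : ℕ → List ℕ}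
    (h : Lists G smp D j i e nxt val head adj) (hi : i = min (G.owners (smp j)).length D) :
    Lists G smp D (j + 1) 0 e nxt val head adj where
  chain := h.chain
  nodup := h.nodup
  mem u k := by
    have ht : (G.owners (smp j)).take i = (G.owners (smp j)).take D := by
      rw [List.take_eq_take_iff]; omega
    rw [h.mem, ht]
    simp only [List.take_zero, List.not_mem_nil, and_false, or_false]
    constructor
    · rintro (⟨h1, h2⟩ | ⟨rfl, h2⟩)
      · exact ⟨by omega, h2⟩
      · exact ⟨by omega, h2⟩
    · rintro ⟨h1, h2⟩
      by_cases hk : k = j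
      · subst hk; exact .inr ⟨rfl, h2⟩
      · exact .inl ⟨by omega, h2⟩
  sum := h.sum

theorem insertCmd_spec {D d j : ℕ} {adj : ℕ → List ℕ} (hv : σ.var .d = d)
    (hj : σ.var .j = j)
    (hsmp : σ.var .v = σ.arr .smp j) (hd : d ≤ (G.owners (σ.arr .smp j)).length)
    (hl : Lists G (σ.arr .smp) D j 0 (σ.var .e) (σ.arr .nxt) (σ.arr .val) (σ.arr .head) adj)
    (hn : 8 * G.n + 16 < W) (he : 8 * (σ.var .e + d) + 16 < W) :
    wp G W insertCmd (fun τ => (∃ adj', Lists G (σ.arr .smp) D j d (τ.var .e) (τ.arr .nxt)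
      (τ.arr .val) (τ.arr .head) adj') ∧ τ.var .e = σ.var .e + d ∧ τ.tm = σ.tm + 7 * d + 2) σ := by
  unfold insertCmd
  rw [wp_seq, wp_assign]
  refine ⟨by simp; omega, wp_while (fun i τ => τ.var .i = i ∧ i ≤ d ∧
    (∃ adj', Lists G (σ.arr .smp) D j i (τ.var .e) (τ.arr .nxt)
      (τ.arr .val) (τ.arr .head) adj') ∧ τ.var .e = σ.var .e + i ∧ τ.tm = σ.tm + 1 + 7 * i)
      d ?_ ?_ ?_ ?_⟩
  · exact ⟨by simp, by omega, ⟨adj, by simpa using hl⟩, by simp, by simp⟩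
  · simp
  · rintro i τ ⟨h1, h2, ⟨adj', h3⟩, h4, h5⟩ hF hlt
    have fd : τ.var .d = d := (hF.var .d rfl).trans hv
    have fv : τ.var .v = σ.arr .smp j := (hF.var .v rfl).trans hsmp
    have fj : τ.var .j = j := (hF.var .j rfl).trans hj
    simp only [Expr.eval_var, h1, fd] at hlt
    refine ⟨hlt, ?_⟩
    obtain ⟨u, hu⟩ : ∃ u, (G.owners (σ.arr .smp j))[i]? = some u :=
      ⟨_, List.getElem?_eq_getElem (by omega)⟩
    have hun : u < G.n := lt_of_mem_owners (List.mem_of_getElem? hu)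
    have := h3.insert hu
    simp only [wp_seq, wp_store, wp_assign]
    simp [h1, fv, fj, h4, h5, elemEntry_eq, hu]
    rw [h4] at this
    exact ⟨by omega, by omega, by omega, by omega, by omega, hlt, ⟨_, this⟩, by omega, by omega⟩
  · rintro i τ ⟨h1, h2, h3, h4, h5⟩ hF hle
    have fd : τ.var .d = d := (hF.var .d rfl).trans hv
    simp only [Expr.eval_var, h1, fd] at hle
    obtain rfl : i = d := by omega
    exact ⟨by simpa using h3, by simpa using h4, by simp [h5]; omega⟩

theorem buildCmd_spec {D s : ℕ} (hs : σ.var .s = s) (hD : σ.var .D = D)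
    (hhead : ∀ u < G.n, σ.arr .head u = 0) (hn : 8 * G.n + 16 < W)
    (he : 8 * (s * D) + 16 < W) (hs' : 8 * s + 16 < W) :
    wp G W buildCmd (fun τ => (∃ e adj, e ≤ s * D ∧ Lists G (σ.arr .smp) D s 0 e (τ.arr .nxt)
      (τ.arr .val) (τ.arr .head) adj) ∧ τ.tm ≤ σ.tm + s * (7 * D + 10) + 3) σ := by
  unfold buildCmd
  simp only [wp_seq, wp_assign]
  refine ⟨by simp; omega, by simp; omega, wp_while (fun j τ => τ.var .j = j ∧ j ≤ s ∧
    τ.var .e ≤ j * D ∧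
    (∃ adj', Lists G (σ.arr .smp) D j 0 (τ.var .e) (τ.arr .nxt) (τ.arr .val) (τ.arr .head) adj') ∧
      τ.tm ≤ σ.tm + 2 + j * (7 * D + 10)) s ?_ ?_ ?_ ?_⟩
  · refine ⟨by simp, by omega, by simp, ⟨fun _ => [], ?_, ?_, ?_, ?_⟩, by simp⟩
    · intro u hu; simpa [Chain] using hhead u hu
    · simp
    · simp
    · simp
  · simp
  · rintro j τ ⟨h1, h2, h3, ⟨adj', h4⟩, h5⟩ hF hlt
    have fs : τ.var .s = s := (hF.var .s rfl).trans hs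
    have fD : τ.var .D = D := (hF.var .D rfl).trans hD
    have fsmp : τ.arr .smp = σ.arr .smp := (hF.arr .smp rfl)
    simp only [Expr.eval_var, h1, fs] at hlt
    refine ⟨hlt, ?_⟩
    have hjD : (j + 1) * D ≤ s * D := Nat.mul_le_mul_right _ hlt
    rw [add_mul, one_mul] at hjD
    -- Both outcomes of the comparison with `D` continue with the same insertion, with `d` the
    -- minimum of the degree and `D`; it is treated once, for any state `ρ` of that kind.
    have main : ∀ ρ : St, ρ.var .d = min (G.owners (σ.arr .smp j)).length D → ρ.var .j = j →
        ρ.var .v = σ.arr .smp j → ρ.var .e = τ.var .e → ρ.arr = τ.arr → ρ.tm ≤ τ.tm + 6 →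
        wp G W insertCmd (fun ρ' => (ρ'.var .j + 1 < W) ∧ (ρ'.var .j + 1 = j + 1 ∧ j + 1 ≤ s ∧
          ρ'.var .e ≤ (j + 1) * D ∧
          (∃ adj', Lists G (σ.arr .smp) D (j + 1) 0 (ρ'.var .e) (ρ'.arr .nxt) (ρ'.arr .val)
            (ρ'.arr .head) adj') ∧ ρ'.tm + 1 ≤ σ.tm + 2 + (j + 1) * (7 * D + 10))) ρ := by
      intro ρ r1 r2 r3 r4 r5 r6
      have hm : min (G.owners (σ.arr .smp j)).length D ≤ D := min_le_right _ _
      refine wp_mono (insertCmd_spec (D := D) (adj := adj') r1 r2 ?_ ?_ ?_ hn ?_) ?_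
      · rw [r3, r5, fsmp]
      · rw [r5, fsmp]; exact min_le_left _ _
      · rw [r4, r5, fsmp]; exact h4
      · rw [r4]; omega
      · rintro ρ' ⟨⟨adj'', h6⟩, h7, h8⟩ hF'
        have fj : ρ'.var .j = j := (hF'.var .j rfl).trans r2
        rw [r5, fsmp] at h6
        rw [r4] at h7
        refine ⟨by omega, by omega, by omega, by rw [add_mul, one_mul]; omega,
          ⟨adj'', h6.next rfl⟩, ?_⟩
        rw [add_mul, one_mul]
        omega
    simp only [wp_seq, wp_assign, wp_ite, wp_skip]
    simp [h1, fD, fsmp, elemDeg_eq]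
    refine ⟨by omega, fun hlt' => ?_, fun hle' => ?_⟩
    · refine wp_mono (main _ ?_ ?_ ?_ ?_ ?_ ?_) ?_
      · simp; omega
      · simpa using h1
      · simp
      · simp
      · rfl
      · simp
      · rintro ρ' ⟨h6, h7, h8, h9, h10, h11⟩ -
        simp at h7
        refine ⟨⟨by omega, h6⟩, h7, h8, h9, h10, h11⟩
    · refine wp_mono (main _ ?_ ?_ ?_ ?_ ?_ ?_) ?_
      · simp; omega
      · simpa using h1
      · simp
      · simp
      · rfl
      · simp
      · rintro ρ' ⟨h6, h7, h8, h9, h10, h11⟩ -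
        simp at h7
        refine ⟨⟨by omega, h6⟩, h7, h8, h9, h10, h11⟩
  · rintro j τ ⟨h1, h2, h3, ⟨adj', h4⟩, h5⟩ hF hle
    have fs : τ.var .s = s := (hF.var .s rfl).trans hs
    simp only [Expr.eval_var, h1, fs] at hle
    obtain rfl : j = s := by omega
    exact ⟨⟨_, adj', h3, h4⟩, by simp; omega⟩

theorem countCmd_spec {e s : ℕ} {l : List ℕ}
    (hl : Chain e (σ.arr .nxt) (σ.arr .val) l (σ.arr .head (σ.var .u)))
    (hu : 8 * σ.var .u + 16 < W) (he : 8 * e + 16 < W) (hs : 8 * s + 16 < W)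
    (hmem : ∀ j ∈ l, j < s) (hlen : l.length < W) :
    wp G W countCmd (fun τ => τ.var .c = (l.map fun j => 1 - σ.arr .cov j).sum ∧
      τ.tm = σ.tm + 3 * l.length + 3) σ := by
  unfold countCmd
  simp only [wp_seq, wp_assign]
  have hsum : ∀ l' : List ℕ, (l'.map fun j => 1 - σ.arr .cov j).sum ≤ l'.length := fun l' => by
    simpa using List.sum_le_card_nsmul (l'.map fun j => 1 - σ.arr .cov j) 1 (by simp)
  refine ⟨by simp; omega, by simp; omega, wp_while (fun i τ => ∃ l',
    Chain e (τ.arr .nxt) (τ.arr .val) l' (τ.var .e) ∧ l' <:+ l ∧ i + l'.length = l.length ∧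
    τ.var .c + (l'.map fun j => 1 - σ.arr .cov j).sum = (l.map fun j => 1 - σ.arr .cov j).sum ∧
    τ.tm = σ.tm + 2 + 3 * i) l.length ?_ ?_ ?_ ?_⟩
  · exact ⟨l, by simpa using hl, List.suffix_rfl, by simp, by simp, by simp⟩
  · simp; omega
  · rintro i τ ⟨l', h1, h2, h3, h4, h5⟩ hF hlt
    have fcov : τ.arr .cov = σ.arr .cov := (hF.arr .cov rfl)
    simp only [Expr.eval_var, Expr.eval_lit] at hlt
    rcases l' with _ | ⟨j, l'⟩
    · exact absurd h1 (by simp [Chain]; omega)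
    obtain ⟨c1, c2, c3, c4⟩ := h1
    have hj := hmem j (h2.subset (by simp))
    have := hsum l
    simp only [List.map_cons, List.sum_cons, List.length_cons] at h4 h3
    refine ⟨by omega, ?_⟩
    simp only [wp_seq, wp_assign]
    simp [c3, fcov]
    refine ⟨⟨⟨by omega, by omega, by omega⟩, by omega⟩, by omega, l', c4,
      (List.suffix_cons j l').trans h2, by omega, by omega, by omega⟩
  · rintro i τ ⟨l', h1, h2, h3, h4, h5⟩ hF hle
    simp only [Expr.eval_var, Expr.eval_lit] at hle
    rcases l' with _ | ⟨j, l'⟩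
    · simp at h3 h4
      exact ⟨by simpa using h4, by simp [h5, h3]; omega⟩
    · exact absurd h1 (by simp [Chain]; omega)

theorem markCmd_spec {e s : ℕ} {l : List ℕ}
    (hl : Chain e (σ.arr .nxt) (σ.arr .val) l (σ.arr .head (σ.var .u)))
    (hu : 8 * σ.var .u + 16 < W) (he : 8 * e + 16 < W) (hs : 8 * s + 16 < W)
    (hmem : ∀ j ∈ l, j < s) :
    wp G W markCmd (fun τ => (∀ j, τ.arr .cov j = if j ∈ l then 1 else σ.arr .cov j) ∧
      τ.tm = σ.tm + 3 * l.length + 2) σ := by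
  unfold markCmd
  simp only [wp_seq, wp_assign]
  refine ⟨by simp; omega, wp_while (fun i τ => ∃ l₁ l₂, l = l₁ ++ l₂ ∧
    Chain e (τ.arr .nxt) (τ.arr .val) l₂ (τ.var .e) ∧ l₁.length = i ∧
    (∀ j, τ.arr .cov j = if j ∈ l₁ then 1 else σ.arr .cov j) ∧
    τ.tm = σ.tm + 1 + 3 * i) l.length ?_ ?_ ?_ ?_⟩
  · exact ⟨[], l, rfl, by simpa using hl, rfl, by simp, by simp⟩
  · simp; omega
  · rintro i τ ⟨l₁, l₂, rfl, h2, h3, h4, h5⟩ hF hlt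
    simp only [Expr.eval_var, Expr.eval_lit] at hlt
    rcases l₂ with _ | ⟨j, l₂⟩
    · exact absurd h2 (by simp [Chain]; omega)
    obtain ⟨c1, c2, c3, c4⟩ := h2
    have hj := hmem j (by simp)
    refine ⟨by simp; omega, ?_⟩
    simp only [wp_seq, wp_store, wp_assign]
    simp [c3]
    refine ⟨⟨by omega, by omega, by omega⟩, by omega, l₁ ++ [j], l₂, by simp, c4, by simp [h3],
      fun k => ?_, by omega⟩
    by_cases hk : k = j
    · subst hk; simp
    · simp [h4, hk]
  · rintro i τ ⟨l₁, l₂, rfl, h2, h3, h4, h5⟩ hF hle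
    simp only [Expr.eval_var, Expr.eval_lit] at hle
    rcases l₂ with _ | ⟨j, l₂⟩
    · exact ⟨by simpa using h4, by simp [h5, h3]; omega⟩
    · exact absurd h2 (by simp [Chain]; omega)

end parts

/-! ### The threshold greedy algorithm as executed -/

section greedy

variable {G : CoverInstance} {W : ℕ} {σ : St}

/-- The first `D` sets of every sample. -/
def CoverInstance.cap (G : CoverInstance) (smp : ℕ → ℕ) (D : ℕ) (j : ℕ) : List ℕ :=
  (G.owners (smp j)).take D

theorem Lists.mem_final {smp : ℕ → ℕ} {D s e : ℕ} {nxt val head : ℕ → ℕ} {adj : ℕ → List ℕ}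
    (h : Lists G smp D s 0 e nxt val head adj) {u j : ℕ} :
    j ∈ adj u ↔ j < s ∧ u ∈ G.cap smp D j := by
  simp [h.mem, CoverInstance.cap]

/-- Marks are 0 or 1, so `1 - cov j` is the indicator of an uncovered sample. -/
theorem Lists.sum_eq_card {smp : ℕ → ℕ} {D s e : ℕ} {nxt val head : ℕ → ℕ} {adj : ℕ → List ℕ}
    (h : Lists G smp D s 0 e nxt val head adj) {cov : ℕ → ℕ} (hcov : ∀ j < s, cov j ≤ 1) (u : ℕ) :
    ((adj u).map fun j => 1 - cov j).sum = (hits (G.cap smp D) (uncovered s cov) u).card := by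
  rw [← List.sum_toFinset _ (h.nodup u)]
  have : hits (G.cap smp D) (uncovered s cov) u =
      (adj u).toFinset.filter fun j => cov j = 0 := by
    ext j
    simp only [hits, uncovered, Finset.mem_filter, Finset.mem_range, List.mem_toFinset,
      h.mem_final]
    tauto
  rw [this, Finset.card_filter]
  refine Finset.sum_congr rfl fun j hj => ?_
  have := hcov j (h.mem_final.1 (List.mem_toFinset.1 hj)).1
  split_ifs <;> omega

/-- Whether or not `u` is picked, afterwards it hits fewer than `tau` uncovered samples, unless the
budget `N` is used up. -/
theorem considerCmd_spec {smp : ℕ → ℕ} {D s e Q k N u tau : ℕ} {adj : ℕ → List ℕ}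
    (hL : Lists G smp D s 0 e (σ.arr .nxt) (σ.arr .val) (σ.arr .head) adj)
    (hg : GreedyInv G.n s Q k N (G.cap smp D) (σ.arr .cov) (σ.arr .pick) (σ.var .t) (σ.var .unc))
    (hQ : 0 < Q) (hk : 0 < k) (hu : σ.var .u = u) (hun : u < G.n) (hN : σ.var .N = N)
    (htau : σ.var .tau = tau) (htau0 : 0 < tau)
    (hM : σ.var .t = N ∨ ∀ u' < G.n,
      (hits (G.cap smp D) (uncovered s (σ.arr .cov)) u').card * Q ≤ tau * (Q + 1))
    (bn : 8 * G.n + 16 < W) (be : 8 * e + 16 < W) (bs : 8 * s + 16 < W) (bN : 8 * N + 16 < W) :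
    wp G W considerCmd (fun τ => GreedyInv G.n s Q k N (G.cap smp D) (τ.arr .cov) (τ.arr .pick)
        (τ.var .t) (τ.var .unc) ∧ uncovered s (τ.arr .cov) ⊆ uncovered s (σ.arr .cov) ∧
      (σ.var .t = N → τ.var .t = N) ∧
      (τ.var .t = N ∨ (hits (G.cap smp D) (uncovered s (τ.arr .cov)) u).card < tau) ∧
      τ.tm ≤ σ.tm + 6 * (adj u).length + 10) σ := by
  have hlen : (adj u).length ≤ e := by
    rw [← hL.sum]
    exact Finset.single_le_sum (f := fun u => (adj u).length) (fun _ _ => Nat.zero_le _)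
      (Finset.mem_range.2 hun)
  unfold considerCmd
  rw [wp_seq]
  refine wp_mono (countCmd_spec (e := e) (s := s) (l := adj u) ?_ (by omega) be bs
    (fun j hj => (hL.mem_final.1 hj).1) (by omega)) ?_
  · rw [hu]; exact hL.chain u hun
  rintro τ ⟨hc, htm⟩ hF
  have fcov : τ.arr .cov = σ.arr .cov := hF.arr .cov rfl
  have fpick : τ.arr .pick = σ.arr .pick := hF.arr .pick rfl
  have fnxt : τ.arr .nxt = σ.arr .nxt := hF.arr .nxt rfl
  have fval : τ.arr .val = σ.arr .val := hF.arr .val rfl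
  have fhead : τ.arr .head = σ.arr .head := hF.arr .head rfl
  have ft : τ.var .t = σ.var .t := hF.var .t rfl
  have fN : τ.var .N = N := (hF.var .N rfl).trans hN
  have fu : τ.var .u = u := (hF.var .u rfl).trans hu
  have ftau : τ.var .tau = tau := (hF.var .tau rfl).trans htau
  have func : τ.var .unc = σ.var .unc := hF.var .unc rfl
  rw [hL.sum_eq_card hg.cov_le] at hc
  simp only [wp_ite, wp_skip]
  refine ⟨by simp, fun hlt => ⟨by simp, fun hlt' => ?_, fun hle => ?_⟩, fun hle => ?_⟩
  · simp [hc, ftau] at hlt'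
    simp [fcov, fpick, ft, func]
    exact ⟨hg, .inr hlt', by omega⟩
  · simp [hc, ftau] at hle
    simp [ft, fN] at hlt
    rw [wp_seq]
    refine wp_mono (markCmd_spec (e := e) (s := s) (l := adj u) ?_ (by simp; omega) be bs
      (fun j hj => (hL.mem_final.1 hj).1)) ?_
    · simp only [St.tick_arr, St.tick_var, fnxt, fval, fhead, fu]; exact hL.chain u hun
    rintro ρ ⟨hcov', htm'⟩ hF'
    simp only [St.tick_arr, St.tick_tm, fcov] at hcov' htm'
    have gpick : ρ.arr .pick = σ.arr .pick := (hF'.arr .pick rfl).trans fpick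
    have gt : ρ.var .t = σ.var .t := (hF'.var .t rfl).trans ft
    have gu : ρ.var .u = u := (hF'.var .u rfl).trans fu
    have gunc : ρ.var .unc = σ.var .unc := (hF'.var .unc rfl).trans func
    have gc : ρ.var .c = τ.var .c := hF'.var .c rfl
    have hcov'' : ∀ j < s, ρ.arr .cov j = if u ∈ G.cap smp D j then 1 else σ.arr .cov j := by
      intro j hj
      rw [hcov' j]
      simp [hL.mem_final, hj]
    have key := hg.step hQ hk hlt hun hcov'' (hM.resolve_left (by omega)) hle
    simp only [wp_seq, wp_store, wp_assign]
    simp [gc, hc, gt, gu, gpick, gunc]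
    refine ⟨by omega, ⟨by omega, by omega⟩, key, fun j hj => ?_, by omega, .inr ?_,
      by omega⟩
    · simp only [uncovered, Finset.mem_filter, Finset.mem_range] at hj ⊢
      refine ⟨hj.1, ?_⟩
      have := hcov'' j hj.1
      split_ifs at this <;> omega
    -- After marking, the picked set hits no uncovered sample at all.
    · have : hits (G.cap smp D) (uncovered s (ρ.arr .cov)) u = ∅ := by
        ext j
        simp only [hits, uncovered, Finset.mem_filter, Finset.mem_range, Finset.notMem_empty,
          iff_false]
        rintro ⟨⟨h1, h2⟩, h3⟩
        rw [hcov'' j h1, if_pos h3] at h2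
        omega
      rw [this]; simpa using htau0
  · simp [ft, fN] at hle
    simp [fcov, fpick, ft, func]
    have := hg.t_le
    exact ⟨hg, .inl (by omega), by omega⟩

/-- Uncovered samples only become fewer, so a set below the threshold stays below it; one scan
therefore brings all sets below `tau`. The lists have `e` nodes in total, hence the time linear in
`e + n`. -/
theorem scanCmd_spec {smp : ℕ → ℕ} {D s e Q k N tau : ℕ} {adj : ℕ → List ℕ}
    (hL : Lists G smp D s 0 e (σ.arr .nxt) (σ.arr .val) (σ.arr .head) adj)
    (hg : GreedyInv G.n s Q k N (G.cap smp D) (σ.arr .cov) (σ.arr .pick) (σ.var .t) (σ.var .unc))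
    (hQ : 0 < Q) (hk : 0 < k) (hn : σ.var .n = G.n) (hN : σ.var .N = N)
    (htau : σ.var .tau = tau) (htau0 : 0 < tau)
    (hM : σ.var .t = N ∨ ∀ u' < G.n,
      (hits (G.cap smp D) (uncovered s (σ.arr .cov)) u').card * Q ≤ tau * (Q + 1))
    (bn : 8 * G.n + 16 < W) (be : 8 * e + 16 < W) (bs : 8 * s + 16 < W) (bN : 8 * N + 16 < W) :
    wp G W scanCmd (fun τ => GreedyInv G.n s Q k N (G.cap smp D) (τ.arr .cov) (τ.arr .pick)
        (τ.var .t) (τ.var .unc) ∧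
      (τ.var .t = N ∨ ∀ u < G.n,
        (hits (G.cap smp D) (uncovered s (τ.arr .cov)) u).card < tau) ∧
      τ.tm ≤ σ.tm + 6 * e + 12 * G.n + 2) σ := by
  unfold scanCmd
  simp only [wp_seq, wp_assign]
  refine ⟨by simp; omega, wp_while (fun u τ => τ.var .u = u ∧ u ≤ G.n ∧
    GreedyInv G.n s Q k N (G.cap smp D) (τ.arr .cov) (τ.arr .pick) (τ.var .t) (τ.var .unc) ∧
    uncovered s (τ.arr .cov) ⊆ uncovered s (σ.arr .cov) ∧
    (σ.var .t = N → τ.var .t = N) ∧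
    (τ.var .t = N ∨ ∀ u' < u, (hits (G.cap smp D) (uncovered s (τ.arr .cov)) u').card < tau) ∧
    τ.tm ≤ σ.tm + 1 + ∑ u' ∈ Finset.range u, (6 * (adj u').length + 12)) G.n ?_ ?_ ?_ ?_⟩
  · simpa using hg
  · simp
  · rintro u τ ⟨h1, h2, h3, h4, h5, h6, h7⟩ hF hlt
    have fn : τ.var .n = G.n := (hF.var .n rfl).trans hn
    have fnxt : τ.arr .nxt = σ.arr .nxt := hF.arr .nxt rfl
    have fval : τ.arr .val = σ.arr .val := hF.arr .val rfl
    have fhead : τ.arr .head = σ.arr .head := hF.arr .head rfl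
    have fN : τ.var .N = N := (hF.var .N rfl).trans hN
    have ftau : τ.var .tau = tau := (hF.var .tau rfl).trans htau
    simp only [Expr.eval_var, h1, fn] at hlt
    refine ⟨hlt, ?_⟩
    rw [wp_seq]
    refine wp_mono (considerCmd_spec (σ := τ.tick) (tau := tau) (u := u) (e := e)
      (by simpa only [St.tick_arr, fnxt, fval, fhead] using hL) h3 hQ hk h1 hlt fN ftau htau0
      ?_ bn be bs bN) ?_
    · simp only [St.tick_arr, St.tick_var]
      rcases hM with hM | hM
      -- If the budget was exhausted before the scan it still is; otherwise the bound on the hits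
      -- persists as the uncovered set shrinks.
      · exact .inl (h5 hM)
      · exact .inr fun u' hu' => (Nat.mul_le_mul_right _
          (Finset.card_le_card (hits_mono _ h4 u'))).trans (hM u' hu')
    rintro ρ ⟨g1, g2, g3, g4, g5⟩ hF'
    have gu : ρ.var .u = u := (hF'.var .u rfl).trans h1
    rw [wp_assign]
    simp only [St.tick_arr, St.tick_var, St.tick_tm] at g1 g2 g3 g4 g5
    simp [gu]
    refine ⟨by omega, hlt, g1, g2.trans h4, fun h => g3 (h5 h), ?_, ?_⟩
    · rcases g4 with g4 | g4
      · exact .inl g4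
      rcases h6 with h6 | h6
      · exact .inl (g3 h6)
      refine .inr fun u' hu' => ?_
      by_cases huu : u' = u
      · subst huu; exact g4
      · exact (Finset.card_le_card (hits_mono _ g2 u')).trans_lt (h6 u' (by omega))
    · rw [Finset.sum_range_succ]; omega
  · rintro u τ ⟨h1, h2, h3, h4, h5, h6, h7⟩ hF hle
    have fn : τ.var .n = G.n := (hF.var .n rfl).trans hn
    simp only [Expr.eval_var, h1, fn] at hle
    obtain rfl : u = G.n := by omega
    rw [Finset.sum_add_distrib, ← Finset.mul_sum, hL.sum] at h7
    refine ⟨h3, h6, ?_⟩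
    simp at h7 ⊢
    omega

/-- After `i` rounds the threshold is at most `s * (Q / (Q + 1)) ^ i`, which is below 1 from round
`R` on. -/
theorem lt_of_mul_pow_le {s Q R i tau : ℕ} (hR : s * Q ^ R < (Q + 1) ^ R) (htau : 0 < tau)
    (h : tau * (Q + 1) ^ i ≤ s * Q ^ i) : i < R := by
  by_contra! hi
  obtain ⟨r, rfl⟩ := Nat.exists_eq_add_of_le hi
  have h1 : s * Q ^ (R + r) < (Q + 1) ^ (R + r) := by
    rw [pow_add, pow_add, ← mul_assoc]
    exact Nat.mul_lt_mul_of_lt_of_le hR (Nat.pow_le_pow_left (Nat.le_succ Q) r) (by positivity)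
  have h2 : (Q + 1) ^ (R + r) ≤ tau * (Q + 1) ^ (R + r) := Nat.le_mul_of_pos_left _ htau
  omega

/-- The loop keeps the maximal number of hits within a factor `(Q + 1) / Q` of the threshold,
despite the rounding down. When the threshold reaches 0, the same invariant says that no set hits
anything. -/
theorem greedyCmd_spec {pr : Params} {smp : ℕ → ℕ} {D s e k N R : ℕ} {adj : ℕ → List ℕ}
    (hL : Lists G smp D s 0 e (σ.arr .nxt) (σ.arr .val) (σ.arr .head) adj)
    (hcov : ∀ j < s, σ.arr .cov j = 0)
    (hQ : 0 < pr.Q) (hk : 0 < k) (hn : σ.var .n = G.n) (hN : σ.var .N = N) (hs : σ.var .s = s)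
    (hR : s * pr.Q ^ R < (pr.Q + 1) ^ R)
    (bn : 8 * G.n + 16 < W) (be : 8 * e + 16 < W) (bs : 8 * s + 16 < W) (bN : 8 * N + 16 < W)
    (bQ : pr.Q + 1 < W) (bt : s * pr.Q < W) :
    wp G W (greedyCmd pr) (fun τ => GreedyInv G.n s pr.Q k N (G.cap smp D) (τ.arr .cov)
        (τ.arr .pick) (τ.var .t) (τ.var .unc) ∧
      (τ.var .t = N ∨ ∀ u < G.n,
        (hits (G.cap smp D) (uncovered s (τ.arr .cov)) u).card * pr.Q ≤ 0) ∧
      τ.tm ≤ σ.tm + R * (6 * e + 12 * G.n + 4) + 4) σ := by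
  unfold greedyCmd
  simp only [wp_seq, wp_assign]
  refine ⟨by simp, by simp; omega, by simp, wp_while (fun i τ => 
    GreedyInv G.n s pr.Q k N (G.cap smp D) (τ.arr .cov) (τ.arr .pick) (τ.var .t) (τ.var .unc) ∧
    (τ.var .t = N ∨ ∀ u < G.n, (hits (G.cap smp D) (uncovered s (τ.arr .cov)) u).card * pr.Q ≤
      τ.var .tau * (pr.Q + 1)) ∧ τ.var .tau ≤ s ∧
    τ.var .tau * (pr.Q + 1) ^ i ≤ s * pr.Q ^ i ∧
    i ≤ R ∧ τ.tm ≤ σ.tm + 3 + i * (6 * e + 12 * G.n + 4)) R ?_ ?_ ?_ ?_⟩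
  · refine ⟨by simpa [hs] using GreedyInv.init hcov, .inr fun u hu => ?_, by simp [hs],
      by simp [hs], by omega, by simp⟩
    simp [hs]
    have : (hits (G.cap smp D) (uncovered s (σ.arr .cov)) u).card ≤ s := by
      refine (Finset.card_le_card ((hits_subset _ _ _).trans (Finset.filter_subset _ _))).trans ?_
      simp
    exact Nat.mul_le_mul this (by omega)
  · simp; omega
  · rintro i τ ⟨h1, h2, h3, h4, h5, h6⟩ hF hlt
    have fn : τ.var .n = G.n := (hF.var .n rfl).trans (by simpa using hn)
    have fN : τ.var .N = N := (hF.var .N rfl).trans (by simpa using hN)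
    have fnxt : τ.arr .nxt = σ.arr .nxt := hF.arr .nxt rfl
    have fval : τ.arr .val = σ.arr .val := hF.arr .val rfl
    have fhead : τ.arr .head = σ.arr .head := hF.arr .head rfl
    simp only [Expr.eval_var, Expr.eval_lit] at hlt
    have hiR := lt_of_mul_pow_le hR hlt h4
    refine ⟨hiR, ?_⟩
    rw [wp_seq]
    refine wp_mono (scanCmd_spec (σ := τ.tick) (tau := τ.var .tau) (e := e)
      (by simpa only [St.tick_arr, fnxt, fval, fhead] using hL) h1 hQ hk fn fN rfl hlt
      h2 bn be bs bN) ?_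
    rintro ρ ⟨g1, g2, g3⟩ hF'
    have ft : ρ.var .tau = τ.var .tau := hF'.var .tau rfl
    rw [wp_assign]
    simp only [St.tick_tm] at g3
    set tau := τ.var .tau
    simp [ft]
    refine ⟨⟨⟨by omega, ?_⟩, by omega⟩, g1, ?_, ?_, ?_, hiR, ?_⟩
    · exact (Nat.mul_le_mul_right _ h3).trans_lt bt
    · refine g2.imp_right fun g2 u hu => ?_
      have g2' := g2 u hu
      -- After the scan the hits are at most `tau - 1`, and `(tau - 1) * Q ≤ tau' * (Q + 1)` for the
      -- rounded new threshold `tau'`: the remainder of the division is at most `Q`.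
      have h7 := Nat.lt_div_mul_add (a := tau * pr.Q) (b := pr.Q + 1) (by omega)
      obtain ⟨tt, htt⟩ : ∃ tt, tau = tt + 1 := ⟨tau - 1, by omega⟩
      have h8 : (hits (G.cap smp D) (uncovered s (ρ.arr .cov)) u).card * pr.Q ≤ tt * pr.Q :=
        Nat.mul_le_mul_right _ (by omega)
      have h9 : tau * pr.Q = tt * pr.Q + pr.Q := by rw [htt]; ring
      omega
    · calc tau * pr.Q / (pr.Q + 1) ≤ tau * (pr.Q + 1) / (pr.Q + 1) :=
            Nat.div_le_div_right (Nat.mul_le_mul_left _ (Nat.le_succ _))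
        _ = tau := Nat.mul_div_cancel _ (by omega)
        _ ≤ s := h3
    · calc tau * pr.Q / (pr.Q + 1) * (pr.Q + 1) ^ (i + 1)
          = tau * pr.Q / (pr.Q + 1) * (pr.Q + 1) * (pr.Q + 1) ^ i := by ring
        _ ≤ tau * pr.Q * (pr.Q + 1) ^ i := Nat.mul_le_mul_right _ (Nat.div_mul_le_self _ _)
        _ = tau * (pr.Q + 1) ^ i * pr.Q := by ring
        _ ≤ s * pr.Q ^ i * pr.Q := Nat.mul_le_mul_right _ h4
        _ = s * pr.Q ^ (i + 1) := by ring
    · rw [add_mul i 1]; omega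
  · rintro i τ ⟨h1, h2, h3, h4, h5, h6⟩ hF hle
    simp only [Expr.eval_var, Expr.eval_lit, Nat.le_zero] at hle
    refine ⟨h1, by simpa [hle] using h2, ?_⟩
    have := Nat.mul_le_mul_right (6 * e + 12 * G.n + 4) h5
    simp
    omega

end greedy

/-- The number of sets to be picked for the guess `k`. -/
def Params.picks (pr : Params) (k : ℕ) : ℕ := (pr.a * k + (pr.b - 1)) / pr.b

/-- All parameters that have to be positive are positive. -/
structure Params.Pos (pr : Params) : Prop where
  b : 0 < pr.b
  Q : 0 < pr.Q
  q : 0 < pr.q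
  A : 0 < pr.A

/-- Words below `W` are large enough. -/
structure Fits (G : CoverInstance) (pr : Params) (L W : ℕ) : Prop where
  edges : 8 * (pr.A * G.n * L * (pr.Q + 1)) + 16 < W
  elems : G.m < W
  picks : 8 * ((pr.a + 1) * G.n + pr.b) + 16 < W
  test : pr.p * (pr.A * G.n * L) < W
  test' : pr.q * (pr.A * G.n * L) < W
  n_le : G.n ≤ pr.A * G.n * L
  Q_le : pr.Q ≤ pr.A * G.n * L * (pr.Q + 1)
  A_lt : pr.A < W
  p_lt : pr.p < W
  q_lt : pr.q < W

/-- The sets in the list `l` are few enough for the guess `k` and cover enough of the samples. -/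
structure GoodList (G : CoverInstance) (pr : Params) (L : ℕ) (smp : ℕ → ℕ) (k : ℕ) (l : List ℕ) :
    Prop where
  length_le : l.length ≤ pr.picks k
  lt : ∀ u ∈ l, u < G.n
  card_le : pr.q * ((Finset.range (pr.A * k * L)).filter fun j =>
    ∀ u ∈ l, u ∉ G.owners (smp j)).card ≤ pr.p * (pr.A * k * L)

theorem Params.picks_le {pr : Params} (hb : 0 < pr.b) (k : ℕ) : pr.picks k ≤ pr.a * k + 1 := by
  unfold Params.picks
  rw [Nat.div_le_iff_le_mul_add_pred hb]
  have : pr.a * k + 1 ≤ pr.b * (pr.a * k + 1) := Nat.le_mul_of_pos_left _ hb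
  omega

theorem Params.le_picks_mul {pr : Params} (hb : 0 < pr.b) (k : ℕ) :
    pr.a * k ≤ pr.picks k * pr.b := by
  have := Nat.lt_div_mul_add (a := pr.a * k + (pr.b - 1)) hb
  unfold Params.picks
  omega

/-! ### One guess, the binary search and the complete deterministic part -/

section search

variable {G : CoverInstance} {W : ℕ} {σ : St} {pr : Params}

/-- The greedy algorithm works with cut lists, a good list is judged by the full ones. This is
harmless: a mark certifies a real hit, so full lists leave no more samples uncovered. -/
theorem GreedyInv.goodList {L k D : ℕ} {smp cov pick : ℕ → ℕ} {t unc : ℕ}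
    (h : GreedyInv G.n (pr.A * k * L) pr.Q k (pr.picks k) (G.cap smp D) cov pick t unc)
    (hu : pr.q * unc ≤ pr.p * (pr.A * k * L)) :
    GoodList G pr L smp k ((List.range t).map pick) where
  length_le := by simpa using h.t_le
  lt u hu := by
    simp only [List.mem_map, List.mem_range] at hu
    obtain ⟨i, hi, rfl⟩ := hu
    exact h.pick_lt i hi
  card_le := by
    refine (Nat.mul_le_mul_left _ ?_).trans hu
    rw [h.unc_eq]
    refine Finset.card_le_card fun j hj => ?_
    simp only [uncovered, Finset.mem_filter, Finset.mem_range, List.mem_map, List.mem_range,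
      forall_exists_index, and_imp, forall_apply_eq_imp_iff₂] at hj ⊢
    refine ⟨hj.1, ?_⟩
    by_contra hc
    obtain ⟨i, hi, hi'⟩ := h.covered j hj.1 (by have := h.cov_le j hj.1; omega)
    exact hj.2 i hi (List.mem_of_mem_take hi')

/-- The guarantees split: the invariant holds for every guess, while passing the test is promised
only when some cover has at most `k` sets. The time bound is the same for all guesses. -/
theorem attemptCmd_spec {L k R : ℕ} (hp : pr.Pos) (hf : Fits G pr L W) (hk : 0 < k)
    (hkn : k ≤ G.n) (hn : σ.var .n = G.n) (hL : σ.var .L = L) (hmid : σ.var .mid = k)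
    (hsmp : ∀ j < pr.A * G.n * L, σ.arr .smp j < G.m)
    (hR : pr.A * G.n * L * pr.Q ^ R < (pr.Q + 1) ^ R)
    (hexp : Real.exp (-((pr.Q : ℝ) ^ 2 / (pr.Q + 1) ^ 2 * (pr.a / pr.b))) ≤ pr.p / pr.q) :
    wp G W (attemptCmd pr) (fun τ => τ.var .s = pr.A * k * L ∧
      (∃ D, GreedyInv G.n (pr.A * k * L) pr.Q k (pr.picks k) (G.cap (σ.arr .smp) D) (τ.arr .cov)
        (τ.arr .pick) (τ.var .t) (τ.var .unc)) ∧
      (∀ T, G.IsSetCover T → T.card ≤ k → pr.q * τ.var .unc ≤ pr.p * (pr.A * k * L)) ∧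
      τ.tm ≤ σ.tm + 40 * (R + 1) * (pr.A * G.n * L * (pr.Q + 1))) σ := by
  obtain ⟨f1, f2, f3, f4, f5, f6, f7, f8, f9, f10⟩ := hf
  set S := pr.A * G.n * L with hS
  set s := pr.A * k * L with hs
  set D := pr.Q * G.n / k + 1 with hD
  set M := S * (pr.Q + 1) with hM
  have hn0 : 0 < G.n := by omega
  have hsS : s ≤ S := by rw [hs, hS]; gcongr
  have hMS : M = S * pr.Q + S := by rw [hM]; ring
  have hL0 : 0 < L := by
    rcases Nat.eq_zero_or_pos L with rfl | h
    · rw [hS, mul_zero] at f6; omega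
    · exact h
  have hnS : pr.Q * G.n ≤ S * pr.Q := by rw [mul_comm]; exact Nat.mul_le_mul_right _ f6
  have hAk : pr.A * k ≤ s := Nat.le_mul_of_pos_right _ hL0
  -- Fewer samples go with longer lists: the factor `k` in `s` cancels the division by `k` in `D`.
  have hsD : s * D ≤ M := by
    have h1 : k * (pr.Q * G.n / k) ≤ pr.Q * G.n := Nat.mul_div_le _ _
    calc s * D = pr.A * L * (k * (pr.Q * G.n / k) + k) := by rw [hs, hD]; ring
      _ ≤ pr.A * L * (pr.Q * G.n + G.n) := by gcongr
      _ = M := by rw [hM, hS]; ring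
  have hDn : pr.Q * G.n / k ≤ pr.Q * G.n := Nat.div_le_self _ _
  have hak : pr.a * k ≤ pr.a * G.n := Nat.mul_le_mul_left _ hkn
  have hb := hp.b
  have f3' : (pr.a + 1) * G.n = pr.a * G.n + G.n := by ring
  have han : pr.a ≤ pr.a * G.n := Nat.le_mul_of_pos_right _ hn0
  have hN : pr.picks k ≤ pr.a * G.n + 1 := (Params.picks_le hp.b k).trans (by omega)
  have hDk : pr.Q * G.n ≤ D * k := by
    have := Nat.lt_div_mul_add (a := pr.Q * G.n) hk
    rw [hD, add_mul]; omega
  unfold attemptCmd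
  simp only [wp_seq, wp_assign]
  simp only [Expr.safe_add, Expr.safe_mul, Expr.safe_div, Expr.safe_lit, Expr.safe_var,
    Expr.eval_add, Expr.eval_mul, Expr.eval_lit, Expr.eval_var, Expr.eval_div, St.set_var, hmid,
    hL, hn, reduceCtorEq, if_false]
  refine ⟨⟨⟨f8, trivial, by omega⟩, trivial, by omega⟩, ⟨⟨⟨by omega, trivial, by omega⟩, trivial⟩,
    by omega, by omega⟩, ⟨⟨⟨by omega, trivial, by omega⟩, by omega, by omega⟩, by omega⟩, ?_⟩
  refine wp_mono (clearCmd_spec (by decide) ?_) ?_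
  · simp [hn]; omega
  rintro τ1 ⟨z1, t1⟩ F1
  refine wp_mono (clearCmd_spec (by decide) ?_) ?_
  · rw [F1.var .s rfl]; simp [← hs]; omega
  rintro τ2 ⟨z2, t2⟩ F2
  have e1s : τ1.var .s = s := by rw [F1.var .s rfl]; simp [hs]
  have e2s : τ2.var .s = s := by rw [F2.var .s rfl, e1s]
  have e2D : τ2.var .D = D := by rw [F2.var .D rfl, F1.var .D rfl]; simp [hD]
  have e2smp : τ2.arr .smp = σ.arr .smp := by rw [F2.arr .smp rfl, F1.arr .smp rfl]; rfl
  have e1n : (St.set (St.set (St.set σ .s s) .D D) .N (pr.picks k)).var .n = G.n := by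
    simp [hn]
  refine wp_mono (buildCmd_spec e2s e2D ?_ (by omega) (by omega) (by omega)) ?_
  · intro u hu
    rw [F2.arr .head rfl]
    exact z1 u (by simpa [hn] using hu)
  rintro τ3 ⟨⟨e, adj, he, hLs⟩, t3⟩ F3
  rw [e2smp] at hLs
  have e3s : τ3.var .s = s := by rw [F3.var .s rfl, e2s]
  have e3N : τ3.var .N = pr.picks k := by
    rw [F3.var .N rfl, F2.var .N rfl, F1.var .N rfl]; simp [Params.picks]
  have e3n : τ3.var .n = G.n := by
    rw [F3.var .n rfl, F2.var .n rfl, F1.var .n rfl]; simp [hn]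
  refine wp_mono (greedyCmd_spec (pr := pr) (R := R) hLs ?_ hp.Q hk e3n e3N e3s ?_ (by omega)
    (by omega) (by omega) (by omega) (by omega) ?_) ?_
  · intro j hj
    rw [F3.arr .cov rfl]
    exact z2 j (by rw [e1s]; exact hj)
  · exact (Nat.mul_le_mul_right _ hsS).trans_lt hR
  · have := Nat.mul_le_mul_right pr.Q hsS
    omega
  rintro τ ⟨hg, hend, t4⟩ F4
  refine ⟨by rw [F4.var .s rfl, e3s], ⟨D, hg⟩, fun T hT hTk => ?_, ?_⟩
  · exact hg.success hk hp.b hp.Q hp.q (Params.le_picks_mul hp.b k) hexp hend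
      (sparse_of_cover hT hTk hDk (Nat.succ_pos _) fun j hj => hsmp j (by omega))
  · simp only [St.set_tm, St.set_var, hn, reduceCtorEq, if_false] at t1
    rw [e1s] at t2
    have h1 : s * (7 * D + 10) = 7 * (s * D) + 10 * s := by ring
    have h2 : R * (6 * e + 12 * G.n + 4) ≤ R * (22 * M) := Nat.mul_le_mul_left _ (by omega)
    have h3 : 40 * (R + 1) * M = 40 * (R * M) + 40 * M := by ring
    have h4 : R * (22 * M) = 22 * (R * M) := by ring
    clear_value M
    omega

theorem copyCmd_spec (hb : 8 * σ.var .t + 16 < W) :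
    wp G W copyCmd (fun τ => (∀ i < σ.var .t, τ.arr .best i = σ.arr .pick i) ∧
      τ.var .bn = σ.var .t ∧ τ.tm = σ.tm + 3 * σ.var .t + 3) σ := by
  unfold copyCmd
  simp only [wp_seq, wp_assign]
  refine ⟨by simp; omega, wp_while (fun i τ => τ.var .i = i ∧ i ≤ σ.var .t ∧
    (∀ k < i, τ.arr .best k = σ.arr .pick k) ∧ τ.tm = σ.tm + 1 + 3 * i) (σ.var .t) ?_ ?_ ?_ ?_⟩
  · simp
  · simp
  · rintro i τ ⟨h1, h2, h3, h4⟩ hF hlt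
    have ft : τ.var .t = σ.var .t := hF.var .t rfl
    have fp : τ.arr .pick = σ.arr .pick := hF.arr .pick rfl
    simp only [Expr.eval_var, h1, ft] at hlt
    refine ⟨hlt, ?_⟩
    simp only [wp_seq, wp_store, wp_assign]
    simp [h1, fp, h4]
    refine ⟨by omega, by omega, hlt, fun k hk => ?_, by omega⟩
    by_cases hki : k = i
    · subst hki; simp
    · rw [Function.update_of_ne hki]; exact h3 k (by omega)
  · rintro i τ ⟨h1, h2, h3, h4⟩ hF hle
    have ft : τ.var .t = σ.var .t := hF.var .t rfl
    simp only [Expr.eval_var, h1, ft] at hle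
    obtain rfl : i = σ.var .t := by omega
    refine ⟨by simp, by simpa using h3, by simp [ft], by simp [h4]; omega⟩

theorem isSetCover_univ (G : CoverInstance) : G.IsSetCover Finset.univ := by
  unfold CoverInstance.IsSetCover
  ext v
  obtain ⟨u, hu⟩ := List.exists_mem_of_ne_nil _ (G.no_isolated v)
  simp only [Finset.mem_univ, iff_true]
  exact mem_covered.2 ⟨u, Finset.mem_univ _, mem_owners.2 ((G.mem_iff u v).2 hu)⟩

theorem IsSetCover.card_pos {T : Finset (Fin G.n)} (hT : G.IsSetCover T) (hm : 0 < G.m) :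
    0 < T.card := by
  have : (⟨0, hm⟩ : Fin G.m) ∈ G.covered T := by rw [hT]; exact Finset.mem_univ _
  obtain ⟨u, hu, -⟩ := mem_covered.1 this
  exact Finset.card_pos.2 ⟨u, hu⟩

/-- A bound on the running time of one pass of the binary search. -/
def passTime (G : CoverInstance) (pr : Params) (L R : ℕ) : ℕ :=
  (40 * (R + 1) + 3 * (pr.a + 1) + 11) * (pr.A * G.n * L * (pr.Q + 1))

/-- Success need not be monotone in the guess. A failed guess is a proof that all covers are larger,
so `lo` stays below every cover, and the result of the last success, at `hi`, is kept in `best`. At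
the end `hi = lo + 1` is a successful guess not exceeding any cover. -/
theorem searchCmd_spec {L R : ℕ} (hp : pr.Pos) (hf : Fits G pr L W) (hn0 : 0 < G.n)
    (hm0 : 0 < G.m) (hnL : G.n < 2 ^ L) (hn : σ.var .n = G.n) (hL : σ.var .L = L)
    (hlo : σ.var .lo = 0) (hhi : σ.var .hi = G.n + 1)
    (hsmp : ∀ j < pr.A * G.n * L, σ.arr .smp j < G.m)
    (hR : pr.A * G.n * L * pr.Q ^ R < (pr.Q + 1) ^ R)
    (hexp : Real.exp (-((pr.Q : ℝ) ^ 2 / (pr.Q + 1) ^ 2 * (pr.a / pr.b))) ≤ pr.p / pr.q) :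
    wp G W (searchCmd pr) (fun τ => (∃ k, 0 < k ∧ k ≤ G.n ∧
        GoodList G pr L (σ.arr .smp) k ((List.range (τ.var .bn)).map (τ.arr .best)) ∧
        ∀ T, G.IsSetCover T → k ≤ T.card) ∧
      τ.tm ≤ σ.tm + L * passTime G pr L R + 1) σ := by
  unfold searchCmd
  have f3 := hf.picks
  have f3' : (pr.a + 1) * G.n = pr.a * G.n + G.n := by ring
  have hb := hp.b
  have f1 := hf.edges
  have f6 := hf.n_le
  set S := pr.A * G.n * L with hS
  have hMS : S * (pr.Q + 1) = S * pr.Q + S := by ring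
  refine wp_while (fun i τ => τ.var .lo < τ.var .hi ∧ τ.var .hi ≤ G.n + 1 ∧
    (∀ T, G.IsSetCover T → τ.var .lo < T.card) ∧
    (τ.var .hi = G.n + 1 ∨
      GoodList G pr L (σ.arr .smp) (τ.var .hi) ((List.range (τ.var .bn)).map (τ.arr .best))) ∧
    (τ.var .hi - τ.var .lo - 1) * 2 ^ i ≤ G.n ∧ i ≤ L ∧
    τ.tm ≤ σ.tm + i * passTime G pr L R) L ?_ ?_ ?_ ?_
  · refine ⟨by omega, by omega, fun T hT => ?_, .inl hhi, by simp [hlo, hhi], by omega, by simp⟩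
    rw [hlo]; exact IsSetCover.card_pos hT hm0
  · rintro i τ ⟨h1, h2, -⟩ hF
    simp
    omega
  · rintro i τ ⟨h1, h2, h3, h4, h5, h6, h7⟩ hF hlt
    have fn : τ.var .n = G.n := (hF.var .n rfl).trans hn
    have fL : τ.var .L = L := (hF.var .L rfl).trans hL
    have fsmp : τ.arr .smp = σ.arr .smp := hF.arr .smp rfl
    simp only [Expr.eval_var, Expr.eval_add, Expr.eval_lit] at hlt
    -- The guard leaves an integer strictly between `lo` and `hi`, so `2 ^ i ≤ n < 2 ^ L`.
    have hiL : i < L := by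
      have h8 : 2 ^ i ≤ (τ.var .hi - τ.var .lo - 1) * 2 ^ i :=
        Nat.le_mul_of_pos_left _ (by omega)
      exact (Nat.pow_lt_pow_iff_right (by norm_num)).1 ((h8.trans h5).trans_lt hnL)
    refine ⟨hiL, ?_⟩
    simp only [wp_seq, wp_assign]
    refine ⟨by simp; omega, ?_⟩
    simp only [Expr.eval_var, Expr.eval_add, Expr.eval_lit, Expr.eval_div, St.tick_var]
    set k := (τ.var .lo + τ.var .hi) / 2 with hk
    have hlk : τ.var .lo < k := by omega
    have hkh : k < τ.var .hi := by omega
    refine wp_mono (attemptCmd_spec (R := R) hp hf (k := k) (by omega) (by omega) (by simpa using fn)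
      (by simpa using fL) (by simp) ?_ hR hexp) ?_
    · simpa [fsmp] using hsmp
    rintro ρ ⟨gs, ⟨D, hg⟩, gT, gt⟩ hF'
    have glo : ρ.var .lo = τ.var .lo := hF'.var .lo rfl
    have ghi : ρ.var .hi = τ.var .hi := hF'.var .hi rfl
    have gmid : ρ.var .mid = k := (hF'.var .mid rfl).trans (by simp)
    have gbest : ρ.arr .best = τ.arr .best := hF'.arr .best rfl
    have gbn : ρ.var .bn = τ.var .bn := hF'.var .bn rfl
    simp only [St.set_tm, St.tick_tm, ← hS] at gt
    simp only [St.set_arr, St.tick_arr, fsmp] at hg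
    have hsS : pr.A * k * L ≤ S := by
      rw [hS]
      exact Nat.mul_le_mul_right _ (Nat.mul_le_mul_left _ (by omega))
    have hunc : ρ.var .unc ≤ S := by
      rw [hg.unc_eq]
      exact (Finset.card_le_card (Finset.filter_subset _ _)).trans (by simpa using hsS)
    have hbp := (Nat.mul_le_mul_left pr.p hsS).trans_lt hf.test
    have hbq := (Nat.mul_le_mul_left pr.q hunc).trans_lt hf.test'
    have hpass : passTime G pr L R = 40 * (R + 1) * (S * (pr.Q + 1)) +
        3 * ((pr.a + 1) * (S * (pr.Q + 1))) + 11 * (S * (pr.Q + 1)) := by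
      unfold passTime; ring
    have hnM : (pr.a + 1) * G.n ≤ (pr.a + 1) * (S * (pr.Q + 1)) :=
      Nat.mul_le_mul_left _ (by omega)
    have hti : (i + 1) * passTime G pr L R = i * passTime G pr L R + passTime G pr L R := by ring
    have hpow : ∀ d, d ≤ (τ.var .hi - τ.var .lo - 1) / 2 → d * 2 ^ (i + 1) ≤ G.n := by
      intro d hd
      calc d * 2 ^ (i + 1) = d * 2 * 2 ^ i := by ring
        _ ≤ (τ.var .hi - τ.var .lo - 1) * 2 ^ i := Nat.mul_le_mul_right _ (by omega)
        _ ≤ G.n := h5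
    have hNk := Params.picks_le hp.b k
    have hak : pr.a * k ≤ pr.a * G.n := Nat.mul_le_mul_left _ (by omega)
    have htN := hg.t_le
    rw [wp_ite]
    simp only [Expr.safe_mul, Expr.safe_lit, Expr.safe_var, Expr.eval_mul, Expr.eval_lit,
      Expr.eval_var, gs]
    refine ⟨⟨⟨hf.p_lt, trivial, hbp⟩, hf.q_lt, trivial, hbq⟩, fun hlt' => ?_, fun hle' => ?_⟩
    · simp [wp_assign, gmid, ghi, gbn, gbest]
      refine ⟨hkh, h2, fun T hT => ?_, h4, ?_, hiL, by omega⟩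
      -- A cover by at most `k` sets would have made the attempt pass the test.
      · by_contra! hc
        exact absurd (gT T hT hc) (by omega)
      · rw [Nat.sub_sub] at hpow
        exact hpow _ (by omega)
    · rw [wp_seq, wp_assign]
      refine ⟨trivial, wp_mono (copyCmd_spec ?_) ?_⟩
      · simp; omega
      rintro ρ' ⟨c1, c2, c3⟩ hF''
      have klo : ρ'.var .lo = τ.var .lo := (hF''.var .lo rfl).trans (by simpa using glo)
      have khi : ρ'.var .hi = k := (hF''.var .hi rfl).trans (by simpa using gmid)
      simp only [St.set_var, St.set_arr, St.tick_arr, St.tick_var, St.set_tm, St.tick_tm,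
        reduceCtorEq, if_false] at c1 c2 c3
      refine ⟨by omega, by omega, by rwa [klo], .inr ?_, ?_, hiL, by omega⟩
      · rw [khi, c2, List.map_congr_left (g := ρ.arr .pick) fun i hi =>
          c1 i (List.mem_range.1 hi)]
        exact hg.goodList hle'
      · rw [khi, klo]
        exact hpow _ (by omega)
  · rintro i τ ⟨h1, h2, h3, h4, h5, h6, h7⟩ hF hle
    simp only [Expr.eval_var, Expr.eval_add, Expr.eval_lit] at hle
    -- The family of all `n` sets is a cover, so `lo < n`; hence `hi` is not the initial `n + 1` and
    -- some attempt has succeeded.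
    have hu : τ.var .hi ≤ G.n := by
      have := h3 _ (isSetCover_univ G)
      simp at this
      omega
    refine ⟨⟨τ.var .hi, by omega, hu, ?_, fun T hT => ?_⟩, ?_⟩
    · simpa using h4.resolve_left (by omega)
    · have := h3 T hT; omega
    · have := Nat.mul_le_mul_right (passTime G pr L R) h6
      simp; omega

theorem reportCmd_spec (hb : 8 * σ.var .bn + 16 < W) :
    wp G W reportCmd (fun τ => τ.out = σ.out ++ (List.range (σ.var .bn)).map (σ.arr .best) ∧
      τ.tm = σ.tm + 3 * σ.var .bn + 2) σ := by
  unfold reportCmd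
  simp only [wp_seq, wp_assign]
  refine ⟨by simp; omega, wp_while (fun i τ => τ.var .i = i ∧ i ≤ σ.var .bn ∧
    τ.out = σ.out ++ (List.range i).map (σ.arr .best) ∧ τ.tm = σ.tm + 1 + 3 * i)
    (σ.var .bn) ?_ ?_ ?_ ?_⟩
  · simp
  · simp
  · rintro i τ ⟨h1, h2, h3, h4⟩ hF hlt
    have ft : τ.var .bn = σ.var .bn := hF.var .bn rfl
    have fp : τ.arr .best = σ.arr .best := hF.arr .best rfl
    simp only [Expr.eval_var, h1, ft] at hlt
    refine ⟨hlt, ?_⟩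
    simp only [wp_seq, wp_emit, wp_assign]
    simp [h1, fp, h4, h3, List.range_succ]
    omega
  · rintro i τ ⟨h1, h2, h3, h4⟩ hF hle
    have ft : τ.var .bn = σ.var .bn := hF.var .bn rfl
    simp only [Expr.eval_var, h1, ft] at hle
    obtain rfl : i = σ.var .bn := by omega
    exact ⟨by simpa using h3, by simp [h4]; omega⟩

/-- What is guaranteed for the output, given the samples. -/
def GoodOutput (G : CoverInstance) (pr : Params) (L : ℕ) (smp : ℕ → ℕ) (out : List ℕ) : Prop :=
  (G.m = 0 → out = []) ∧ (0 < G.m → ∃ k, 0 < k ∧ k ≤ G.n ∧ GoodList G pr L smp k out ∧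
    ∀ T, G.IsSetCover T → k ≤ T.card)

/-- Without elements the samples are meaningless; the search is skipped and the empty family is
output. -/
theorem solveCmd_spec {L R : ℕ} (hp : pr.Pos) (hf : Fits G pr L W) (hn0 : 0 < G.n)
    (hnL : G.n < 2 ^ L) (hn : σ.var .n = G.n) (hm : σ.var .m = G.m) (hL : σ.var .L = L)
    (hout : σ.out = [])
    (hsmp : 0 < G.m → ∀ j < pr.A * G.n * L, σ.arr .smp j < G.m)
    (hR : pr.A * G.n * L * pr.Q ^ R < (pr.Q + 1) ^ R)
    (hexp : Real.exp (-((pr.Q : ℝ) ^ 2 / (pr.Q + 1) ^ 2 * (pr.a / pr.b))) ≤ pr.p / pr.q) :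
    wp G W (solveCmd pr) (fun τ => GoodOutput G pr L (σ.arr .smp) τ.out ∧
      τ.tm ≤ σ.tm + (L + 1) * passTime G pr L R) σ := by
  have f1 := hf.edges
  have f3 := hf.picks
  have f3' : (pr.a + 1) * G.n = pr.a * G.n + G.n := by ring
  have hb := hp.b
  have f6 := hf.n_le
  have hMS : pr.A * G.n * L * (pr.Q + 1) = pr.A * G.n * L * pr.Q + pr.A * G.n * L := by ring
  have hpass : passTime G pr L R = 40 * (R * (pr.A * G.n * L * (pr.Q + 1))) +
      3 * ((pr.a + 1) * (pr.A * G.n * L * (pr.Q + 1))) + 51 * (pr.A * G.n * L * (pr.Q + 1)) := by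
    unfold passTime; ring
  have hnM : (pr.a + 1) * G.n ≤ (pr.a + 1) * (pr.A * G.n * L * (pr.Q + 1)) :=
    Nat.mul_le_mul_left _ (by omega)
  have hL1 : (L + 1) * passTime G pr L R = L * passTime G pr L R + passTime G pr L R := by ring
  unfold solveCmd
  simp only [wp_seq, wp_assign]
  refine ⟨by simp; omega, by simp; omega, by simp [hn]; omega, ?_⟩
  rw [wp_ite]
  simp only [Expr.eval_lit, Expr.eval_var, Expr.eval_add, St.set_var, reduceCtorEq, if_false, hm]
  refine ⟨⟨by simp; omega, by simp⟩, fun hm0 => ?_, fun hm0 => ?_⟩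
  · refine wp_mono (searchCmd_spec (R := R) hp hf hn0 hm0 hnL ?_ ?_ ?_ ?_ ?_ hR hexp) ?_
    · simpa using hn
    · simpa using hL
    · simp
    · simpa using hn
    · simpa using hsmp hm0
    rintro τ ⟨⟨k, hk0, hkn, hg, hT⟩, ht⟩ hF
    have fout : τ.out = [] := (hF.out rfl).trans (by simpa using hout)
    have hlen := hg.length_le
    have hNk := Params.picks_le hp.b k
    have hak : pr.a * k ≤ pr.a * G.n := Nat.mul_le_mul_left _ (by omega)
    simp at hlen
    refine wp_mono (reportCmd_spec (by omega)) ?_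
    rintro ρ ⟨h1, h2⟩ -
    rw [fout, List.nil_append] at h1
    refine ⟨⟨fun h => by omega, fun _ => ⟨k, hk0, hkn, by rw [h1]; simpa using hg, hT⟩⟩, ?_⟩
    simp at ht
    omega
  · rw [wp_skip]
    refine wp_mono (reportCmd_spec (by simp; omega)) ?_
    rintro ρ ⟨h1, h2⟩ -
    refine ⟨⟨fun h => by simpa [hout] using h1, fun h => by omega⟩, ?_⟩
    simp at h2
    omega

theorem setupCmd_spec (hf : Fits G pr (Nat.size G.n) W) (hn0 : 0 < G.n) :
    wp G W (setupCmd pr) (fun τ => τ.var .n = G.n ∧ τ.var .m = G.m ∧ τ.var .L = Nat.size G.n ∧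
      τ.var .ad = 0 ∧ τ.var .en = 8 * (pr.A * G.n * Nat.size G.n) ∧ τ.var .eight = 8 ∧
      τ.tm ≤ σ.tm + 3 * Nat.size G.n + 9) σ := by
  have f1 := hf.edges
  have f6 := hf.n_le
  have f8 := hf.A_lt
  set L := Nat.size G.n
  have hMS : pr.A * G.n * L * (pr.Q + 1) = pr.A * G.n * L * pr.Q + pr.A * G.n * L := by ring
  have hL0 : 0 < L := Nat.size_pos.2 hn0
  have hAn : pr.A * G.n ≤ pr.A * G.n * L := Nat.le_mul_of_pos_right _ hL0
  have hL : L ≤ G.n := Nat.size_le.2 (Nat.lt_two_pow_self)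
  unfold setupCmd
  simp only [wp_seq, wp_assign]
  refine ⟨by simp, by simp, by simp; omega, by simp; omega, wp_while (fun i τ => τ.var .x = 2 ^ i ∧
    τ.var .L = i ∧ i ≤ L ∧ τ.tm = σ.tm + 4 + 3 * i) L ?_ ?_ ?_ ?_⟩
  · simp
  · rintro i τ ⟨h1, h2, h3, h4⟩ hF
    have fn : τ.var .n = G.n := (hF.var .n rfl).trans (by simp)
    simp [fn]; omega
  · rintro i τ ⟨h1, h2, h3, h4⟩ hF hlt
    have fn : τ.var .n = G.n := (hF.var .n rfl).trans (by simp)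
    simp only [Expr.eval_var, Expr.eval_add, Expr.eval_lit, h1, fn] at hlt
    have hiL : i < L := Nat.lt_size.2 (by omega)
    refine ⟨hiL, ?_⟩
    simp only [wp_seq, wp_assign]
    simp [h1, h2, h4]
    refine ⟨by omega, by omega, by ring, hiL, by omega⟩
  · rintro i τ ⟨h1, h2, h3, h4⟩ hF hle
    have fn : τ.var .n = G.n := (hF.var .n rfl).trans (by simp)
    have fm : τ.var .m = G.m := (hF.var .m rfl).trans (by simp)
    simp only [Expr.eval_var, Expr.eval_add, Expr.eval_lit, h1, fn] at hle
    have hiL : i = L := by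
      refine le_antisymm h3 (Nat.size_le.2 (by omega))
    subst hiL
    simp [fn, fm, h2, h4]
    refine ⟨by omega, by omega, by omega, by omega, by omega⟩

end search

/-! ### Random samples -/

/-- The expected value of a nonnegative function. -/
noncomputable def expect {α : Type*} (p : PMF α) (f : α → ℝ≥0∞) : ℝ≥0∞ := ∑' a, p a * f a

theorem expect_pure {α : Type*} (a : α) (f : α → ℝ≥0∞) : expect (PMF.pure a) f = f a := by
  unfold expect
  rw [tsum_eq_single a]
  · simp
  · intro b hb; simp [hb]

theorem expect_bind {α β : Type*} (p : PMF α) (g : α → PMF β) (f : β → ℝ≥0∞) :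
    expect (p.bind g) f = expect p fun a => expect (g a) f := by
  unfold expect
  simp only [PMF.bind_apply, ← ENNReal.tsum_mul_right, ← ENNReal.tsum_mul_left, mul_assoc]
  exact ENNReal.tsum_comm

theorem expect_map {α β : Type*} (p : PMF α) (g : α → β) (f : β → ℝ≥0∞) :
    expect (p.map g) f = expect p (f ∘ g) := by
  rw [← PMF.bind_pure_comp, expect_bind]
  simp only [Function.comp_apply, expect_pure]
  rfl

theorem expect_mul_const {α : Type*} (p : PMF α) (f : α → ℝ≥0∞) (c : ℝ≥0∞) :
    expect p (fun a => f a * c) = expect p f * c := by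
  unfold expect
  simp only [← ENNReal.tsum_mul_right, mul_assoc]

theorem toOuterMeasure_le_expect {α : Type*} (p : PMF α) {f : α → ℝ≥0∞} {s : Set α}
    (h : ∀ a ∈ s, 1 ≤ f a) : p.toOuterMeasure s ≤ expect p f := by
  rw [PMF.toOuterMeasure_apply]
  refine ENNReal.tsum_le_tsum fun a => ?_
  by_cases ha : a ∈ s
  · rw [Set.indicator_of_mem ha]
    exact le_mul_of_one_le_right zero_le (h a ha)
  · simp [ha]

theorem expect_uniformBelow {m : ℕ} (hm : 0 < m) (f : ℕ → ℝ≥0∞) :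
    expect (uniformBelow m) f = (m : ℝ≥0∞)⁻¹ * ∑ x ∈ Finset.range m, f x := by
  obtain ⟨m, rfl⟩ : ∃ m', m = m' + 1 := ⟨m - 1, by omega⟩
  rw [uniformBelow, expect_map, expect, tsum_fintype, ← Fin.sum_univ_eq_sum_range, Finset.mul_sum]
  simp

/-- The distribution of the memory after `j` random numbers below `m` have been stored. -/
noncomputable def sampleMem (m W : ℕ) (mem : ℕ → ℕ) : ℕ → PMF (ℕ → ℕ)
  | 0 => PMF.pure mem
  | j + 1 => (sampleMem m W mem j).bind fun f =>
      (uniformBelow m).map fun x => Function.update f (8 * j) (x % W)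

/-- Independence of the samples: each one goes to a fresh cell, so the expected product is the
product of the averages. -/
theorem expect_sampleMem {m W : ℕ} (hm : 0 < m) (hW : m ≤ W) (mem : ℕ → ℕ)
    (h : ℕ → ℕ → ℝ≥0∞) (S : ℕ) :
    expect (sampleMem m W mem S) (fun f => ∏ j ∈ Finset.range S, h j (f (8 * j))) =
      ∏ j ∈ Finset.range S, ((m : ℝ≥0∞)⁻¹ * ∑ x ∈ Finset.range m, h j x) := by
  induction S with
  | zero => simp [sampleMem, expect_pure]
  | succ S ih =>
    rw [sampleMem, expect_bind, Finset.prod_range_succ, ← ih, ← expect_mul_const]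
    congr 1
    funext f
    rw [expect_map, expect_uniformBelow hm]
    have : ∀ x ∈ Finset.range m, ((fun f : ℕ → ℕ => ∏ j ∈ Finset.range (S + 1), h j (f (8 * j))) ∘
        fun x => Function.update f (8 * S) (x % W)) x =
        (∏ j ∈ Finset.range S, h j (f (8 * j))) * h S x := by
      intro x hx
      rw [Finset.mem_range] at hx
      simp only [Function.comp_apply, Finset.prod_range_succ, Function.update_self,
        Nat.mod_eq_of_lt (hx.trans_le hW)]
      congr 1
      refine Finset.prod_congr rfl fun j hj => ?_
      rw [Finset.mem_range] at hj
      rw [Function.update_of_ne (by omega)]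
    rw [Finset.sum_congr rfl this, ← Finset.mul_sum]
    ring

theorem lt_of_mem_support_uniformBelow {m x : ℕ} (hm : 0 < m)
    (h : x ∈ (uniformBelow m).support) : x < m := by
  obtain ⟨m, rfl⟩ : ∃ m', m = m' + 1 := ⟨m - 1, by omega⟩
  rw [uniformBelow, PMF.mem_support_map_iff] at h
  obtain ⟨y, -, rfl⟩ := h
  exact y.2

theorem sampleMem_support {m W : ℕ} (hW : 0 < W) {mem : ℕ → ℕ} (hmem : ∀ r, mem r < W) {S : ℕ}
    {f : ℕ → ℕ} (hf : f ∈ (sampleMem m W mem S).support) :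
    (∀ r, f r < W) ∧ (0 < m → ∀ j < S, f (8 * j) < m) := by
  induction S generalizing f with
  | zero =>
    rw [sampleMem, PMF.support_pure, Set.mem_singleton_iff] at hf
    subst hf
    exact ⟨hmem, by simp⟩
  | succ S ih =>
    rw [sampleMem, PMF.mem_support_bind_iff] at hf
    obtain ⟨g, hg, hf⟩ := hf
    rw [PMF.mem_support_map_iff] at hf
    obtain ⟨x, hx, rfl⟩ := hf
    obtain ⟨h1, h2⟩ := ih hg
    refine ⟨fun r => ?_, fun hm j hj => ?_⟩
    · by_cases hr : r = 8 * S
      · subst hr; simpa using Nat.mod_lt _ hW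
      · rw [Function.update_of_ne hr]; exact h1 r
    · by_cases hr : j = S
      · subst hr
        simpa using (Nat.mod_le _ _).trans_lt (lt_of_mem_support_uniformBelow hm hx)
      · rw [Function.update_of_ne (by omega)]; exact h2 hm j (by omega)

/-- A set of more than `lam * m` elements is unlikely to be hit by a fraction of at most `p / q` of
the samples. -/
theorem sampleMem_tail {m W S s p q : ℕ} {lam y : ℝ} (hm : 0 < m) (hW : m ≤ W) (hs : s ≤ S)
    (mem : ℕ → ℕ) (B : ℕ → Prop) [DecidablePred B] (hy : 0 < y) (hy1 : y < 1)
    (hlam : lam * m ≤ ((Finset.range m).filter B).card) :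
    (sampleMem m W mem S).toOuterMeasure
      {f | q * ((Finset.range s).filter fun j => B (f (8 * j))).card ≤ p * s} ≤
      ENNReal.ofReal (((1 - lam * (1 - y ^ q)) / y ^ p) ^ s) := by
  have hz : y ^ q ≤ 1 := pow_le_one₀ hy.le hy1.le
  -- The Chernoff weights: each of the first `s` samples contributes `y ^ q / y ^ p` if it lies in
  -- `B` and `1 / y ^ p` otherwise; the others contribute 1.
  set g : ℕ → ℕ → ℝ := fun j x => if j < s then (if B x then y ^ q else 1) / y ^ p else 1 with hg
  have hg0 : ∀ j x, 0 ≤ g j x := by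
    intro j x
    simp only [hg]
    split_ifs <;> positivity
  have hprod : ∀ f : ℕ → ℕ, ∏ j ∈ Finset.range S, g j (f (8 * j)) =
      ∏ j ∈ Finset.range s, ((if B (f (8 * j)) then y ^ q else 1) / y ^ p) := by
    intro f
    rw [← Finset.prod_range_mul_prod_Ico _ hs]
    rw [Finset.prod_eq_one (s := Finset.Ico s S) (fun j hj => by
      simp only [hg]; rw [if_neg (by simpa using (Finset.mem_Ico.1 hj).1)]), mul_one]
    exact Finset.prod_congr rfl fun j hj => by
      simp only [hg]; rw [if_pos (Finset.mem_range.1 hj)]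
  refine (toOuterMeasure_le_expect _ (f := fun f => ∏ j ∈ Finset.range S,
    ENNReal.ofReal (g j (f (8 * j)))) fun f hf => ?_).trans ?_
  -- On the event the product of the weights is at least 1, as `y < 1` and the exponent `q * count`
  -- is at most `p * s`. Markov's inequality then applies.
  · rw [← ENNReal.ofReal_prod_of_nonneg fun j _ => hg0 _ _, ENNReal.one_le_ofReal, hprod,
      Finset.prod_div_distrib, Finset.prod_ite]
    simp only [Finset.prod_const, one_pow, mul_one, Finset.card_range]
    rw [one_le_div (by positivity), ← pow_mul, ← pow_mul]
    exact pow_le_pow_of_le_one hy.le hy1.le hf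
  · rw [expect_sampleMem hm hW mem (fun j x => ENNReal.ofReal (g j x))]
    have hterm : ∀ j, (m : ℝ≥0∞)⁻¹ * ∑ x ∈ Finset.range m, ENNReal.ofReal (g j x) =
        ENNReal.ofReal ((m : ℝ)⁻¹ * ∑ x ∈ Finset.range m, g j x) := by
      intro j
      rw [ENNReal.ofReal_mul (by positivity), ENNReal.ofReal_inv_of_pos (by exact_mod_cast hm),
        ENNReal.ofReal_natCast, ENNReal.ofReal_sum_of_nonneg fun x _ => hg0 j x]
    have hm' : (0 : ℝ) < m := by exact_mod_cast hm
    have hterm0 : ∀ j, 0 ≤ (m : ℝ)⁻¹ * ∑ x ∈ Finset.range m, g j x := fun j =>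
      mul_nonneg (by positivity) (Finset.sum_nonneg fun x _ => hg0 j x)
    simp only [hterm]
    rw [← ENNReal.ofReal_prod_of_nonneg fun j _ => hterm0 j]
    refine ENNReal.ofReal_le_ofReal ?_
    rw [← Finset.prod_range_mul_prod_Ico _ hs]
    rw [Finset.prod_eq_one (s := Finset.Ico s S) (fun j hj => by
      simp only [hg]
      simp [not_lt.2 (Finset.mem_Ico.1 hj).1, hm'.ne']), mul_one]
    refine (Finset.prod_le_prod (g := fun _ => (1 - lam * (1 - y ^ q)) / y ^ p)
      (fun j _ => hterm0 j) fun j hj => ?_).trans ?_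
    · simp only [hg, if_pos (Finset.mem_range.1 hj)]
      rw [← Finset.sum_div, Finset.sum_ite, ← mul_div_assoc]
      refine div_le_div_of_nonneg_right ?_ (by positivity)
      simp only [Finset.sum_const, nsmul_eq_mul, mul_one]
      have hc : (((Finset.range m).filter fun x => ¬ B x).card : ℝ) =
          m - ((Finset.range m).filter B).card := by
        have := Finset.card_filter_add_card_filter_not (s := Finset.range m) B
        rw [Finset.card_range] at this
        have : ((((Finset.range m).filter B).card + ((Finset.range m).filter fun x => ¬ B x).card :
          ℕ) : ℝ) = m := by rw [this]
        push_cast at this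
        linarith
      rw [hc, inv_mul_le_iff₀ hm']
      nlinarith
    · rw [Finset.prod_const, Finset.card_range]

/-- Some short list of sets misses more than a fraction `lam` of the elements but few samples. -/
def BadSample (G : CoverInstance) (pr : Params) (L : ℕ) (lam : ℝ) (f : ℕ → ℕ) : Prop :=
  ∃ k l, 0 < k ∧ k ≤ G.n ∧ GoodList G pr L (fun j => f (8 * j)) k l ∧
    lam * G.m ≤ (((Finset.range G.m).filter fun x => ∀ u ∈ l, u ∉ G.owners x).card : ℝ)

/-- Union bound over all guesses and all lists of the allowed length. The rate `A` is chosen so that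
the tail bound, with exponent proportional to `k * L`, beats the number of lists. -/
theorem badSample_le {G : CoverInstance} {pr : Params} {L W : ℕ} {lam y : ℝ} (hp : pr.Pos)
    (hn : 0 < G.n) (hm : 0 < G.m) (hW : G.m ≤ W) (hnL : G.n < 2 ^ L) (mem : ℕ → ℕ)
    (hlam : 0 < lam) (hlam1 : lam < 1) (hy : 0 < y) (hy1 : y < 1)
    (hA : ((1 - lam * (1 - y ^ pr.q)) / y ^ pr.p) ^ pr.A ≤ (1 / 2) ^ (pr.a + 3)) :
    (sampleMem G.m W mem (pr.A * G.n * L)).toOuterMeasure {f | BadSample G pr L lam f} ≤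
      (G.n : ℝ≥0∞)⁻¹ := by
  classical
  set ρ := (1 - lam * (1 - y ^ pr.q)) / y ^ pr.p with hρ
  have hρ0 : 0 ≤ ρ := by
    have : 0 < y ^ pr.q := by positivity
    refine div_nonneg ?_ (by positivity)
    nlinarith
  -- Lists are padded to the exact length `picks k` with the dummy index `n`, which owns no element,
  -- so there are `(n + 1) ^ picks k` tuples to consider. Tuples that cover enough elements give an
  -- empty event.
  set E : (k : ℕ) → (Fin (pr.picks k) → Fin (G.n + 1)) → Set (ℕ → ℕ) := fun k t =>
    {f | if lam * G.m ≤ ((Finset.range G.m).filter fun x => ∀ i, (t i : ℕ) ∉ G.owners x).card then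
      pr.q * ((Finset.range (pr.A * k * L)).filter fun j =>
        ∀ i, (t i : ℕ) ∉ G.owners (f (8 * j))).card ≤ pr.p * (pr.A * k * L) else False} with hE
  have hE' : ∀ k ∈ Finset.Icc 1 G.n, ∀ t,
      (sampleMem G.m W mem (pr.A * G.n * L)).toOuterMeasure (E k t) ≤
        ENNReal.ofReal (ρ ^ (pr.A * k * L)) := by
    intro k hk t
    by_cases h : lam * G.m ≤ ((Finset.range G.m).filter fun x => ∀ i, (t i : ℕ) ∉ G.owners x).card
    · simp only [hE, if_pos h]
      refine sampleMem_tail hm hW ?_ mem (fun x => ∀ i, (t i : ℕ) ∉ G.owners x) hy hy1 h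
      have := (Finset.mem_Icc.1 hk).2
      gcongr
    · simp only [hE, if_neg h]
      simp
  have hsub : {f | BadSample G pr L lam f} ⊆ ⋃ k ∈ Finset.Icc 1 G.n, ⋃ t ∈ Finset.univ, E k t := by
    rintro f ⟨k, l, hk, hkn, hg, hl⟩
    simp only [Set.mem_iUnion]
    have hlt : ∀ i : Fin (pr.picks k), l.getD i G.n < G.n + 1 := by
      intro i
      rw [List.getD_eq_getElem?_getD]
      rcases h : l[(i : ℕ)]? with _ | u
      · simp
      · simpa using (hg.lt u (List.mem_of_getElem? h)).le
    have hiff : ∀ x, (∀ i : Fin (pr.picks k), l.getD i G.n ∉ G.owners x) ↔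
        ∀ u ∈ l, u ∉ G.owners x := by
      intro x
      constructor
      · intro h u hu
        obtain ⟨i, hi, rfl⟩ := List.mem_iff_getElem.1 hu
        have := h ⟨i, hi.trans_le hg.length_le⟩
        simpa [hi] using this
      · intro h i
        rw [List.getD_eq_getElem?_getD]
        rcases hi : l[(i : ℕ)]? with _ | u
        · exact fun h => (lt_irrefl _ (lt_of_mem_owners h))
        · exact h u (List.mem_of_getElem? hi)
    refine ⟨k, Finset.mem_Icc.2 ⟨hk, hkn⟩, fun i => ⟨l.getD i G.n, hlt i⟩, Finset.mem_univ _, ?_⟩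
    simp only [hE, hiff, if_pos hl]
    exact hg.card_le
  refine (MeasureTheory.measure_mono hsub).trans
    ((MeasureTheory.measure_biUnion_finset_le _ _).trans ?_)
  -- There are at most `2 ^ (L * (a * k + 1))` tuples, each of probability at most `2 ^ (-(a + 3) *
  -- k * L)`; as `k ≥ 1`, the product is at most `2 ^ (-2 * L)`.
  have hterm : ∀ k ∈ Finset.Icc 1 G.n, (sampleMem G.m W mem (pr.A * G.n * L)).toOuterMeasure
      (⋃ t ∈ Finset.univ, E k t) ≤ ENNReal.ofReal ((1 / 2) ^ (2 * L)) := by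
    intro k hk
    refine (MeasureTheory.measure_biUnion_finset_le _ _).trans
      ((Finset.sum_le_sum fun t _ => hE' k hk t).trans ?_)
    rw [Finset.sum_const, Finset.card_univ, Fintype.card_fun, Fintype.card_fin, Fintype.card_fin,
      ← ENNReal.ofReal_nsmul]
    refine ENNReal.ofReal_le_ofReal ?_
    rw [nsmul_eq_mul]
    have hk1 := (Finset.mem_Icc.1 hk).1
    have h1 : (((G.n + 1) ^ pr.picks k : ℕ) : ℝ) ≤ 2 ^ (L * (pr.a * k + 1)) := by
      have : (G.n + 1) ^ pr.picks k ≤ 2 ^ (L * (pr.a * k + 1)) := by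
        rw [pow_mul]
        exact (Nat.pow_le_pow_left hnL _).trans
          (Nat.pow_le_pow_right (by positivity) (Params.picks_le hp.b k))
      exact_mod_cast this
    have h2 : ρ ^ (pr.A * k * L) ≤ (1 / 2) ^ ((pr.a + 3) * (k * L)) := by
      rw [mul_assoc, pow_mul, pow_mul ((1 : ℝ) / 2)]
      exact pow_le_pow_left₀ (by positivity) hA _
    calc (((G.n + 1) ^ pr.picks k : ℕ) : ℝ) * ρ ^ (pr.A * k * L)
        ≤ 2 ^ (L * (pr.a * k + 1)) * (1 / 2) ^ ((pr.a + 3) * (k * L)) := by gcongr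
      _ ≤ 2 ^ (L * (pr.a * k + 1)) * (1 / 2) ^ (L * (pr.a * k + 1) + 2 * L) := by
        gcongr ?_ * ?_
        refine pow_le_pow_of_le_one (by norm_num) (by norm_num) ?_
        have : L ≤ L * k := Nat.le_mul_of_pos_right _ hk1
        calc L * (pr.a * k + 1) + 2 * L = pr.a * (k * L) + 3 * L := by ring
          _ ≤ pr.a * (k * L) + 3 * (L * k) := by omega
          _ = (pr.a + 3) * (k * L) := by ring
      _ = (1 / 2) ^ (2 * L) := by
        rw [pow_add, ← mul_assoc, ← mul_pow]; norm_num
  -- Summing over the `n` guesses gives `n * 2 ^ (-2 * L) ≤ 1 / n`, because `n ≤ 2 ^ L`.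
  refine (Finset.sum_le_sum hterm).trans ?_
  rw [Finset.sum_const, Nat.card_Icc, ← ENNReal.ofReal_nsmul, Nat.add_sub_cancel, nsmul_eq_mul]
  have hn' : (0 : ℝ) < G.n := by exact_mod_cast hn
  rw [← ENNReal.ofReal_natCast, ← ENNReal.ofReal_inv_of_pos hn']
  refine ENNReal.ofReal_le_ofReal ?_
  have h2 : (G.n : ℝ) ≤ 2 ^ L := by exact_mod_cast hnL.le
  have h3 : (G.n : ℝ) * G.n ≤ 2 ^ (2 * L) := by
    rw [two_mul, pow_add]; gcongr
  rw [one_div, inv_pow, ← div_eq_mul_inv, div_le_iff₀ (by positivity), inv_mul_eq_div,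
    le_div_iff₀ hn']
  exact h3

/-! ### Choice of the parameters -/

/-- At `y = 1` both sides are 1, with derivatives `lam * q` and `p`. Since `p < lam * q`, the strict
inequality holds slightly to the left of 1. -/
theorem exists_pow_base {p q : ℕ} {lam : ℝ} (hq : 0 < q) (hlam1 : lam < 1)
    (h : (p : ℝ) < lam * q) :
    ∃ y : ℝ, 0 < y ∧ y < 1 ∧ 1 - lam * (1 - y ^ q) < y ^ p := by
  have hq' : (0 : ℝ) < q := by exact_mod_cast hq
  have hp' : (0 : ℝ) ≤ p := Nat.cast_nonneg p
  -- An explicit distance from 1, small enough for `p * (1 + q * x) < lam * q`.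
  set x : ℝ := (lam * q - p) / (q * (p + 1)) with hx
  have hx0 : 0 < x := div_pos (by linarith) (by positivity)
  have hxe : x * (q * (p + 1)) = lam * q - p := div_mul_cancel₀ _ (by positivity)
  have hx1 : x < 1 := by
    rw [hx, div_lt_one (by positivity)]
    nlinarith
  refine ⟨1 - x, by linarith, by linarith, ?_⟩
  have h1 : 1 - p * x ≤ (1 - x) ^ p := by
    have := one_add_mul_le_pow (a := -x) (by linarith) p
    calc 1 - p * x = 1 + p * -x := by ring
      _ ≤ (1 + -x) ^ p := this
      _ = (1 - x) ^ p := by ring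
  -- Bernoulli for `1 + x`, together with `(1 - x) * (1 + x) ≤ 1`, bounds `(1 - x) ^ q` from above.
  have h2 : (1 - x) ^ q * (1 + q * x) ≤ 1 := by
    have h3 := one_add_mul_le_pow (a := x) (by linarith) q
    calc (1 - x) ^ q * (1 + q * x) ≤ (1 - x) ^ q * (1 + x) ^ q := by
          gcongr
      _ = (1 - x ^ 2) ^ q := by rw [← mul_pow]; ring
      _ ≤ 1 := pow_le_one₀ (by nlinarith) (by nlinarith)
  have h0 : 0 < lam := by
    by_contra! hc
    nlinarith
  have h4 : (p : ℝ) * x * (1 + q * x) < lam * (q * x) := by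
    have : (p : ℝ) * (1 + q * x) < lam * q := by nlinarith
    nlinarith
  have h5 : 0 < 1 + (q : ℝ) * x := by positivity
  have h6 : q * x ≤ (1 - (1 - x) ^ q) * (1 + q * x) := by nlinarith
  have h7 : (p : ℝ) * x < lam * (1 - (1 - x) ^ q) := by
    refine lt_of_mul_lt_mul_right ?_ h5.le
    nlinarith
  linarith

/-- All requirements on the parameters. -/
structure Params.Suitable (pr : Params) (ε lam y : ℝ) : Prop extends pr.Pos where
  approx : (pr.a : ℝ) / pr.b ≤ (1 + ε) * Real.log (1 / lam)
  exp_le : Real.exp (-((pr.Q : ℝ) ^ 2 / (pr.Q + 1) ^ 2 * (pr.a / pr.b))) ≤ pr.p / pr.q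
  y_pos : 0 < y
  y_lt : y < 1
  rate : ((1 - lam * (1 - y ^ pr.q)) / y ^ pr.p) ^ pr.A ≤ (1 / 2) ^ (pr.a + 3)

theorem exists_nat_div_btwn {x z : ℝ} (hx : 0 ≤ x) (h : x < z) :
    ∃ a b : ℕ, 0 < b ∧ x < (a : ℝ) / b ∧ (a : ℝ) / b < z := by
  obtain ⟨r, h1, h2⟩ := exists_rat_btwn h
  have hr : 0 ≤ r := by exact_mod_cast hx.trans h1.le
  have : ((r.num.toNat : ℝ) / r.den) = r := by
    have h3 : ((r.num.toNat : ℤ) : ℝ) = r.num := by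
      rw [Int.toNat_of_nonneg (Rat.num_nonneg.2 hr)]
    rw [Int.cast_natCast] at h3
    rw [h3, ← Rat.cast_def]
  exact ⟨r.num.toNat, r.den, r.den_pos, by rwa [this], by rwa [this]⟩

/-- The order of choice matters: `a / b` strictly between `log (1 / lam)` and `(1 + ε) * log (1 /
lam)`, then `Q` so large that the factor `(Q / (Q + 1)) ^ 2` does not use up this gap, then `p / q`
between the resulting exponential and `lam`, then `y` with tail base below 1, and finally `A` as its
exponent. -/
theorem exists_suitable {ε lam : ℝ} (hε : 0 < ε) (hlam : 0 < lam) (hlam1 : lam < 1) :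
    ∃ pr : Params, ∃ y, pr.Suitable ε lam y := by
  set ℓ := Real.log (1 / lam) with hℓ
  have hℓ0 : 0 < ℓ := Real.log_pos (by rw [lt_div_iff₀ hlam]; linarith)
  obtain ⟨a, b, hb, h1, h2⟩ := exists_nat_div_btwn hℓ0.le
    (show ℓ < (1 + ε) * ℓ by nlinarith)
  obtain ⟨Q, hQ0, hQ⟩ : ∃ Q : ℕ, 0 < Q ∧ ℓ < (Q : ℝ) ^ 2 / (Q + 1) ^ 2 * (a / b) := by
    have ht : Filter.Tendsto (fun Q : ℕ => ((Q : ℝ) / (Q + 1)) ^ 2 * ((a : ℝ) / b)) Filter.atTop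
        (nhds (1 ^ 2 * ((a : ℝ) / b))) :=
      ((tendsto_natCast_div_add_atTop (1 : ℝ)).pow 2).mul_const _
    rw [one_pow, one_mul] at ht
    obtain ⟨Q, h3, h4⟩ := ((ht.eventually (lt_mem_nhds h1)).and
      (Filter.eventually_gt_atTop 0)).exists
    exact ⟨Q, h4, by rwa [div_pow] at h3⟩
  have h3 : Real.exp (-((Q : ℝ) ^ 2 / (Q + 1) ^ 2 * (a / b))) < lam := by
    calc _ < Real.exp (-ℓ) := Real.exp_lt_exp.2 (by linarith)
      _ = lam := by rw [hℓ, one_div, Real.log_inv, neg_neg, Real.exp_log hlam]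
  obtain ⟨p, q, hq, h4, h5⟩ := exists_nat_div_btwn (Real.exp_nonneg _) h3
  obtain ⟨y, hy, hy1, h6⟩ := exists_pow_base hq hlam1 ((div_lt_iff₀ (by exact_mod_cast hq)).1 h5)
  obtain ⟨A, hA⟩ := exists_pow_lt_of_lt_one (y := (1 - lam * (1 - y ^ q)) / y ^ p)
    (show (0 : ℝ) < (1 / 2) ^ (a + 3) by positivity)
    (by rw [div_lt_one (by positivity)]; exact h6)
  have hA0 : 0 < A := by
    rcases Nat.eq_zero_or_pos A with rfl | h
    · have : ((1 : ℝ) / 2) ^ (a + 3) ≤ 1 := pow_le_one₀ (by norm_num) (by norm_num)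
      rw [pow_zero] at hA
      linarith
    · exact h
  exact ⟨⟨a, b, Q, p, q, A⟩, y, ⟨⟨hb, hQ0, hq, hA0⟩, h2.le, h4.le, hy, hy1, hA.le⟩⟩

/-! ### Number of rounds and word length -/

/-- A number of rounds that brings the threshold to zero. -/
def Params.rounds (pr : Params) (L : ℕ) : ℕ := pr.Q * (pr.A + 2 * L)

/-- By Bernoulli, `Q` rounds at least halve the threshold, and `A + 2 * L` halvings bring `A * n *
L` below 1. -/
theorem Params.rounds_spec {pr : Params} {n L : ℕ} (hQ : 0 < pr.Q) (hn : n < 2 ^ L) :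
    pr.A * n * L * pr.Q ^ pr.rounds L < (pr.Q + 1) ^ pr.rounds L := by
  have h1 : 2 * pr.Q ^ pr.Q ≤ (pr.Q + 1) ^ pr.Q := by
    have h3 : (1 : ℝ) + pr.Q * (1 / pr.Q) ≤ (1 + 1 / pr.Q) ^ pr.Q :=
      one_add_mul_le_pow (by have : (0 : ℝ) ≤ 1 / pr.Q := by positivity
                             linarith) _
    have hQ' : (0 : ℝ) < pr.Q := by exact_mod_cast hQ
    have h4 : (1 : ℝ) + 1 / pr.Q = (pr.Q + 1) / pr.Q := by field_simp
    rw [h4, div_pow, mul_one_div_cancel hQ'.ne', le_div_iff₀ (by positivity)] at h3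
    have : (2 : ℝ) * pr.Q ^ pr.Q ≤ (pr.Q + 1) ^ pr.Q := by linarith
    exact_mod_cast this
  have h2 : pr.A * n * L < 2 ^ (pr.A + 2 * L) := by
    have hA : pr.A < 2 ^ pr.A := Nat.lt_two_pow_self
    have hL : L < 2 ^ L := Nat.lt_two_pow_self
    calc pr.A * n * L < 2 ^ pr.A * 2 ^ L * 2 ^ L :=
          Nat.mul_lt_mul_of_le_of_lt (Nat.mul_le_mul hA.le hn.le) hL (by positivity)
      _ = 2 ^ (pr.A + 2 * L) := by ring
  calc pr.A * n * L * pr.Q ^ pr.rounds L < 2 ^ (pr.A + 2 * L) * pr.Q ^ pr.rounds L :=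
        Nat.mul_lt_mul_of_pos_right h2 (by positivity)
    _ = (2 * pr.Q ^ pr.Q) ^ (pr.A + 2 * L) := by rw [mul_pow, ← pow_mul]; rfl
    _ ≤ ((pr.Q + 1) ^ pr.Q) ^ (pr.A + 2 * L) := Nat.pow_le_pow_left h1 _
    _ = _ := by rw [← pow_mul]; rfl

/-- The factor between the word length and the length of the input numbers. -/
def Params.wordFactor (pr : Params) : ℕ :=
  2 + (8 * (pr.A * (pr.Q + 1)) + 8 * (pr.a + 1 + pr.b) + 32 + pr.p * pr.A + pr.q * pr.A +
    pr.A + pr.p + pr.q)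

/-- Every number that must fit is at most a constant times `(n + m) ^ 2`. The 2 in `wordFactor` pays
for the square, the rest for the constant. -/
theorem Params.fits {pr : Params} {G : CoverInstance} {w : ℕ} (hp : pr.Pos) (hn : 0 < G.n)
    (hw : pr.wordFactor * Nat.size (G.n + G.m) ≤ w) : Fits G pr (Nat.size G.n) (2 ^ w) := by
  set L := Nat.size G.n
  set K := 8 * (pr.A * (pr.Q + 1)) + 8 * (pr.a + 1 + pr.b) + 32 + pr.p * pr.A + pr.q * pr.A +
    pr.A + pr.p + pr.q with hK
  set z := Nat.size (G.n + G.m) with hz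
  have hz1 : 0 < z := Nat.size_pos.2 (by omega)
  have hnz : G.n + G.m < 2 ^ z := Nat.lt_size_self _
  have hL0 : 0 < L := Nat.size_pos.2 hn
  have hL : L ≤ G.n := Nat.size_le.2 Nat.lt_two_pow_self
  have hW : (G.n + G.m) * (G.n + G.m) * K < 2 ^ w := by
    calc (G.n + G.m) * (G.n + G.m) * K < (2 ^ z * 2 ^ z) * 2 ^ K :=
          Nat.mul_lt_mul_of_le_of_lt (Nat.mul_le_mul hnz.le hnz.le) Nat.lt_two_pow_self
            (by positivity)
      _ = 2 ^ (2 * z + K * 1) := by ring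
      _ ≤ 2 ^ (2 * z + K * z) := Nat.pow_le_pow_right (by norm_num) (by gcongr; omega)
      _ = 2 ^ (pr.wordFactor * z) := by rw [Params.wordFactor, ← hK]; ring
      _ ≤ 2 ^ w := Nat.pow_le_pow_right (by norm_num) hw
  have hnL : G.n * L ≤ (G.n + G.m) * (G.n + G.m) := Nat.mul_le_mul (by omega) (by omega)
  set X := (G.n + G.m) * (G.n + G.m) with hX
  have hX1 : G.n + G.m ≤ X := Nat.le_mul_of_pos_right _ (by omega)
  have hKX : X * K = 8 * (pr.A * X * (pr.Q + 1)) + 8 * ((pr.a + 1 + pr.b) * X) + 32 * X +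
      pr.p * (pr.A * X) + pr.q * (pr.A * X) + pr.A * X + pr.p * X + pr.q * X := by
    rw [hK]; ring
  have e1 : pr.A * G.n * L = pr.A * (G.n * L) := mul_assoc _ _ _
  have e2 : pr.A * (G.n * L) ≤ pr.A * X := Nat.mul_le_mul_left _ hnL
  have e3 : pr.A * (G.n * L) * (pr.Q + 1) ≤ pr.A * X * (pr.Q + 1) := Nat.mul_le_mul_right _ e2
  have e4 : pr.p * (pr.A * (G.n * L)) ≤ pr.p * (pr.A * X) := Nat.mul_le_mul_left _ e2
  have e5 : pr.q * (pr.A * (G.n * L)) ≤ pr.q * (pr.A * X) := Nat.mul_le_mul_left _ e2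
  have e6 : pr.A ≤ pr.A * X := Nat.le_mul_of_pos_right _ (by omega)
  have e7 : pr.p ≤ pr.p * X := Nat.le_mul_of_pos_right _ (by omega)
  have e8 : pr.q ≤ pr.q * X := Nat.le_mul_of_pos_right _ (by omega)
  have e9 : (pr.a + 1) * G.n + pr.b ≤ (pr.a + 1 + pr.b) * X := by
    have h1 : (pr.a + 1) * G.n ≤ (pr.a + 1) * X := Nat.mul_le_mul_left _ (by omega)
    have h2 : pr.b ≤ pr.b * X := Nat.le_mul_of_pos_right _ (by omega)
    rw [add_mul (pr.a + 1)]
    omega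
  have e10 : G.n ≤ pr.A * (G.n * L) := by
    have h1 : G.n ≤ G.n * L := Nat.le_mul_of_pos_right _ hL0
    exact h1.trans (Nat.le_mul_of_pos_left _ hp.A)
  have e11 : pr.Q + 1 ≤ pr.A * (G.n * L) * (pr.Q + 1) := Nat.le_mul_of_pos_left _ (by omega)
  constructor
  all_goals (try rw [e1])
  all_goals omega

theorem size_le_log {n : ℕ} (hn : 0 < n) : (Nat.size n : ℝ) ≤ 2 * (1 + Real.log n) := by
  have h1 : 2 ^ (Nat.size n - 1) ≤ n := Nat.lt_size.1 (by have := Nat.size_pos.2 hn; omega)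
  have hs : 1 ≤ Nat.size n := Nat.size_pos.2 hn
  have h2 : (2 : ℝ) ^ (Nat.size n - 1) ≤ n := by exact_mod_cast h1
  have h3 := Real.log_le_log (by positivity) h2
  rw [Real.log_pow, Nat.cast_sub hs, Nat.cast_one] at h3
  have h4 := Real.log_two_gt_d9
  have h5 : (1 : ℝ) ≤ Nat.size n := by exact_mod_cast hs
  nlinarith

/-! ### The complete algorithm -/

/-- The sampling loop, to be placed at address `l`. -/
def sampleCode (l : ℕ) : List Instr :=
  [.rand 1 (2 * Var.m.ctorIdx), .store (2 * Var.ad.ctorIdx) 1,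
    .arith .add (2 * Var.ad.ctorIdx) (2 * Var.ad.ctorIdx) (2 * Var.eight.ctorIdx),
    .jumpLt (2 * Var.ad.ctorIdx) (2 * Var.en.ctorIdx) l]

/-- The configuration after `j` passes of the sampling loop, with memory `f`. -/
def sampleConfig (c : Config) (S j : ℕ) (f : ℕ → ℕ) : Config where
  pc := if j = 0 ∨ j < S then c.pc else c.pc + 4
  reg := Function.update (Function.update c.reg 1 (if j = 0 then c.reg 1 else f (8 * (j - 1))))
    (2 * Var.ad.ctorIdx) (8 * j)
  mem := f
  out := c.out

/-- One pass is four steps. The address is advanced before the test, so the pass with `j + 1 = S`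
falls through to the instruction after the loop. -/
theorem sampleConfig_step {P : Program} {G : CoverInstance} {w S j : ℕ} {c : Config} {f : ℕ → ℕ}
    (hc : CodeAt P c.pc (sampleCode c.pc)) (hm : c.reg (2 * Var.m.ctorIdx) = G.m)
    (hen : c.reg (2 * Var.en.ctorIdx) = 8 * S) (h8 : c.reg (2 * Var.eight.ctorIdx) = 8)
    (hS : 8 * S < 2 ^ w) (hj : j < S) :
    runFrom P G w (sampleConfig c S j f) 4 = (uniformBelow G.m).map fun x =>
      sampleConfig c S (j + 1) (Function.update f (8 * j) (x % 2 ^ w)) := by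
  rw [show 4 = 1 + 3 from rfl, runFrom_add, runFrom_one]
  have hpc : (sampleConfig c S j f).pc = c.pc := if_pos (.inr hj)
  have h1 : step P G w (sampleConfig c S j f) = (uniformBelow G.m).map fun x =>
      (sampleConfig c S j f).write w 1 x := by
    rw [step, hpc, hc.head]
    simp only [exec]
    congr 2
  rw [h1, PMF.bind_map, ← PMF.bind_pure_comp]
  congr 1
  funext x
  have hc' : CodeAt P ((sampleConfig c S j f).write w 1 x).pc
      ([.store (2 * Var.ad.ctorIdx) 1, .arith .add (2 * Var.ad.ctorIdx) (2 * Var.ad.ctorIdx)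
        (2 * Var.eight.ctorIdx)] ++ [.jumpLt (2 * Var.ad.ctorIdx) (2 * Var.en.ctorIdx) c.pc]) := by
    have := hc.tail
    simp only [Config.write, hpc]
    exact this
  have r1 := Reach.block (G := G) (w := w) hc'.left rfl
  have p1 := foldl_direct_pc G w ((sampleConfig c S j f).write w 1 x)
    (code := [.store (2 * Var.ad.ctorIdx) 1, .arith .add (2 * Var.ad.ctorIdx)
      (2 * Var.ad.ctorIdx) (2 * Var.eight.ctorIdx)]) rfl
  have r2 := Reach.jump (G := G) (w := w) (p1 ▸ hc'.right.head)
  change Reach P G w ((sampleConfig c S j f).write w 1 x) 3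
    (sampleConfig c S (j + 1) (Function.update f (8 * j) (x % 2 ^ w)))
  convert r1.trans r2 using 1
  · rfl
  have had : 2 * Var.ad.ctorIdx = 10 := rfl
  have hen' : 2 * Var.en.ctorIdx = 12 := rfl
  have h8' : 2 * Var.eight.ctorIdx = 14 := rfl
  rw [hen'] at hen
  rw [h8'] at h8
  simp only [sampleConfig, directExec, Config.write, ArithOp.eval, had, hen', h8', List.foldl_cons,
    List.foldl_nil]
  have h16 : (8 * j + 8) % 2 ^ w = 8 * (j + 1) := by
    rw [Nat.mod_eq_of_lt (by omega)]; ring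
  simp [hen, h8, h16, hj]
  funext r
  by_cases h10 : r = 10
  · subst h10; simp
  · by_cases h1 : r = 1
    · subst h1; simp
    · simp [h10, h1]

theorem runFrom_sampleConfig {P : Program} {G : CoverInstance} {w S : ℕ} {c : Config}
    (hc : CodeAt P c.pc (sampleCode c.pc)) (hm : c.reg (2 * Var.m.ctorIdx) = G.m)
    (had : c.reg (2 * Var.ad.ctorIdx) = 0)
    (hen : c.reg (2 * Var.en.ctorIdx) = 8 * S) (h8 : c.reg (2 * Var.eight.ctorIdx) = 8)
    (hS : 8 * S < 2 ^ w) {j : ℕ} (hj : j ≤ S) :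
    runFrom P G w c (4 * j) = (sampleMem G.m (2 ^ w) c.mem j).map (sampleConfig c S j) := by
  induction j with
  | zero =>
    have : sampleConfig c S 0 c.mem = c := by
      rcases c with ⟨pc, reg, mem, out⟩
      simp only [sampleConfig, Config.mk.injEq, and_true, true_or, if_true]
      refine ⟨trivial, ?_⟩
      funext r
      by_cases hr : r = 2 * Var.ad.ctorIdx
      · subst hr; simpa using had.symm
      · simp [Function.update_of_ne hr]
    rw [sampleMem, PMF.pure_map, this]
    rfl
  | succ j ih =>
    rw [mul_add, mul_one, runFrom_add, ih (by omega), PMF.bind_map, sampleMem, PMF.map_bind]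
    congr 1
    funext f
    rw [Function.comp_apply, sampleConfig_step hc hm hen h8 hS hj, PMF.map_comp]
    rfl

/-- The whole program. -/
def program (pr : Params) : Program :=
  let u := (setupCmd pr).compile 0
  u ++ (sampleCode u.length ++ (solveCmd pr).compile (u.length + 4))

/-- The number of steps after which the machine has halted for sure. -/
def totalTime (G : CoverInstance) (pr : Params) : ℕ :=
  ((setupCmd pr).compile 0).length * (3 * Nat.size G.n + 9) +
    4 * (pr.A * G.n * Nat.size G.n) + ((solveCmd pr).compile
      (((setupCmd pr).compile 0).length + 4)).length *
      ((Nat.size G.n + 1) * passTime G pr (Nat.size G.n) (pr.rounds (Nat.size G.n)))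

/-- For each fixed memory of samples the remaining run is deterministic. Padding all runs to a
common length makes the final distribution the image of the sample distribution. -/
theorem exists_run_eq_map {G : CoverInstance} {pr : Params} {w : ℕ} {ε lam y : ℝ}
    (hp : pr.Suitable ε lam y) (hn : 0 < G.n) (hf : Fits G pr (Nat.size G.n) (2 ^ w)) :
    ∃ (t : ℕ) (mem : ℕ → ℕ) (fin : (ℕ → ℕ) → Config), t ≤ totalTime G pr ∧
      run (program pr) G w t =
        (sampleMem G.m (2 ^ w) mem (pr.A * G.n * Nat.size G.n)).map fin ∧
      ∀ f ∈ (sampleMem G.m (2 ^ w) mem (pr.A * G.n * Nat.size G.n)).support,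
        Halted (program pr) (fin f) ∧
          GoodOutput G pr (Nat.size G.n) (fun j => f (8 * j)) (fin f).out := by
  have f1 := hf.edges
  have f6 := hf.n_le
  set L := Nat.size G.n with hL
  set u := (setupCmd pr).compile 0 with hu
  set v := (solveCmd pr).compile (u.length + 4) with hv
  set S := pr.A * G.n * L with hS
  have f1' : S * (pr.Q + 1) = S * pr.Q + S := by ring
  have hSW : 8 * S < 2 ^ w := by omega
  have hW : 1 < 2 ^ w := by omega
  have hnW : G.n < 2 ^ w := by omega
  have hP : program pr = u ++ (sampleCode u.length ++ v) := rfl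
  have hPc : CodeAt (program pr) 0 (u ++ (sampleCode u.length ++ v)) :=
    ⟨[], [], by simp [hP], rfl⟩
  set σ₀ : St := ⟨fun _ => 0, fun _ _ => 0, [], 0⟩
  have hsim : Sim w Config.init σ₀ :=
    ⟨fun _ => rfl, fun _ _ => rfl, rfl, fun _ => by positivity, fun _ => by positivity⟩
  obtain ⟨σ₁, hx1, n1, m1, L1, ad1, en1, e1, t1⟩ := setupCmd_spec (σ := σ₀) hf hn
  have fout : σ₁.out = [] := hx1.frame.out rfl
  obtain ⟨t₁, c₁, r1, p1, s1, b1⟩ := hx1.reach hW hnW hf.elems (P := program pr) (K := u.length)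
    (c := Config.init) hPc.left le_rfl hsim
  replace p1 : c₁.pc = u.length := by rw [p1]; simp [Config.init, hu]
  have hloop := runFrom_sampleConfig (P := program pr) (G := G) (w := w) (S := S) (c := c₁)
    (by rw [p1]; simpa using hPc.right.left) (by rw [s1.var, m1]) (by rw [s1.var, ad1])
    (by rw [s1.var, en1]) (by rw [s1.var, e1]) hSW le_rfl
  have hS0 : ¬ (S = 0 ∨ S < S) := by omega
  have hsolve : ∀ f ∈ (sampleMem G.m (2 ^ w) c₁.mem S).support, ∃ c, Reach (program pr) G w
      (sampleConfig c₁ S S f) (v.length * ((L + 1) * passTime G pr L (pr.rounds L))) c ∧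
      Halted (program pr) c ∧ GoodOutput G pr L (fun j => f (8 * j)) c.out := by
    intro f hfs
    obtain ⟨hfW, hfm⟩ := sampleMem_support (by positivity) s1.mem_lt hfs
    set c₂ := sampleConfig c₁ S S f with hc₂
    have p2 : c₂.pc = u.length + 4 := by
      rw [← p1]; exact if_neg hS0
    -- The structured state is read off the machine after the sampling, with the clock restarted.
    -- The array `smp` has offset 0, so its cells are the addresses `8 * j` that the loop has
    -- filled.
    set σ₂ : St := ⟨fun x => c₂.reg (2 * x.ctorIdx), fun a i => f (8 * i + a.ctorIdx), [], 0⟩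
      with hσ₂
    have hreg : ∀ x : Var, x ≠ .ad → c₂.reg (2 * x.ctorIdx) = σ₁.var x := by
      intro x hx
      have h1 : 2 * x.ctorIdx ≠ 2 * Var.ad.ctorIdx := fun h =>
        hx (Var.ctorIdx_injective (by omega))
      simp only [hc₂, sampleConfig, Function.update_of_ne h1]
      rw [Function.update_of_ne (by omega), s1.var]
    have s2 : Sim w c₂ σ₂ := by
      refine ⟨fun _ => rfl, fun _ _ => rfl, s1.out.trans fout, fun r => ?_, hfW⟩
      simp only [hc₂, sampleConfig]
      by_cases hr : r = 2 * Var.ad.ctorIdx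
      · subst hr; simpa using hSW
      · rw [Function.update_of_ne hr]
        by_cases hr1 : r = 1
        · subst hr1
          rw [Function.update_self]
          split_ifs
          · exact s1.reg_lt _
          · exact hfW _
        · rw [Function.update_of_ne hr1]; exact s1.reg_lt r
    obtain ⟨σ₃, hx3, ho3, t3⟩ := solveCmd_spec (σ := σ₂) (W := 2 ^ w) (R := pr.rounds L)
      hp.toPos hf hn (Nat.lt_size_self _) ((hreg .n (by decide)).trans n1)
      ((hreg .m (by decide)).trans m1) ((hreg .L (by decide)).trans L1) rfl
      hfm (Params.rounds_spec hp.Q (Nat.lt_size_self _)) hp.exp_le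
    obtain ⟨t, c₃, r3, p3, s3, b3⟩ := hx3.reach hW hnW hf.elems (P := program pr) (K := v.length)
      (c := c₂) (by rw [p2]; simpa [sampleCode] using hPc.right.right) (by rw [p2]) s2
    have hh : Halted (program pr) c₃ := by
      rw [Halted, p3, p2, hP]
      simp [sampleCode, hv]
      omega
    have hb : t ≤ v.length * ((L + 1) * passTime G pr L (pr.rounds L)) := by
      have h1 : σ₂.tm = 0 := rfl
      rw [h1] at t3 b3
      have := Nat.mul_le_mul_left v.length t3
      rw [Nat.zero_add] at this
      omega
    obtain ⟨d, hd⟩ := Nat.exists_eq_add_of_le hb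
    refine ⟨c₃, ?_, hh, ?_⟩
    · rw [hd]; exact r3.trans (Reach.of_halted hh d)
    · rw [s3.out]; exact ho3
  have : Nonempty Config := ⟨Config.init⟩
  choose! fin hfin using hsolve
  refine ⟨t₁ + 4 * S + v.length * ((L + 1) * passTime G pr L (pr.rounds L)), c₁.mem, fin, ?_, ?_,
    fun f hf' => (hfin f hf').2⟩
  · have h1 : σ₀.tm = 0 := rfl
    rw [h1, zero_add, ← hL] at t1
    rw [h1] at b1
    have := Nat.mul_le_mul_left u.length t1
    change _ ≤ u.length * (3 * L + 9) + 4 * S +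
      v.length * ((L + 1) * passTime G pr L (pr.rounds L))
    omega
  · rw [run_eq_runFrom, runFrom_add, runFrom_add, r1, PMF.pure_bind, hloop, PMF.bind_map,
      ← PMF.bind_pure_comp]
    ext c
    simp only [PMF.bind_apply]
    refine tsum_congr fun f => ?_
    -- `fin f` is specified only on the support; elsewhere both terms have weight 0.
    by_cases hf' : f ∈ (sampleMem G.m (2 ^ w) c₁.mem S).support
    · congr 1
      exact congrArg (fun p : PMF Config => p c) (hfin f hf').1
    · rw [PMF.mem_support_iff, not_not] at hf'
      simp [hf']

/-- If the sample is not bad, a family that misses few samples misses fewer than `lam * m` elements.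
Its size is at most `a * k / b` rounded up, where `k` is at most the size of any cover. -/
theorem correct_of_goodOutput {G : CoverInstance} {pr : Params} {ε lam : ℝ} {f : ℕ → ℕ}
    {c : Config} {L : ℕ} (hb : 0 < pr.b)
    (hab : (pr.a : ℝ) / pr.b ≤ (1 + ε) * Real.log (1 / lam))
    (hg : GoodOutput G pr L (fun j => f (8 * j)) c.out) (hbad : 0 < G.m → ¬ BadSample G pr L lam f) :
    Correct G lam ((1 + ε) * Real.log (1 / lam)) c := by
  rcases Nat.eq_zero_or_pos G.m with hm | hm
  · have hout := hg.1 hm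
    have hfam : outputFamily G c = ∅ := by simp [outputFamily, hout]
    refine ⟨by simp [hout], by simp [hm], fun T _ => by simp [hfam]⟩
  obtain ⟨k, hk, hkn, hl, hT⟩ := hg.2 hm
  refine ⟨hl.lt, ?_, fun T hT' => ?_⟩
  · have hb' : ¬ lam * G.m ≤ (((Finset.range G.m).filter fun x => ∀ u ∈ c.out,
        u ∉ G.owners x).card : ℝ) := fun h => hbad hm ⟨k, c.out, hk, hkn, hl, h⟩
    push Not at hb'
    have hcov : G.coverage (outputFamily G c) + ((Finset.range G.m).filter fun x => ∀ u ∈ c.out,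
        u ∉ G.owners x).card = G.m := by
      have h1 : ((Finset.range G.m).filter fun x => ∀ u ∈ c.out, u ∉ G.owners x).card =
          (G.covered (outputFamily G c))ᶜ.card := by
        rw [← Finset.card_map Fin.valEmbedding]
        congr 1
        ext x
        simp only [Finset.mem_filter, Finset.mem_range, Finset.mem_map, Finset.mem_compl,
          mem_covered, outputFamily, Finset.mem_univ, true_and, Fin.valEmbedding_apply]
        constructor
        · rintro ⟨hx, h⟩
          exact ⟨⟨x, hx⟩, fun ⟨u, hu, hu'⟩ => h u hu hu', rfl⟩
        · rintro ⟨v, h, rfl⟩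
          exact ⟨v.2, fun u hu hu' => h ⟨⟨u, hl.lt u hu⟩, hu, hu'⟩⟩
      rw [h1, CoverInstance.coverage, Finset.card_add_card_compl, Fintype.card_fin]
    have hcov' : (G.coverage (outputFamily G c) : ℝ) + (((Finset.range G.m).filter fun x =>
        ∀ u ∈ c.out, u ∉ G.owners x).card : ℝ) = G.m := by exact_mod_cast hcov
    linarith
  · have h1 : (outputFamily G c).card ≤ c.out.length := by
      refine le_trans ?_ (List.toFinset_card_le c.out)
      refine Finset.card_le_card_of_injOn Fin.val (fun i hi => ?_) Fin.val_injective.injOn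
      simpa [outputFamily] using hi
    refine h1.trans (hl.length_le.trans ?_)
    unfold Params.picks
    set X := ⌈(1 + ε) * Real.log (1 / lam) * (T.card : ℝ)⌉₊ with hX
    have hb' : (0 : ℝ) < pr.b := by exact_mod_cast hb
    -- `X` is an integer above `a * k / b`, hence also above the rounded-up quotient.
    have h2 : (pr.a : ℝ) * k ≤ X * pr.b := by
      have h3 : (k : ℝ) ≤ T.card := by exact_mod_cast hT T hT'
      have h4 : (pr.a : ℝ) / pr.b * k ≤ X :=
        calc (pr.a : ℝ) / pr.b * k ≤ (pr.a : ℝ) / pr.b * T.card := by gcongr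
          _ ≤ (1 + ε) * Real.log (1 / lam) * T.card := by gcongr
          _ ≤ X := Nat.le_ceil _
      rw [div_mul_eq_mul_div, div_le_iff₀ hb'] at h4
      exact h4
    have h5 : pr.a * k ≤ X * pr.b := by exact_mod_cast h2
    rw [Nat.div_le_iff_le_mul_add_pred hb, mul_comm pr.b]
    omega

/-- A constant factor in the running time. -/
def Params.timeFactor (pr : Params) : ℕ :=
  ((setupCmd pr).compile 0).length * 12 + 4 * pr.A + ((solveCmd pr).compile
    (((setupCmd pr).compile 0).length + 4)).length * (2 *
      ((40 * (pr.Q * (pr.A + 2) + 1) + 3 * (pr.a + 1) + 11) * (pr.A * (pr.Q + 1))))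

/-- The three factors `L` come from the number of samples, the number of thresholds and the number
of passes of the binary search. -/
theorem totalTime_le {G : CoverInstance} (pr : Params) (hn : 0 < G.n) :
    totalTime G pr ≤ pr.timeFactor * (G.n * Nat.size G.n ^ 3) := by
  set L := Nat.size G.n with hL
  have hL1 : 1 ≤ L := Nat.size_pos.2 hn
  set X := G.n * L ^ 3 with hX
  have hLX : L ≤ X := by
    calc L = 1 * L ^ 1 := by ring
      _ ≤ G.n * L ^ 3 := Nat.mul_le_mul hn (Nat.pow_le_pow_right hL1 (by norm_num))
  have hnLX : G.n * L ≤ X := by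
    calc G.n * L = G.n * L ^ 1 := by ring
      _ ≤ G.n * L ^ 3 := Nat.mul_le_mul le_rfl (Nat.pow_le_pow_right hL1 (by norm_num))
  have h1 : 3 * L + 9 ≤ 12 * X := by omega
  have h2 : (L + 1) * passTime G pr L (pr.rounds L) ≤ 2 *
      ((40 * (pr.Q * (pr.A + 2) + 1) + 3 * (pr.a + 1) + 11) * (pr.A * (pr.Q + 1))) * X := by
    have h3 : pr.rounds L ≤ pr.Q * (pr.A + 2) * L := by
      unfold Params.rounds
      rw [mul_assoc]
      refine Nat.mul_le_mul_left _ ?_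
      rw [add_mul]
      have : pr.A ≤ pr.A * L := Nat.le_mul_of_pos_right _ hL1
      omega
    have h4 : 40 * (pr.rounds L + 1) + 3 * (pr.a + 1) + 11 ≤
        (40 * (pr.Q * (pr.A + 2) + 1) + 3 * (pr.a + 1) + 11) * L := by
      have h5 : 3 * (pr.a + 1) ≤ 3 * (pr.a + 1) * L := Nat.le_mul_of_pos_right _ hL1
      have h6 : (40 * (pr.Q * (pr.A + 2) + 1) + 3 * (pr.a + 1) + 11) * L =
        40 * (pr.Q * (pr.A + 2) * L) + 40 * L + 3 * (pr.a + 1) * L + 11 * L := by ring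
      omega
    calc (L + 1) * passTime G pr L (pr.rounds L)
        ≤ (2 * L) * (((40 * (pr.Q * (pr.A + 2) + 1) + 3 * (pr.a + 1) + 11) * L) *
          (pr.A * G.n * L * (pr.Q + 1))) :=
          Nat.mul_le_mul (by omega) (Nat.mul_le_mul_right _ h4)
      _ = _ := by rw [hX]; ring
  have h7 : pr.A * G.n * L ≤ pr.A * X := by
    rw [mul_assoc]; exact Nat.mul_le_mul_left _ hnLX
  unfold totalTime Params.timeFactor
  rw [← hL]
  set ul := ((setupCmd pr).compile 0).length
  set vl := ((solveCmd pr).compile (ul + 4)).length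
  have h8 := Nat.mul_le_mul_left ul h1
  have h9 := Nat.mul_le_mul_left vl h2
  calc _ ≤ ul * (12 * X) + 4 * (pr.A * X) + vl * (2 *
      ((40 * (pr.Q * (pr.A + 2) + 1) + 3 * (pr.a + 1) + 11) * (pr.A * (pr.Q + 1))) * X) := by
        omega
    _ = _ := by ring

end OutlierCover

/-! ### Conclusion -/

open OutlierCover

theorem mainTheorem4 :
    ∃ p : ℕ, ∀ ε lam : ℝ, 0 < ε → ε ≤ 1 → 0 < lam → lam < 1 →
      ∃ (P : OutlierCover.Program) (κ : ℕ) (C : ℝ),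
        ∀ G : OutlierCover.CoverInstance, 0 < G.n →
          ∀ w : ℕ, κ * Nat.size (G.n + G.m) ≤ w →
            ∃ t : ℕ, (t : ℝ) ≤ C * (G.n : ℝ) * (1 + Real.log (G.n : ℝ)) ^ p ∧
              (∀ c ∈ (OutlierCover.run P G w t).support, OutlierCover.Halted P c) ∧
              1 - (G.n : ℝ≥0∞)⁻¹ ≤ (OutlierCover.run P G w t).toOuterMeasure
                {c | OutlierCover.Correct G lam ((1 + ε) * Real.log (1 / lam)) c} := by
  refine ⟨3, fun ε lam hε _ hlam hlam1 => ?_⟩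
  obtain ⟨pr, y, hp⟩ := exists_suitable hε hlam hlam1
  -- The 8 is `2 ^ 3`, from `size n ≤ 2 * (1 + log n)` in the third power.
  refine ⟨program pr, pr.wordFactor, pr.timeFactor * 8, fun G hn w hw => ?_⟩
  have hf := Params.fits hp.toPos hn hw
  obtain ⟨t, mem, fin, ht, hrun, hfin⟩ := exists_run_eq_map hp hn hf
  refine ⟨t, ?_, ?_, ?_⟩
  · have h1 : (t : ℝ) ≤ pr.timeFactor * (G.n * Nat.size G.n ^ 3) := by
      exact_mod_cast ht.trans (totalTime_le pr hn)
    have h2 : (Nat.size G.n : ℝ) ^ 3 ≤ (2 * (1 + Real.log G.n)) ^ 3 :=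
      pow_le_pow_left₀ (Nat.cast_nonneg _) (size_le_log hn) 3
    calc (t : ℝ) ≤ pr.timeFactor * (G.n * Nat.size G.n ^ 3) := h1
      _ ≤ pr.timeFactor * (G.n * (2 * (1 + Real.log G.n)) ^ 3) := by gcongr
      _ = _ := by ring
  · intro c hc
    rw [hrun, PMF.mem_support_map_iff] at hc
    obtain ⟨f, hf', rfl⟩ := hc
    exact (hfin f hf').1
  · rw [hrun, PMF.toOuterMeasure_map_apply]
    set μ := sampleMem G.m (2 ^ w) mem (pr.A * G.n * Nat.size G.n)
    set good := fin ⁻¹' {c | Correct G lam ((1 + ε) * Real.log (1 / lam)) c}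
    rcases Nat.eq_zero_or_pos G.m with hm | hm
    · have : μ.toOuterMeasure good = 1 := by
        rw [PMF.toOuterMeasure_apply_eq_one_iff]
        intro f hf'
        exact correct_of_goodOutput hp.b hp.approx (hfin f hf').2 fun h => by omega
      rw [this]; exact tsub_le_self
    -- Every sample in the support is bad or leads to a correct output, so the good event misses at
    -- most the probability of bad samples.
    · have h1 : μ.toOuterMeasure (good ∪ {f | BadSample G pr (Nat.size G.n) lam f}) = 1 := by
        rw [PMF.toOuterMeasure_apply_eq_one_iff]
        intro f hf'
        by_cases hbad : BadSample G pr (Nat.size G.n) lam f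
        · exact .inr hbad
        · exact .inl (correct_of_goodOutput hp.b hp.approx (hfin f hf').2 fun _ => hbad)
      have h2 := badSample_le hp.toPos hn hm hf.elems.le (Nat.lt_size_self G.n) mem hlam hlam1
        hp.y_pos hp.y_lt hp.rate
      rw [tsub_le_iff_right, ← h1]
      exact (MeasureTheory.measure_union_le _ _).trans (add_le_add le_rfl h2)
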